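/- Let $n,m\in\mathbb R$, $\mathcal B>0$, $q:=m-n+1$, and suppose $1<q<2$. For $0<\alpha<1$ let $k_\alpha$ be the unique positive periodic solution on $\mathbb R$ of $$k''+\frac{k^q-1}{q}=0,\qquad k(0)=\alpha,\quad k'(0)=0,$$ let $P(\alpha)$ be its least period, $A(\alpha)=\int_0^{P(\alpha)}k_\alpha\,dx$, and $E(\alpha)=P(\alpha)^{3-q}A(\alpha)^{q-1}$. Let $h_{\rm ss}\in C^4(\mathbb R)$ be a non-constant positive periodic steady state of $h_t=-(h^nh_{xxx})_x-\mathcal B(h^mh_x)_x$ with least period $X$, and let $x_0$ be a point where $h_{\rm ss}$ attains its minimum. Then the translate $h(x)=h_{\rm ss}(x_0+x)$ rescales to $k_\alpha$ for some $\alpha\in(0,1)$; that is, for some constant $D>0$, $$h''+\frac{\mathcal B h^q-D}{q}=0\quad\text{and}\quad k_\alpha(x)=\Big(\frac{\mathcal B}{D}\Big)^{1/q}h\Big(\Big(\frac{D}{\mathcal B}\Big)^{1/(2q)}\frac{x}{D^{1/2}}\Big)\quad\text{for all }x\in\mathbb R.$$ If moreover $E'(\alpha)<0$ for such an $\alpha$,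 then $h_{\rm ss}$ is energy stable: for every function $H$ with $H''(y)=\mathcal B y^{m-n}$ on $(0,\infty)$, and with $$\mathcal E(\ell)=\int_0^X\Big[\tfrac12(\ell')^2-H(\ell)\Big]dx,$$ every $X$-periodic $u\in H^1(\mathbb R/X\mathbb Z)\setminus\{0\}$ with $\int_0^Xu\,dx=0$ satisfies $\mathcal E(h_{\rm ss}+\varepsilon u)>\mathcal E(h_{\rm ss})$ for all sufficiently small $\varepsilon>0$ (how small may depend on $u$). -/

import Mathlib

open Set Filter Topology MeasureTheory
open scoped ContDiff

namespace ThinFilm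

/-- `h` is a positive classical (`C⁴`) steady state on the line of the evolution equation
`h_t = -(f(h) h_xxx)_x - (g(h) h_x)_x`. -/
def IsPositiveSteadyState (f g h : ℝ → ℝ) : Prop :=
  ContDiff ℝ 4 h ∧ (∀ x, 0 < h x) ∧
    ∀ x, deriv (fun y => f (h y) * iteratedDeriv 3 h y) x
      + deriv (fun y => g (h y) * deriv h y) x = 0

/-- `X` is the least period of `h` (among the strictly positive ones). -/
def IsLeastPeriod (h : ℝ → ℝ) (X : ℝ) : Prop :=
  IsLeast {T : ℝ | 0 < T ∧ Function.Periodic h T} X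

/-- `H'' = r` on the half-line `(0, ∞)`. -/
def IsSecondAntiderivative (r H : ℝ → ℝ) : Prop :=
  ∃ H₁ : ℝ → ℝ, ∀ y, 0 < y → HasDerivAt H (H₁ y) y ∧ HasDerivAt H₁ (r y) y

/-- `u` (viewed as an `X`-periodic function on the line) belongs to `H¹` of the circle of
circumference `X`, with weak derivative `v`. -/
structure IsH1Circle (X : ℝ) (u v : ℝ → ℝ) : Prop where
  periodic : Function.Periodic u X
  periodic_deriv : Function.Periodic v X
  memLp : MemLp u 2 (volume.restrict (Ioc 0 X))
  memLp_deriv : MemLp v 2 (volume.restrict (Ioc 0 X))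
  weak_deriv : ∀ φ : ℝ → ℝ, ContDiff ℝ ∞ φ → HasCompactSupport φ →
    ∫ x, u x * deriv φ x = -∫ x, v x * φ x

/-- The energy `∫₀ˣ [½ (ℓ')² - H(ℓ)] dx` of `ℓ ∈ H¹`; the argument `dl` is the (weak)
derivative of `l`. -/
noncomputable def energy (X : ℝ) (H l dl : ℝ → ℝ) : ℝ :=
  ∫ x in (0 : ℝ)..X, ((1 / 2) * dl x ^ 2 - H (l x))

/-- Energy stability of `h` with respect to zero-mean perturbations at period `X`. -/
def EnergyStable (X : ℝ) (H h : ℝ → ℝ) : Prop :=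
  ∀ u v : ℝ → ℝ, IsH1Circle X u v → ¬ (u =ᵐ[volume] 0) → (∫ x in (0 : ℝ)..X, u x) = 0 →
    ∀ᶠ ε : ℝ in 𝓝[>] 0,
      energy X H h (deriv h) < energy X H (fun x => h x + ε * u x) (fun x => deriv h x + ε * v x)

/-- `k` is a positive periodic solution of the canonical oscillator
`k'' + (k^q - 1)/q = 0`, `k(0) = α`, `k'(0) = 0` (for `q ≠ 0`). -/
def IsCanonicalSolution (q α : ℝ) (k : ℝ → ℝ) : Prop :=
  ContDiff ℝ 2 k ∧ (∀ x, 0 < k x) ∧ (∃ T, 0 < T ∧ Function.Periodic k T) ∧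
    (∀ x, iteratedDeriv 2 k x + (k x ^ q - 1) / q = 0) ∧ k 0 = α ∧ deriv k 0 = 0

/-- The function `k_α`: the solution of the canonical oscillator problem, which exists and is
unique for `0 < α < 1`. -/
noncomputable def canonicalSolution (q α : ℝ) : ℝ → ℝ :=
  Classical.epsilon (IsCanonicalSolution q α)

/-- `P(α)`, the least period of `k_α`. -/
noncomputable def period (q α : ℝ) : ℝ :=
  sInf {T : ℝ | 0 < T ∧ Function.Periodic (canonicalSolution q α) T}

/-- `A(α)`, the area under one period of `k_α`. -/
noncomputable def area (q α : ℝ) : ℝ :=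
  ∫ x in (0 : ℝ)..(period q α), canonicalSolution q α x

/-- `E(α) = P(α)^(3 - q) A(α)^(q - 1)`. -/
noncomputable def stabilityFunction (q α : ℝ) : ℝ :=
  period q α ^ (3 - q) * area q α ^ (q - 1)

/-- A function `h` solving `h'' + (B h^q - D)/q = 0` for some `D > 0` rescales to `k_α`:
`k_α(x) = (B/D)^(1/q) h((D/B)^(1/(2q)) x / D^(1/2))`. -/
def RescalesTo (q B α : ℝ) (h : ℝ → ℝ) : Prop :=
  ∃ D : ℝ, 0 < D ∧ (∀ x, iteratedDeriv 2 h x + (B * h x ^ q - D) / q = 0) ∧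
    ∀ x, canonicalSolution q α x =
      (B / D) ^ (1 / q) * h ((D / B) ^ (1 / (2 * q)) * (x / D ^ ((1 : ℝ) / 2)))

end ThinFilm

namespace ThinFilm

/-! The flux of a periodic steady state vanishes, so h'' + (B h^q - D)/q = 0, and scaling turns h
into k_α. Stability becomes a question about the form Q(u) = ∫ u'² - V u², with V = k^(q-1), on
zero-mean periodic u.

Write the potential U as Y²/2 and let g be the inverse of Y. The orbit of amplitude r is k = g(r sin
θ), k' = r cos θ, θ' = 1/g'(r sin θ), so that period P and area A are integrals over a fixed
interval, differentiable in r. Since g'' is increasing (`IsMorse.strictMonoOn`, a form of Chicone's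
criterion), P_r > 0. The minimum α decreases in r, hence E'(α) < 0 means (3-q) A P_r + (q-1) P A_r >
0.

The amplitude derivative w = ∂k/∂r solves the linearised equation. Because P_r > 0, one period
splits into an interval about a minimum where -w > 0 and an interval about a maximum where a
recentred copy of w is positive (`IsOrbit.exists_split`). By Jacobi's identity Q is positive
definite on functions vanishing at the two division points. A general zero-mean u is moved into that
space by adding multiples of k', which is odd about the minimum, and of an even periodic ψ with ψ''
+ Vψ = 1. The kernel element k' is Q-orthogonal to everything and ψ to zero-mean functions, so Q(u)
= Q(u + c k' + d ψ) + d² ∫ψ. The sign of ∫ψ is that of (3-q) A P_r + (q-1) P A_r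
(`IsOrbit.exists_certificate`). Thus Q ≥ 0, with equality only on multiples of k'
(`IsStabilityCertificate.form_nonneg`).

If Q(u) > 0, Taylor expansion gives the energy increase. If u is a multiple of h', evenness of h
gives equal energies at h + δh' and h - δh', and strict concavity of y^(q-1) for 1 < q < 2 makes the
sum of these two energies exceed twice the energy of h (`IsProfile.energy_lt_translation`). -/

/-! ### The potential of the oscillator and its Morse coordinate. -/

theorem analyticAt_dslope {f : ℝ → ℝ} {a x : ℝ} (hfx : AnalyticAt ℝ f x) (hfa : AnalyticAt ℝ f a) :
    AnalyticAt ℝ (dslope f a) x := by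
  rcases eq_or_ne x a with rfl | hxa
  · obtain ⟨p, hp⟩ := hfx
    exact ⟨_, hp.has_fpower_series_dslope_fslope⟩
  · refine AnalyticAt.congr ?_ (dslope_eventuallyEq_slope_of_ne f hxa).symm
    have : slope f a = fun b => (b - a)⁻¹ * (f b - f a) := by
      ext b; simp [slope_def_field, div_eq_inv_mul]
    rw [this]
    exact ((analyticAt_id.sub analyticAt_const).inv (sub_ne_zero.2 hxa)).mul
      (hfx.sub analyticAt_const)

/-- The potential of the canonical oscillator, normalised to vanish at its minimum `1`. -/
noncomputable def potential (q k : ℝ) : ℝ := (k ^ (q + 1) / (q + 1) - k) / q + 1 / (q + 1)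

theorem potential_one {q : ℝ} (hq : 1 < q) : potential q 1 = 0 := by
  have : q + 1 ≠ 0 := by linarith
  have : q ≠ 0 := by linarith
  simp only [potential, Real.one_rpow]
  field_simp
  ring

theorem hasDerivAt_potential {q k : ℝ} (hq : 1 < q) (hk : 0 < k) :
    HasDerivAt (potential q) ((k ^ q - 1) / q) k := by
  have h := (((Real.hasDerivAt_rpow_const (x := k) (p := q + 1) (Or.inl hk.ne')).div_const
    (q + 1)).sub (hasDerivAt_id k)).div_const q |>.add_const (1 / (q + 1))
  have : q + 1 ≠ 0 := by linarith
  refine h.congr_deriv ?_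
  rw [add_sub_cancel_right]
  field_simp

theorem hasDerivAt_force {q k : ℝ} (hq : 1 < q) (hk : 0 < k) :
    HasDerivAt (fun k : ℝ => (k ^ q - 1) / q) (k ^ (q - 1)) k := by
  have h := ((Real.hasDerivAt_rpow_const (x := k) (p := q) (Or.inl hk.ne')).sub_const 1).div_const q
  have : q ≠ 0 := by linarith
  refine h.congr_deriv ?_
  field_simp

theorem analyticAt_potential {q k : ℝ} (hk : 0 < k) : AnalyticAt ℝ (potential q) k := by
  have h : AnalyticAt ℝ (fun x : ℝ => x ^ (q + 1)) k :=
    (Real.contDiffAt_rpow_const_of_ne (n := ω) hk.ne').analyticAt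
  exact ((h.div_const.sub analyticAt_id).div_const).add analyticAt_const

theorem force_sign {q k : ℝ} (hq : 1 < q) (hk : 0 < k) (hk1 : k ≠ 1) :
    0 < (k - 1) * ((k ^ q - 1) / q) := by
  have hq0 : 0 < q := by linarith
  rcases lt_or_gt_of_ne hk1 with h | h
  · have := Real.rpow_lt_one hk.le h hq0
    exact mul_pos_of_neg_of_neg (by linarith) (div_neg_of_neg_of_pos (by linarith) hq0)
  · have := Real.one_lt_rpow h hq0
    exact mul_pos (by linarith) (div_pos (by linarith) hq0)

/-- A function on the half-line vanishing at `1` whose derivative has the sign of `k - 1` is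
positive away from `1`. -/
theorem pos_of_deriv_sign {f f' : ℝ → ℝ} (hf : ∀ k, 0 < k → HasDerivAt f (f' k) k) (h1 : f 1 = 0)
    (hs : ∀ k, 0 < k → k ≠ 1 → 0 < (k - 1) * f' k) {k : ℝ} (hk : 0 < k) (hk1 : k ≠ 1) :
    0 < f k := by
  rcases lt_or_gt_of_ne hk1 with h | h
  · have : StrictAntiOn f (Icc k 1) := by
      refine strictAntiOn_of_deriv_neg (convex_Icc k 1)
        (fun x hx => (hf x (hk.trans_le hx.1)).continuousAt.continuousWithinAt) fun x hx => ?_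
      rw [interior_Icc] at hx
      have hx0 := hk.trans hx.1
      rw [(hf x hx0).deriv]
      have := hs x hx0 hx.2.ne
      by_contra hc
      nlinarith [hx.2, not_lt.1 hc, mul_nonneg (sub_nonneg.2 hx.2.le) (not_lt.1 hc)]
    rw [← h1]
    exact this ⟨le_rfl, h.le⟩ ⟨h.le, le_rfl⟩ h
  · have : StrictMonoOn f (Icc 1 k) := by
      refine strictMonoOn_of_deriv_pos (convex_Icc 1 k)
        (fun x hx => (hf x (one_pos.trans_le hx.1)).continuousAt.continuousWithinAt) fun x hx => ?_
      rw [interior_Icc] at hx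
      have hx0 : 0 < x := one_pos.trans hx.1
      rw [(hf x hx0).deriv]
      exact pos_of_mul_pos_right (hs x hx0 hx.1.ne') (by linarith [hx.1])
    rw [← h1]
    exact this ⟨le_rfl, h.le⟩ ⟨h.le, le_rfl⟩ h

theorem potential_pos {q k : ℝ} (hq : 1 < q) (hk : 0 < k) (hk1 : k ≠ 1) : 0 < potential q k :=
  pos_of_deriv_sign (fun _ h => hasDerivAt_potential hq h) (potential_one hq)
    (fun _ h h1 => force_sign hq h h1) hk hk1

/-- The potential has a double zero at 1; two divided differences there remove it and stay analytic,
so a smooth signed square root can be taken. -/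
theorem exists_factor_potential {q : ℝ} (hq : 1 < q) :
    ∃ W : ℝ → ℝ, (∀ k, 0 < k → AnalyticAt ℝ W k) ∧ (∀ k, 0 < k → 0 < W k) ∧
      ∀ k, potential q k = (k - 1) ^ 2 * W k := by
  set f := dslope (potential q) 1 with hf
  have hU1 := analyticAt_potential (q := q) one_pos
  have hW : ∀ k, 0 < k → AnalyticAt ℝ (dslope f 1) k := fun k hk =>
    analyticAt_dslope (analyticAt_dslope (analyticAt_potential hk) hU1) (analyticAt_dslope hU1 hU1)
  have hq0 : q ≠ 0 := by linarith
  have hf1 : f 1 = 0 := by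
    rw [hf, dslope_same, (hasDerivAt_potential hq one_pos).deriv]
    simp
  have hfac : ∀ k, potential q k = (k - 1) ^ 2 * dslope f 1 k := by
    intro k
    have h1 := sub_smul_dslope_of_zero (potential_one hq) k
    have h2 := sub_smul_dslope_of_zero hf1 k
    rw [← h1, ← hf, ← h2, smul_eq_mul, smul_eq_mul]
    ring
  refine ⟨dslope f 1, hW, fun k hk => ?_, hfac⟩
  rcases eq_or_ne k 1 with rfl | hk1
  · set W := dslope f 1
    -- At 1 the value of the potential says nothing about W. Differentiating the factorisation twice
    -- gives 2 W(1) = U''(1) = 1.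
    have hd : ∀ᶠ x in 𝓝 (1 : ℝ), (x ^ q - 1) / q = (x - 1) * (2 * W x + (x - 1) * deriv W x) := by
      filter_upwards [lt_mem_nhds one_pos] with x hx
      have h1 := hasDerivAt_potential hq hx
      have h2 : HasDerivAt (fun k => (k - 1) ^ 2 * W k) _ x :=
        (((hasDerivAt_id x).sub_const 1).pow 2).mul (hW x hx).differentiableAt.hasDerivAt
      have h3 : potential q = fun k => (k - 1) ^ 2 * W k := funext hfac
      rw [h3] at h1
      rw [h1.unique h2]
      simp
      ring
    have h1 := (hasDerivAt_force hq one_pos).congr_of_eventuallyEq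
      (EventuallyEq.symm hd)
    have hWd := (hW 1 one_pos).differentiableAt.hasDerivAt
    have hWd2 := (hW 1 one_pos).deriv.differentiableAt.hasDerivAt
    have hx := (hasDerivAt_id (1 : ℝ)).sub_const 1
    have h2 := hx.mul ((hWd.const_mul 2).add (hx.mul hWd2))
    have h3 := h1.unique h2
    simp at h3
    linarith
  · have h1 := potential_pos hq hk hk1
    rw [hfac] at h1
    exact pos_of_mul_pos_right h1 (sq_nonneg _)

/-- The Morse coordinate `Y` of the potential, `Y² / 2 = potential`, together with its first two
derivatives. -/
structure IsMorse (q : ℝ) (Y Y1 Y2 : ℝ → ℝ) : Prop where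
  deriv1 : ∀ k, 0 < k → HasDerivAt Y (Y1 k) k
  deriv2 : ∀ k, 0 < k → HasDerivAt Y1 (Y2 k) k
  cont : ∀ k, 0 < k → ContinuousAt Y2 k
  pos : ∀ k, 0 < k → 0 < Y1 k
  sq : ∀ k, 0 < k → Y k ^ 2 = 2 * potential q k
  sign : ∀ k, 0 < k → k ≠ 1 → 0 < (k - 1) * Y k

theorem IsMorse.mul_deriv {q : ℝ} {Y Y1 Y2 : ℝ → ℝ} (h : IsMorse q Y Y1 Y2) (hq : 1 < q) {k : ℝ}
    (hk : 0 < k) : Y k * Y1 k = (k ^ q - 1) / q := by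
  have h1 := (h.deriv1 k hk).pow 2
  have h2 := ((hasDerivAt_potential hq hk).const_mul 2).congr_of_eventuallyEq
    (f₁ := Y ^ 2) (by filter_upwards [lt_mem_nhds hk] with x hx using h.sq x hx)
  have := h1.unique h2
  simp at this
  linarith

theorem IsMorse.deriv_sq {q : ℝ} {Y Y1 Y2 : ℝ → ℝ} (h : IsMorse q Y Y1 Y2) (hq : 1 < q) {k : ℝ}
    (hk : 0 < k) : Y1 k ^ 2 + Y k * Y2 k = k ^ (q - 1) := by
  have h1 := (h.deriv1 k hk).mul (h.deriv2 k hk)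
  have h2 := (hasDerivAt_force hq hk).congr_of_eventuallyEq
    (f₁ := Y * Y1) (by filter_upwards [lt_mem_nhds hk] with x hx using h.mul_deriv hq hx)
  have := h1.unique h2
  linarith

/-- Y = (k - 1)√(2W) is analytic because W > 0. Away from 1 its derivative is positive because Y and
Y Y' = U' both have the sign of k - 1; at 1 the derivative is √(2W(1)). -/
theorem exists_isMorse {q : ℝ} (hq : 1 < q) : ∃ Y Y1 Y2, IsMorse q Y Y1 Y2 := by
  obtain ⟨W, hW, hWpos, hfac⟩ := exists_factor_potential hq
  set Y : ℝ → ℝ := fun k => (k - 1) * √(2 * W k) with hY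
  have hYa : ∀ k, 0 < k → AnalyticAt ℝ Y k := by
    intro k hk
    have h0 : 2 * W k ≠ 0 := by have := hWpos k hk; positivity
    have h1 : AnalyticAt ℝ Real.sqrt (2 * W k) := (Real.contDiffAt_sqrt (n := ω) h0).analyticAt
    exact (analyticAt_id.sub analyticAt_const).mul
      (h1.fun_comp (f := fun k => 2 * W k) (analyticAt_const.mul (hW k hk)))
  have hsq : ∀ k, 0 < k → Y k ^ 2 = 2 * potential q k := by
    intro k hk
    have h0 : 0 ≤ 2 * W k := by have := hWpos k hk; positivity
    simp only [hY]
    rw [mul_pow, Real.sq_sqrt h0, hfac]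
    ring
  have hsign : ∀ k, 0 < k → k ≠ 1 → 0 < (k - 1) * Y k := by
    intro k hk hk1
    have h0 : 0 < √(2 * W k) := Real.sqrt_pos.2 (by have := hWpos k hk; positivity)
    have h1 : 0 < (k - 1) ^ 2 := by have := sub_ne_zero.2 hk1; positivity
    have : (k - 1) * Y k = (k - 1) ^ 2 * √(2 * W k) := by simp only [hY]; ring
    rw [this]
    positivity
  have hd1 : ∀ k, 0 < k → HasDerivAt Y (deriv Y k) k := fun k hk =>
    (hYa k hk).differentiableAt.hasDerivAt
  refine ⟨Y, deriv Y, deriv (deriv Y), hd1, fun k hk =>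
    (hYa k hk).deriv.differentiableAt.hasDerivAt, fun k hk => (hYa k hk).deriv.deriv.continuousAt,
    fun k hk => ?_, hsq, hsign⟩
  rcases eq_or_ne k 1 with rfl | hk1
  · have h0 : 2 * W 1 ≠ 0 := by have := hWpos 1 hk; positivity
    have h1 := ((hasDerivAt_id (1 : ℝ)).sub_const 1).mul
      ((Real.hasDerivAt_sqrt h0).comp 1 ((hW 1 hk).differentiableAt.hasDerivAt.const_mul 2))
    rw [HasDerivAt.deriv (f := Y) h1]
    simpa using hWpos 1 hk
  · have h1 : Y k * deriv Y k = (k ^ q - 1) / q := by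
      have h1 := (hd1 k hk).pow 2
      have h2 := ((hasDerivAt_potential hq hk).const_mul 2).congr_of_eventuallyEq
        (f₁ := Y ^ 2) (by filter_upwards [lt_mem_nhds hk] with x hx using hsq x hx)
      have := h1.unique h2
      simp at this
      linarith
    have h2 := force_sign hq hk hk1
    rw [← h1, ← mul_assoc] at h2
    exact pos_of_mul_pos_right h2 (hsign k hk hk1).le

/-! ### Chicone's criterion for the potential. -/

/-- The key inequality behind the monotonicity of the period function. -/
theorem chicone_inequality {q k : ℝ} (hq : 1 < q) (hk : 0 < k) (hk1 : k ≠ 1) :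
    3 * k * (k ^ q - 1) ^ 2 < 2 * potential q k * (q * ((2 * q + 1) * k ^ q + (q - 1))) := by
  have hq0 : 0 < q := by linarith
  have hd : ∀ k : ℝ, 0 < k → 0 < (2 * q + 1) * k ^ q + (q - 1) := fun k hk => by
    have := Real.rpow_pos_of_pos hk q
    have : 0 < q - 1 := by linarith
    positivity
  -- Dividing by the factor that multiplies U makes U enter the derivative only through U', so f' is
  -- an explicit expression with the sign of (k^q - 1)³.
  set f : ℝ → ℝ := fun k => 2 * potential q k -
    3 * k * (k ^ q - 1) ^ 2 / (q * ((2 * q + 1) * k ^ q + (q - 1))) with hf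
  have hder : ∀ k, 0 < k → HasDerivAt f ((2 * q + 1) * (q - 1) * (k ^ q - 1) ^ 3 /
      (q * ((2 * q + 1) * k ^ q + (q - 1)) ^ 2)) k := by
    intro k hk
    have hz := Real.hasDerivAt_rpow_const (x := k) (p := q) (Or.inl hk.ne')
    have hdk := hd k hk
    have h := ((hasDerivAt_potential hq hk).const_mul 2).sub
      ((((hasDerivAt_id k).const_mul 3).mul ((hz.sub_const 1).pow 2)).div
        (((hz.const_mul (2 * q + 1)).add_const (q - 1)).const_mul q) (by positivity))
    refine h.congr_deriv ?_
    have hk' : k ^ (q - 1) = k ^ q / k := Real.rpow_sub_one hk.ne' q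
    simp only [id, Pi.pow_apply, Pi.mul_apply, hk']
    generalize k ^ q = z at *
    have h1 : (2 * q + 1) * z + (q - 1) ≠ 0 := hdk.ne'
    push_cast
    generalize hdz : (2 * q + 1) * z + (q - 1) = d at *
    field_simp
    rw [← hdz]
    ring
  have h1 : f 1 = 0 := by simp [hf, potential_one hq]
  have := pos_of_deriv_sign hder h1 (fun k hk hk1 => by
    have h1 := force_sign hq hk hk1
    have h2 := hd k hk
    have h3 : 0 < (k - 1) * (k ^ q - 1) := by
      have : (k - 1) * (k ^ q - 1) = q * ((k - 1) * ((k ^ q - 1) / q)) := by field_simp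
      rw [this]; positivity
    have h4 : 0 < (k ^ q - 1) ^ 2 := by
      have : k ^ q - 1 ≠ 0 := fun h => by simp [h] at h3
      positivity
    have h5 : 0 < q - 1 := by linarith
    have : (k - 1) * ((2 * q + 1) * (q - 1) * (k ^ q - 1) ^ 3 /
      (q * ((2 * q + 1) * k ^ q + (q - 1)) ^ 2)) = ((k - 1) * (k ^ q - 1)) * ((k ^ q - 1) ^ 2 *
        ((2 * q + 1) * (q - 1) / (q * ((2 * q + 1) * k ^ q + (q - 1)) ^ 2))) := by ring
    rw [this]
    positivity) hk hk1
  have h2 : 0 < q * ((2 * q + 1) * k ^ q + (q - 1)) := mul_pos hq0 (hd k hk)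
  rwa [hf, sub_pos, div_lt_iff₀ h2] at this

/-- The second derivative of the inverse of the Morse coordinate is increasing. -/
theorem IsMorse.strictMonoOn {q : ℝ} {Y Y1 Y2 : ℝ → ℝ} (h : IsMorse q Y Y1 Y2) (hq : 1 < q) :
    StrictMonoOn (fun k => -Y2 k / Y1 k ^ 3) (Ioi 0) := by
  set M : ℝ → ℝ := fun k => -Y2 k / Y1 k ^ 3 with hM
  have hq0 : 0 < q := by linarith
  have hc : ∀ k, 0 < k → ContinuousAt M k := fun k hk =>
    (h.cont k hk).neg.div ((h.deriv2 k hk).continuousAt.pow 3) (by have := h.pos k hk; positivity)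
  have hF : ∀ k, 0 < k → k ≠ 1 → (k ^ q - 1) / q ≠ 0 := fun k hk hk1 h0 => by
    have := force_sign hq hk hk1
    simp [h0] at this
  -- The right side is the derivative of U/U'², so increase of M is convexity of U/U'², Chicone's
  -- condition.
  have hM' : ∀ k, 0 < k → k ≠ 1 → M k =
      (((k ^ q - 1) / q) ^ 2 - 2 * potential q k * k ^ (q - 1)) / ((k ^ q - 1) / q) ^ 3 := by
    intro k hk hk1
    have h1 := h.mul_deriv hq hk
    have h2 := h.deriv_sq hq hk
    have h3 := h.sq k hk
    have h4 := h.pos k hk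
    have h5 : Y k ≠ 0 := fun h0 => by have := h.sign k hk hk1; simp [h0] at this
    rw [← h1, ← h2, ← h3, hM]
    field_simp
    ring
  have hder : ∀ k, 0 < k → k ≠ 1 → 0 < deriv M k := by
    intro k hk hk1
    have hFk := hF k hk hk1
    have h1 := ((((hasDerivAt_force hq hk).pow 2).sub (((hasDerivAt_potential hq hk).const_mul 2).mul
      (Real.hasDerivAt_rpow_const (x := k) (p := q - 1) (Or.inl hk.ne')))).div
        ((hasDerivAt_force hq hk).pow 3) (pow_ne_zero 3 hFk))
    have h2 := h1.congr_of_eventuallyEq (f₁ := M) (by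
      filter_upwards [lt_mem_nhds hk, isOpen_ne.mem_nhds hk1] with x hx hx1
      rw [hM' x hx hx1]; rfl)
    rw [h2.deriv]
    have hk2 : k ^ (q - 1) = k ^ q / k := Real.rpow_sub_one hk.ne' q
    have hk3 : k ^ (q - 1 - 1) = k ^ q / k / k := by rw [Real.rpow_sub_one hk.ne' (q - 1), hk2]
    have hch := chicone_inequality hq hk hk1
    have hzpos := Real.rpow_pos_of_pos hk q
    simp only [Pi.pow_apply, Pi.mul_apply, Pi.sub_apply, hk3, hk2]
    generalize potential q k = U at *
    generalize k ^ q = z at *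
    have hz1 : z - 1 ≠ 0 := fun h0 => by simp [h0] at hFk
    have : 0 < z * q ^ 2 / (k ^ 2 * (z - 1) ^ 4) *
        (2 * U * (q * ((2 * q + 1) * z + (q - 1))) - 3 * k * (z - 1) ^ 2) := by
      have : 0 < 2 * U * (q * ((2 * q + 1) * z + (q - 1))) - 3 * k * (z - 1) ^ 2 := by linarith
      positivity
    refine this.trans_eq ?_
    push_cast
    field_simp
    ring
  -- The quotient formula degenerates at 1; the two sides are glued there by continuity of M.
  have hleft : StrictMonoOn M (Ioc 0 1) := by
    refine strictMonoOn_of_deriv_pos (convex_Ioc 0 1)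
      (fun x hx => (hc x hx.1).continuousWithinAt) fun x hx => ?_
    rw [interior_Ioc] at hx
    exact hder x hx.1 hx.2.ne
  have hright : StrictMonoOn M (Ici 1) := by
    refine strictMonoOn_of_deriv_pos (convex_Ici 1)
      (fun x hx => (hc x (one_pos.trans_le hx)).continuousWithinAt) fun x hx => ?_
    rw [interior_Ici] at hx
    exact hder x (one_pos.trans hx) (ne_of_gt hx)
  have := hleft.union hright (c := 1) (isGreatest_Ioc one_pos) isLeast_Ici
  rwa [Ioc_union_Ici_eq_Ioi one_pos] at this

/-! ### The inverse of the Morse coordinate. -/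

/-- The inverse `g` of the Morse coordinate of the potential, defined on `J`, with its first two
derivatives. -/
structure IsChart (q : ℝ) (J : Set ℝ) (g g1 g2 : ℝ → ℝ) : Prop where
  isOpen : IsOpen J
  pos : ∀ y ∈ J, 0 < g y
  deriv1 : ∀ y ∈ J, HasDerivAt g (g1 y) y
  deriv2 : ∀ y ∈ J, HasDerivAt g1 (g2 y) y
  cont : ContinuousOn g2 J
  pos1 : ∀ y ∈ J, 0 < g1 y
  force : ∀ y ∈ J, (g y ^ q - 1) / q * g1 y = y
  force_deriv : ∀ y ∈ J, g y ^ (q - 1) * g1 y ^ 2 + (g y ^ q - 1) / q * g2 y = 1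
  mono : StrictMonoOn g2 J

theorem IsMorse.strictMono {q : ℝ} {Y Y1 Y2 : ℝ → ℝ} (h : IsMorse q Y Y1 Y2) :
    StrictMonoOn Y (Ioi 0) := by
  refine strictMonoOn_of_deriv_pos (convex_Ioi 0)
    (fun x hx => (h.deriv1 x hx).continuousAt.continuousWithinAt) fun x hx => ?_
  rw [interior_Ioi] at hx
  rw [(h.deriv1 x hx).deriv]
  exact h.pos x hx

theorem IsMorse.ordConnected {q : ℝ} {Y Y1 Y2 : ℝ → ℝ} (h : IsMorse q Y Y1 Y2) :
    OrdConnected (Y '' Ioi 0) :=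
  (isPreconnected_Ioi.image Y fun x hx =>
    (h.deriv1 x hx).continuousAt.continuousWithinAt).ordConnected

theorem IsMorse.isOpen_image {q : ℝ} {Y Y1 Y2 : ℝ → ℝ} (h : IsMorse q Y Y1 Y2) :
    IsOpen (Y '' Ioi 0) := by
  rw [isOpen_iff_mem_nhds]
  rintro _ ⟨k, hk : 0 < k, rfl⟩
  have h1 : Y (k / 2) < Y k := h.strictMono (half_pos hk) hk (half_lt_self hk)
  have h2 : Y k < Y (2 * k) := h.strictMono hk (show 0 < 2 * k by positivity) (by linarith)
  refine mem_of_superset (Icc_mem_nhds h1 h2) ?_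
  exact h.ordConnected.out ⟨_, half_pos hk, rfl⟩ ⟨_, show 0 < 2 * k by positivity, rfl⟩

theorem IsMorse.exists_isChart {q : ℝ} {Y Y1 Y2 : ℝ → ℝ} (h : IsMorse q Y Y1 Y2) (hq : 1 < q) :
    ∃ g g1 g2, IsChart q (Y '' Ioi 0) g g1 g2 ∧ ∀ k, 0 < k → g (Y k) = k := by
  set g := Function.invFunOn Y (Ioi 0) with hg
  have hleft : ∀ k, 0 < k → g (Y k) = k := fun k hk => h.strictMono.injOn.leftInvOn_invFunOn hk
  have hright : ∀ y ∈ Y '' Ioi 0, Y (g y) = y := fun y hy => Function.invFunOn_eq hy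
  have hpos : ∀ y ∈ Y '' Ioi 0, 0 < g y := fun y hy => Function.invFunOn_mem hy
  have hopen := h.isOpen_image
  have hmono : StrictMonoOn g (Y '' Ioi 0) := by
    rintro _ ⟨a, ha, rfl⟩ _ ⟨b, hb, rfl⟩ hab
    rw [hleft a ha, hleft b hb]
    exact (h.strictMono.lt_iff_lt ha hb).1 hab
  have himg : g '' (Y '' Ioi 0) = Ioi 0 := by
    ext k
    constructor
    · rintro ⟨y, hy, rfl⟩
      exact hpos y hy
    · intro hk
      exact ⟨Y k, ⟨k, hk, rfl⟩, hleft k hk⟩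
  -- A monotone function whose image is open is continuous, which is what the inverse-function
  -- derivative rule needs.
  have hcont : ∀ y ∈ Y '' Ioi 0, ContinuousAt g y := fun y hy =>
    continuousAt_of_monotoneOn_of_image_mem_nhds hmono.monotoneOn (hopen.mem_nhds hy)
      (by rw [himg]; exact Ioi_mem_nhds (hpos y hy))
  have hd1 : ∀ y ∈ Y '' Ioi 0, HasDerivAt g (Y1 (g y))⁻¹ y := fun y hy =>
    HasDerivAt.of_local_left_inverse (hcont y hy) (h.deriv1 _ (hpos y hy)) (h.pos _ (hpos y hy)).ne'
      (by filter_upwards [hopen.mem_nhds hy] with x hx using hright x hx)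
  refine ⟨g, fun y => (Y1 (g y))⁻¹, fun y => -Y2 (g y) / Y1 (g y) ^ 3, ⟨hopen, hpos, hd1,
    fun y hy => ?_, fun y hy => ?_, fun y hy => inv_pos.2 (h.pos _ (hpos y hy)),
    fun y hy => ?_, fun y hy => ?_, ?_⟩, hleft⟩
  · have h1 := ((h.deriv2 _ (hpos y hy)).comp y (hd1 y hy)).inv (h.pos _ (hpos y hy)).ne'
    refine h1.congr_deriv ?_
    have := (h.pos _ (hpos y hy)).ne'
    simp only [Function.comp]
    field_simp
  · have h1 : ContinuousAt (fun k => -Y2 k / Y1 k ^ 3) (g y) :=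
      (h.cont _ (hpos y hy)).neg.div ((h.deriv2 _ (hpos y hy)).continuousAt.pow 3)
        (pow_ne_zero 3 (h.pos _ (hpos y hy)).ne')
    exact (ContinuousAt.comp' h1 (hcont y hy)).continuousWithinAt
  · rw [← h.mul_deriv hq (hpos y hy), hright y hy, mul_inv_cancel_right₀ (h.pos _ (hpos y hy)).ne']
  · have := (h.pos _ (hpos y hy)).ne'
    rw [← h.mul_deriv hq (hpos y hy), ← h.deriv_sq hq (hpos y hy)]
    field_simp
    ring
  · intro a ha b hb hab
    exact h.strictMonoOn hq (hpos a ha) (hpos b hb) (hmono ha hb hab)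

/-- The chart must also reach the maximum of the orbit that starts at its minimum α. The potential
near 0 tends to 1/(q+1), above its value at α, and it regains 1/(q+1) to the right of 1, so the
level of α is met there too. -/
theorem IsMorse.Icc_subset {q : ℝ} {Y Y1 Y2 : ℝ → ℝ} (h : IsMorse q Y Y1 Y2) (hq : 1 < q) {α : ℝ}
    (hα : α ∈ Ioo (0 : ℝ) 1) : Y α < 0 ∧ Icc (Y α) (-Y α) ⊆ Y '' Ioi 0 := by
  have hneg : Y α < 0 := by
    have := h.sign α hα.1 hα.2.ne
    exact neg_of_mul_pos_right this (by linarith [hα.2])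
  refine ⟨hneg, ?_⟩
  have hq0 : 0 < q := by linarith
  -- β is the point beyond 1 where the potential again equals its value 1/(q+1) at 0.
  set β : ℝ := (q + 1) ^ (1 / q) with hβ
  have hβ1 : 1 < β := Real.one_lt_rpow (by linarith) (by positivity)
  have hβ0 : 0 < β := one_pos.trans hβ1
  have hβq : β ^ q = q + 1 := by
    rw [hβ, ← Real.rpow_mul (by linarith), one_div, inv_mul_cancel₀ hq0.ne', Real.rpow_one]
  have hUβ : potential q β = 1 / (q + 1) := by
    rw [potential, Real.rpow_add_one hβ0.ne', hβq]
    field_simp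
    ring
  have hUα : potential q α < 1 / (q + 1) := by
    have h1 : α ^ q < 1 := Real.rpow_lt_one hα.1.le hα.2 hq0
    have h2 : α ^ (q + 1) / (q + 1) < α := by
      rw [div_lt_iff₀ (by linarith), Real.rpow_add_one hα.1.ne']
      nlinarith [hα.1]
    have : (α ^ (q + 1) / (q + 1) - α) / q < 0 := div_neg_of_neg_of_pos (by linarith) hq0
    rw [potential]
    linarith
  have hYβ : 0 < Y β := by
    have := h.sign β hβ0 hβ1.ne'
    exact pos_of_mul_pos_right this (by linarith)
  have hle : -Y α ≤ Y β := by
    have h1 := h.sq α hα.1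
    have h2 := h.sq β hβ0
    nlinarith
  exact (Icc_subset_Icc_right hle).trans (h.ordConnected.out ⟨α, hα.1, rfl⟩ ⟨β, hβ0, rfl⟩)

/-- The amplitude is ρ(α) = -Y(α). Its negative derivative reverses the sign between E'(α) and
derivatives in the amplitude. -/
theorem exists_isChart {q : ℝ} (hq : 1 < q) : ∃ (J : Set ℝ) (g g1 g2 ρ : ℝ → ℝ),
    IsChart q J g g1 g2 ∧ ∀ α ∈ Ioo (0 : ℝ) 1, 0 < ρ α ∧ Icc (-ρ α) (ρ α) ⊆ J ∧ g (-ρ α) = α ∧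
      ∃ ρ' < 0, HasDerivAt ρ ρ' α := by
  obtain ⟨Y, Y1, Y2, h⟩ := exists_isMorse hq
  obtain ⟨g, g1, g2, hg, hinv⟩ := h.exists_isChart hq
  refine ⟨Y '' Ioi 0, g, g1, g2, fun α => -Y α, hg, fun α hα => ?_⟩
  obtain ⟨h1, h2⟩ := h.Icc_subset hq hα
  refine ⟨neg_pos.2 h1, by rwa [neg_neg], by rw [neg_neg, hinv α hα.1], -Y1 α,
    neg_neg_of_pos (h.pos α hα.1), (h.deriv1 α hα.1).neg⟩

/-! ### Integrals of functions of r sin s and their dependence on r. -/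

theorem mul_sin_mem_Icc {r R : ℝ} (hr : |r| ≤ R) (s : ℝ) : r * Real.sin s ∈ Icc (-R) R := by
  rw [mem_Icc, ← abs_le, abs_mul]
  exact (mul_le_of_le_one_right (abs_nonneg r) (Real.abs_sin_le_one s)).trans hr

theorem exists_symm_Icc_subset {J : Set ℝ} (hJ : IsOpen J) {r : ℝ} (hr : 0 < r)
    (h : Icc (-r) r ⊆ J) : ∃ R, r < R ∧ Icc (-R) R ⊆ J := by
  have h1 : ∀ᶠ x in 𝓝 r, x ∈ J := hJ.mem_nhds (h ⟨by linarith, le_rfl⟩)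
  have h2 : ∀ᶠ x in 𝓝 r, -x ∈ J :=
    (continuous_neg.tendsto r).eventually (hJ.mem_nhds (h ⟨le_rfl, by linarith⟩))
  obtain ⟨δ, hδ, hb⟩ := Metric.eventually_nhds_iff.1 (h1.and h2)
  refine ⟨r + δ / 2, by linarith, fun x hx => ?_⟩
  by_cases hx1 : x ∈ Icc (-r) r
  · exact h hx1
  · rw [mem_Icc, not_and_or, not_le, not_le] at hx1
    rcases hx1 with hx1 | hx1
    · have := (hb (y := -x) (by
        rw [Real.dist_eq, abs_lt]; constructor <;> linarith [hx.1])).2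
      rwa [neg_neg] at this
    · exact (hb (y := x) (by rw [Real.dist_eq, abs_lt]; constructor <;> linarith [hx.2])).1

theorem continuous_comp_mul_sin {J : Set ℝ} {G : ℝ → ℝ} (hG : ContinuousOn G J) {r : ℝ}
    (h : Icc (-|r|) |r| ⊆ J) : Continuous fun s => G (r * Real.sin s) :=
  hG.comp_continuous (by fun_prop) fun s => h (mul_sin_mem_Icc le_rfl s)

/-- A slightly larger symmetric interval still lies in the open set J; compactness bounds G' on it
uniformly for nearby amplitudes, which dominates the difference quotients. -/
theorem hasDerivAt_integral_comp_mul_sin {J : Set ℝ} (hJ : IsOpen J) {G G' : ℝ → ℝ}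
    (hG : ∀ y ∈ J, HasDerivAt G (G' y) y) (hG' : ContinuousOn G' J) {r : ℝ} (hr : 0 < r)
    (h : Icc (-r) r ⊆ J) (a b : ℝ) :
    HasDerivAt (fun r => ∫ s in a..b, G (r * Real.sin s))
      (∫ s in a..b, G' (r * Real.sin s) * Real.sin s) r := by
  obtain ⟨R, hrR, hR⟩ := exists_symm_Icc_subset hJ hr h
  obtain ⟨C, hC⟩ := isCompact_Icc.exists_bound_of_continuousOn (hG'.mono hR)
  have hGc : ContinuousOn G J := fun y hy => (hG y hy).continuousAt.continuousWithinAt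
  have hball : ∀ x ∈ Metric.ball r (min r (R - r)), |x| ≤ R := by
    intro x hx
    rw [Metric.mem_ball, Real.dist_eq, lt_min_iff, abs_lt, abs_lt] at hx
    rw [abs_le]
    constructor <;> linarith [hx.1.1, hx.2.2]
  have hsub : ∀ {x : ℝ}, |x| ≤ R → Icc (-|x|) |x| ⊆ J := fun hx =>
    (Icc_subset_Icc (neg_le_neg hx) hx).trans hR
  have hrR' : |r| ≤ R := by rw [abs_of_pos hr]; exact hrR.le
  refine (intervalIntegral.hasDerivAt_integral_of_dominated_loc_of_deriv_le (μ := volume)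
    (F' := fun x s => G' (x * Real.sin s) * Real.sin s) (bound := fun _ => C)
    (Metric.ball_mem_nhds r (lt_min hr (sub_pos.2 hrR))) ?_ ?_ ?_ ?_ ?_ ?_).2
  · filter_upwards [Metric.ball_mem_nhds r (lt_min hr (sub_pos.2 hrR))] with x hx
    exact (continuous_comp_mul_sin hGc (hsub (hball x hx))).aestronglyMeasurable
  · exact (continuous_comp_mul_sin hGc (hsub hrR')).intervalIntegrable a b
  · exact ((continuous_comp_mul_sin hG' (hsub hrR')).mul Real.continuous_sin).aestronglyMeasurable
  · refine Eventually.of_forall fun s _ x hx => ?_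
    rw [norm_mul]
    have h1 := hC _ (mul_sin_mem_Icc (hball x hx) s)
    exact (mul_le_of_le_one_right (norm_nonneg _) (Real.abs_sin_le_one s)).trans h1
  · exact intervalIntegrable_const
  · refine Eventually.of_forall fun s _ x hx => ?_
    exact (hG _ (hR (mul_sin_mem_Icc (hball x hx) s))).comp x
      ((hasDerivAt_id x).mul_const _ |>.congr_deriv (one_mul _))

/-- A strictly increasing weight has a positive first sine moment over half a period. -/
theorem integral_comp_mul_sin_mul_sin_pos {J : Set ℝ} {G : ℝ → ℝ} (hG : ContinuousOn G J)
    (hmono : StrictMonoOn G J) {r : ℝ} (hr : 0 < r) (h : Icc (-r) r ⊆ J) :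
    0 < ∫ s in (-(Real.pi / 2))..(Real.pi / 2), G (r * Real.sin s) * Real.sin s := by
  have hr' : |r| = r := abs_of_pos hr
  have hc : Continuous fun s => G (r * Real.sin s) :=
    continuous_comp_mul_sin hG (by rwa [hr'])
  have hpi := Real.pi_pos
  -- The constant G(0) has zero sine moment. After subtracting it, (G(r sin s) - G(0)) sin s is
  -- nonnegative by monotonicity.
  have h0 : ∫ s in (-(Real.pi / 2))..(Real.pi / 2), G 0 * Real.sin s = 0 := by
    rw [intervalIntegral.integral_const_mul, integral_sin]; simp
  have hc2 : Continuous fun s => G (r * Real.sin s) * Real.sin s := hc.mul Real.continuous_sin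
  have hc3 : Continuous fun s => G 0 * Real.sin s := continuous_const.mul Real.continuous_sin
  have h1 : ∫ s in (-(Real.pi / 2))..(Real.pi / 2), G (r * Real.sin s) * Real.sin s =
      ∫ s in (-(Real.pi / 2))..(Real.pi / 2),
        (G (r * Real.sin s) * Real.sin s - G 0 * Real.sin s) := by
    rw [intervalIntegral.integral_sub (hc2.intervalIntegrable _ _)
      (hc3.intervalIntegrable _ _), h0, sub_zero]
  rw [h1]
  have hJ0 : (0 : ℝ) ∈ J := h ⟨by linarith, hr.le⟩
  have hJs : ∀ s, r * Real.sin s ∈ J := fun s => h (mul_sin_mem_Icc hr'.le s)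
  have hnn : ∀ s, 0 ≤ G (r * Real.sin s) * Real.sin s - G 0 * Real.sin s := by
    intro s
    rw [← sub_mul]
    rcases le_total 0 (Real.sin s) with hs | hs
    · exact mul_nonneg (sub_nonneg.2 (hmono.monotoneOn hJ0 (hJs s) (mul_nonneg hr.le hs))) hs
    · exact mul_nonneg_of_nonpos_of_nonpos (sub_nonpos.2 (hmono.monotoneOn (hJs s) hJ0
        (mul_nonpos_of_nonneg_of_nonpos hr.le hs))) hs
  refine intervalIntegral.integral_pos (by linarith) (hc2.sub hc3).continuousOn (fun s _ => hnn s)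
    ⟨Real.pi / 2, ⟨by linarith, le_rfl⟩, ?_⟩
  rw [Real.sin_pi_div_two, mul_one, mul_one, mul_one, sub_pos]
  exact hmono hJ0 (h ⟨by linarith, le_rfl⟩) hr

/-! ### The phase function and its symmetries. -/

section Reflection

variable {f : ℝ → ℝ}

theorem integral_reflect_left (hf : ∀ s, f (-Real.pi - s) = f s) (x : ℝ) :
    ∫ s in (-(Real.pi / 2))..(-Real.pi - x), f s = -∫ s in (-(Real.pi / 2))..x, f s := by
  have h := intervalIntegral.integral_comp_sub_left (a := x) (b := -(Real.pi / 2)) f (-Real.pi)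
  simp only [hf] at h
  rw [show -Real.pi - -(Real.pi / 2) = -(Real.pi / 2) by ring] at h
  rw [← h, intervalIntegral.integral_symm]

theorem integral_reflect_right (hc : Continuous f) (hf : ∀ s, f (Real.pi - s) = f s) (x : ℝ) :
    ∫ s in (-(Real.pi / 2))..(Real.pi - x), f s =
      2 * (∫ s in (-(Real.pi / 2))..(Real.pi / 2), f s) - ∫ s in (-(Real.pi / 2))..x, f s := by
  have h := intervalIntegral.integral_comp_sub_left (a := x) (b := Real.pi / 2) f Real.pi
  simp only [hf] at h
  rw [show Real.pi - Real.pi / 2 = Real.pi / 2 by ring] at h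
  have h1 := intervalIntegral.integral_add_adjacent_intervals
    (hc.intervalIntegrable (-(Real.pi / 2)) (Real.pi / 2))
    (hc.intervalIntegrable (Real.pi / 2) (Real.pi - x)) (μ := volume)
  have h2 := intervalIntegral.integral_add_adjacent_intervals
    (hc.intervalIntegrable (-(Real.pi / 2)) x) (hc.intervalIntegrable x (Real.pi / 2)) (μ := volume)
  linarith

theorem integral_add_two_pi (hc : Continuous f) (hf : ∀ s, f (Real.pi - s) = f s)
    (hf' : ∀ s, f (-Real.pi - s) = f s) (x : ℝ) :
    ∫ s in (-(Real.pi / 2))..(x + 2 * Real.pi), f s = (∫ s in (-(Real.pi / 2))..x, f s) +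
      ∫ s in (-(Real.pi / 2))..(3 * Real.pi / 2), f s := by
  have h1 := integral_reflect_right hc hf (-Real.pi - x)
  have h2 := integral_reflect_right hc hf (-(Real.pi / 2))
  rw [integral_reflect_left hf' x] at h1
  rw [intervalIntegral.integral_same] at h2
  rw [show Real.pi - (-Real.pi - x) = x + 2 * Real.pi by ring] at h1
  rw [show Real.pi - -(Real.pi / 2) = 3 * Real.pi / 2 by ring] at h2
  linarith

theorem integral_half (hc : Continuous f) (hf : ∀ s, f (Real.pi - s) = f s) :
    ∫ s in (-(Real.pi / 2))..(3 * Real.pi / 2), f s =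
      2 * ∫ s in (-(Real.pi / 2))..(Real.pi / 2), f s := by
  have h2 := integral_reflect_right hc hf (-(Real.pi / 2))
  rw [intervalIntegral.integral_same] at h2
  rw [show Real.pi - -(Real.pi / 2) = 3 * Real.pi / 2 by ring] at h2
  linarith

/-- The solution `θ` of `θ' = 1 / f(θ)`, `θ(0) = -π/2`, for a positive weight `f` with the
symmetries of the sine. -/
structure IsPhase (f θ : ℝ → ℝ) (P : ℝ) : Prop where
  deriv : ∀ t, HasDerivAt θ (f (θ t))⁻¹ t
  mono : StrictMono θ
  left_inv : ∀ t, ∫ s in (-(Real.pi / 2))..θ t, f s = t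
  right_inv : ∀ x, θ (∫ s in (-(Real.pi / 2))..x, f s) = x
  zero : θ 0 = -(Real.pi / 2)
  neg : ∀ t, θ (-t) = -Real.pi - θ t
  add_period : ∀ t, θ (t + P) = θ t + 2 * Real.pi
  pos : 0 < P

/-- θ inverts x ↦ ∫ f. The two reflections compose to translation by 2π, so f is periodic with
positive mean and its primitive covers the whole line; the same reflections give the symmetries of
θ. -/
theorem exists_isPhase (hc : Continuous f) (hpos : ∀ s, 0 < f s)
    (hf : ∀ s, f (Real.pi - s) = f s) (hf' : ∀ s, f (-Real.pi - s) = f s) :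
    ∃ θ, IsPhase f θ (∫ s in (-(Real.pi / 2))..(3 * Real.pi / 2), f s) := by
  set T : ℝ → ℝ := fun x => ∫ s in (-(Real.pi / 2))..x, f s with hT
  have hpi := Real.pi_pos
  have hd : ∀ x, HasDerivAt T (f x) x := fun x => hc.integral_hasStrictDerivAt _ x |>.hasDerivAt
  have hTmono : StrictMono T := strictMono_of_deriv_pos fun x => by rw [(hd x).deriv]; exact hpos x
  have hTc : Continuous T := continuous_iff_continuousAt.2 fun x => (hd x).continuousAt
  have hper : Function.Periodic f (2 * Real.pi) := fun s => by
    have h1 := hf (-Real.pi - s)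
    rw [hf', show Real.pi - (-Real.pi - s) = s + 2 * Real.pi by ring] at h1
    exact h1
  have hadd : ∀ x, T x = T 0 + ∫ s in (0 : ℝ)..x, f s := fun x =>
    (intervalIntegral.integral_add_adjacent_intervals (hc.intervalIntegrable _ _)
      (hc.intervalIntegrable _ _)).symm
  have hI : 0 < ∫ s in (0 : ℝ)..(2 * Real.pi), f s :=
    intervalIntegral.intervalIntegral_pos_of_pos (hc.intervalIntegrable _ _) hpos (by positivity)
  have hsurj : Function.Surjective T := by
    refine hTc.surjective ?_ ?_
    · rw [funext hadd]
      exact tendsto_atTop_add_const_left _ _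
        (hper.tendsto_atTop_intervalIntegral_of_pos hI
          (by positivity))
    · rw [funext hadd]
      exact tendsto_atBot_add_const_left _ _
        (hper.tendsto_atBot_intervalIntegral_of_pos hI
          (by positivity))
  set e := hTmono.orderIsoOfSurjective T hsurj with he
  have heT : ∀ x, e x = T x := fun x => rfl
  have hl : ∀ t, T (e.symm t) = t := fun t => e.apply_symm_apply t
  have hr : ∀ x, e.symm (T x) = x := fun x => e.symm_apply_apply x
  refine ⟨e.symm, ⟨fun t => ?_, e.symm.strictMono, hl, hr, ?_, fun t => ?_, fun t => ?_, ?_⟩⟩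
  · exact HasDerivAt.of_local_left_inverse e.symm.continuous.continuousAt (hd _) (hpos _).ne'
      (Eventually.of_forall hl)
  · rw [← hr (-(Real.pi / 2))]
    simp [hT]
  · apply hTmono.injective
    have h1 := integral_reflect_left hf' (e.symm t)
    have h2 := hl t
    simp only [hT] at h2 ⊢
    rw [h1, h2]
    exact hl (-t)
  · apply hTmono.injective
    have h1 := integral_add_two_pi hc hf hf' (e.symm t)
    have h2 := hl t
    simp only [hT] at h2 ⊢
    rw [h1, h2]
    exact hl _
  · exact intervalIntegral.intervalIntegral_pos_of_pos (hc.intervalIntegrable _ _) hpos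
      (by linarith)

theorem IsPhase.integral_comp {θ : ℝ → ℝ} {P : ℝ} (h : IsPhase f θ P) (hc : Continuous f)
    {F : ℝ → ℝ} (hF : Continuous F) :
    ∫ t in (0 : ℝ)..P, F (θ t) = ∫ s in (-(Real.pi / 2))..(3 * Real.pi / 2), F s * f s := by
  have hθ : Continuous θ := continuous_iff_continuousAt.2 fun t => (h.deriv t).continuousAt
  have h1 := intervalIntegral.integral_comp_mul_deriv (a := -(Real.pi / 2)) (b := 3 * Real.pi / 2)
    (f := fun x => ∫ s in (-(Real.pi / 2))..x, f s) (f' := f) (g := fun t => F (θ t))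
    (fun x _ => hc.integral_hasStrictDerivAt _ x |>.hasDerivAt) hc.continuousOn (hF.comp hθ)
  have hP := h.left_inv P
  have h2 := h.add_period 0
  rw [zero_add, h.zero] at h2
  rw [h2, show -(Real.pi / 2) + 2 * Real.pi = 3 * Real.pi / 2 by ring] at hP
  rw [hP, intervalIntegral.integral_same] at h1
  rw [← h1]
  simp [h.right_inv]

end Reflection

/-! ### Orbits, their amplitude derivative, and the splitting of a period. -/

/-- In the chart `g`, the orbit `g (r sin θ)` of amplitude `r` of the canonical oscillator, with
phase `θ` and period `P`. -/
structure IsOrbit (q : ℝ) (J : Set ℝ) (g g1 g2 : ℝ → ℝ) (r P : ℝ) (θ : ℝ → ℝ) : Prop where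
  chart : IsChart q J g g1 g2
  pos : 0 < r
  subset : Icc (-r) r ⊆ J
  phase : IsPhase (fun s => g1 (r * Real.sin s)) θ P

section Orbit

variable {q : ℝ} {J : Set ℝ} {g g1 g2 : ℝ → ℝ} {r P : ℝ} {θ : ℝ → ℝ}

theorem sin_neg_pi_sub (s : ℝ) : Real.sin (-Real.pi - s) = Real.sin s := by
  rw [show -Real.pi - s = -(s + Real.pi) by ring, Real.sin_neg, Real.sin_add_pi, neg_neg]

theorem cos_neg_pi_sub (s : ℝ) : Real.cos (-Real.pi - s) = -Real.cos s := by
  rw [show -Real.pi - s = -(s + Real.pi) by ring, Real.cos_neg, Real.cos_add_pi]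

theorem IsChart.continuousOn (hc : IsChart q J g g1 g2) : ContinuousOn g J :=
  fun y hy => (hc.deriv1 y hy).continuousAt.continuousWithinAt

theorem IsChart.continuousOn1 (hc : IsChart q J g g1 g2) : ContinuousOn g1 J :=
  fun y hy => (hc.deriv2 y hy).continuousAt.continuousWithinAt

theorem IsChart.exists_isOrbit (hc : IsChart q J g g1 g2) (hr : 0 < r) (hJ : Icc (-r) r ⊆ J) :
    ∃ θ, IsOrbit q J g g1 g2 r
      (∫ s in (-(Real.pi / 2))..(3 * Real.pi / 2), g1 (r * Real.sin s)) θ := by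
  have hr' : |r| = r := abs_of_pos hr
  obtain ⟨θ, hθ⟩ := exists_isPhase (f := fun s => g1 (r * Real.sin s))
    (continuous_comp_mul_sin hc.continuousOn1 (by rwa [hr']))
    (fun s => hc.pos1 _ (hJ (mul_sin_mem_Icc hr'.le s))) (fun s => by simp)
    (fun s => by rw [sin_neg_pi_sub])
  exact ⟨θ, hc, hr, hJ, hθ⟩

namespace IsOrbit

theorem mem (h : IsOrbit q J g g1 g2 r P θ) (s : ℝ) : r * Real.sin s ∈ J :=
  h.subset (mul_sin_mem_Icc (abs_of_pos h.pos).le s)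

theorem continuous_comp (h : IsOrbit q J g g1 g2 r P θ) {G : ℝ → ℝ} (hG : ContinuousOn G J) :
    Continuous fun s => G (r * Real.sin s) :=
  continuous_comp_mul_sin hG (by rw [abs_of_pos h.pos]; exact h.subset)

theorem hasDerivAt_mul_sin (s : ℝ) :
    HasDerivAt (fun s => r * Real.sin s) (r * Real.cos s) s :=
  (Real.hasDerivAt_sin s).const_mul r

theorem hasDerivAt_k (h : IsOrbit q J g g1 g2 r P θ) (t : ℝ) :
    HasDerivAt (fun t => g (r * Real.sin (θ t))) (r * Real.cos (θ t)) t := by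
  have h1 := ((h.chart.deriv1 _ (h.mem (θ t))).comp (θ t) (hasDerivAt_mul_sin (θ t))).comp t
    (h.phase.deriv t)
  refine h1.congr_deriv ?_
  have := (h.chart.pos1 _ (h.mem (θ t))).ne'
  field_simp

theorem hasDerivAt_k1 (h : IsOrbit q J g g1 g2 r P θ) (t : ℝ) :
    HasDerivAt (fun t => r * Real.cos (θ t)) (-((g (r * Real.sin (θ t)) ^ q - 1) / q)) t := by
  have h1 := ((Real.hasDerivAt_cos (θ t)).const_mul r).comp t (h.phase.deriv t)
  refine h1.congr_deriv ?_
  have h2 := (h.chart.pos1 _ (h.mem (θ t))).ne'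
  have h3 := h.chart.force _ (h.mem (θ t))
  rw [← div_eq_mul_inv, div_eq_iff h2]
  linarith

/-- `I(x) = ∫_{-π/2}^x g''(r sin s) sin s ds`. -/
noncomputable def momentIntegral (g2 : ℝ → ℝ) (r x : ℝ) : ℝ :=
  ∫ s in (-(Real.pi / 2))..x, g2 (r * Real.sin s) * Real.sin s

theorem hasDerivAt_momentIntegral (h : IsOrbit q J g g1 g2 r P θ) (x : ℝ) :
    HasDerivAt (momentIntegral g2 r) (g2 (r * Real.sin x) * Real.sin x) x :=
  (((h.continuous_comp h.chart.cont).mul Real.continuous_sin).integral_hasStrictDerivAt _ x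
    ).hasDerivAt

theorem momentIntegral_neg (x : ℝ) :
    momentIntegral g2 r (-Real.pi - x) = -momentIntegral g2 r x :=
  integral_reflect_left (fun s => by rw [sin_neg_pi_sub]) x

theorem momentIntegral_pi_sub (h : IsOrbit q J g g1 g2 r P θ) (x : ℝ) :
    momentIntegral g2 r (Real.pi - x) =
      2 * momentIntegral g2 r (Real.pi / 2) - momentIntegral g2 r x :=
  integral_reflect_right ((h.continuous_comp h.chart.cont).mul Real.continuous_sin)
    (fun s => by simp) x

theorem momentIntegral_add_two_pi (h : IsOrbit q J g g1 g2 r P θ) (x : ℝ) :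
    momentIntegral g2 r (x + 2 * Real.pi) =
      momentIntegral g2 r x + 2 * momentIntegral g2 r (Real.pi / 2) := by
  have h1 := h.momentIntegral_pi_sub (-Real.pi - x)
  rw [momentIntegral_neg, show Real.pi - (-Real.pi - x) = x + 2 * Real.pi by ring] at h1
  linarith

theorem momentIntegral_pos (h : IsOrbit q J g g1 g2 r P θ) :
    0 < momentIntegral g2 r (Real.pi / 2) :=
  integral_comp_mul_sin_mul_sin_pos h.chart.cont h.chart.mono h.pos h.subset

/-- The amplitude derivative of the orbit, as a function of the phase. -/
noncomputable def variation (g1 g2 : ℝ → ℝ) (r x : ℝ) : ℝ :=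
  g1 (r * Real.sin x) * Real.sin x - r * Real.cos x * momentIntegral g2 r x

theorem hasDerivAt_variation (h : IsOrbit q J g g1 g2 r P θ) (x : ℝ) :
    HasDerivAt (variation g1 g2 r) (g1 (r * Real.sin x) * Real.cos x +
      r * Real.sin x * momentIntegral g2 r x) x := by
  have h1 := (((h.chart.deriv2 _ (h.mem x)).comp x (hasDerivAt_mul_sin x)).mul
    (Real.hasDerivAt_sin x)).sub (((Real.hasDerivAt_cos x).const_mul r).mul
      (h.hasDerivAt_momentIntegral x))
  refine h1.congr_deriv ?_
  simp only [Function.comp]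
  ring

theorem hasDerivAt_w (h : IsOrbit q J g g1 g2 r P θ) (t : ℝ) :
    HasDerivAt (fun t => variation g1 g2 r (θ t)) (Real.cos (θ t) +
      (g (r * Real.sin (θ t)) ^ q - 1) / q * momentIntegral g2 r (θ t)) t := by
  have h1 := (h.hasDerivAt_variation (θ t)).comp t (h.phase.deriv t)
  refine h1.congr_deriv ?_
  have h2 := (h.chart.pos1 _ (h.mem (θ t))).ne'
  have h3 := h.chart.force _ (h.mem (θ t))
  rw [← div_eq_mul_inv, div_eq_iff h2]
  linear_combination -momentIntegral g2 r (θ t) * h3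

/-- Together with `hasDerivAt_w` this is w'' + k^(q-1) w = 0, as expected of a derivative of
solutions in a parameter. -/
theorem hasDerivAt_w1 (h : IsOrbit q J g g1 g2 r P θ) (hq : 1 < q) (t : ℝ) :
    HasDerivAt (fun t => Real.cos (θ t) +
      (g (r * Real.sin (θ t)) ^ q - 1) / q * momentIntegral g2 r (θ t))
      (-(g (r * Real.sin (θ t)) ^ (q - 1) * variation g1 g2 r (θ t))) t := by
  have h0 := (hasDerivAt_force hq (h.chart.pos _ (h.mem (θ t)))).comp t (h.hasDerivAt_k t)
  have h1 := ((Real.hasDerivAt_cos (θ t)).comp t (h.phase.deriv t)).add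
    (h0.mul ((h.hasDerivAt_momentIntegral (θ t)).comp t (h.phase.deriv t)))
  refine h1.congr_deriv ?_
  have h2 := (h.chart.pos1 _ (h.mem (θ t))).ne'
  have h3 := h.chart.force_deriv _ (h.mem (θ t))
  simp only [Function.comp, variation]
  generalize (g (r * Real.sin (θ t)) ^ q - 1) / q = V1 at *
  generalize g (r * Real.sin (θ t)) ^ (q - 1) = V2 at *
  generalize g1 (r * Real.sin (θ t)) = a at *
  generalize g2 (r * Real.sin (θ t)) = b at *
  field_simp
  linear_combination Real.sin (θ t) * h3

theorem variation_neg (x : ℝ) : variation g1 g2 r (-Real.pi - x) = variation g1 g2 r x := by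
  simp only [variation, sin_neg_pi_sub, cos_neg_pi_sub, momentIntegral_neg]
  ring

/-- This is k(t + P(r)) = k(t) differentiated in r: the defect is P_r k', where P_r is twice the
half-period moment. -/
theorem variation_add_two_pi (h : IsOrbit q J g g1 g2 r P θ) (x : ℝ) :
    variation g1 g2 r (x + 2 * Real.pi) = variation g1 g2 r x -
      2 * momentIntegral g2 r (Real.pi / 2) * (r * Real.cos x) := by
  simp only [variation, Real.sin_add_two_pi, Real.cos_add_two_pi, h.momentIntegral_add_two_pi]
  ring

/-- The quotient is w/k' for two solutions of the linearised equation. Its time derivative is their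
constant Wronskian, here r, divided by k'². -/
theorem strictMonoOn_variation_div_cos (h : IsOrbit q J g g1 g2 r P θ) :
    StrictMonoOn (fun x => variation g1 g2 r x / (r * Real.cos x))
      (Ioo (-(Real.pi / 2)) (Real.pi / 2)) := by
  have hd : ∀ x ∈ Ioo (-(Real.pi / 2)) (Real.pi / 2), HasDerivAt
      (fun x => variation g1 g2 r x / (r * Real.cos x))
      (g1 (r * Real.sin x) / (r * Real.cos x ^ 2)) x := by
    intro x hx
    have hc := (Real.cos_pos_of_mem_Ioo hx).ne'
    have hr := h.pos.ne'
    have h1 := (h.hasDerivAt_variation x).div ((Real.hasDerivAt_cos x).const_mul r)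
      (mul_ne_zero hr hc)
    refine h1.congr_deriv ?_
    simp only [variation]
    field_simp
    linear_combination g1 (r * Real.sin x) * Real.sin_sq_add_cos_sq x
  refine strictMonoOn_of_deriv_pos (convex_Ioo _ _)
    (fun x hx => (hd x hx).continuousAt.continuousWithinAt) fun x hx => ?_
  rw [interior_Ioo] at hx
  rw [(hd x hx).deriv]
  have := h.chart.pos1 _ (h.mem x)
  have := Real.cos_pos_of_mem_Ioo hx
  have := h.pos
  positivity

/-- A phase splitting the orbit into two intervals without conjugate points. -/
theorem exists_split (h : IsOrbit q J g g1 g2 r P θ) :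
    ∃ x₁ ∈ Ioo (-(Real.pi / 2)) (Real.pi / 2),
      (∀ x ∈ Icc (-Real.pi - x₁) x₁, variation g1 g2 r x < 0) ∧
      ∀ x ∈ Icc x₁ (Real.pi - x₁),
        0 < variation g1 g2 r x + r * Real.cos x * momentIntegral g2 r (Real.pi / 2) := by
  set c := momentIntegral g2 r (Real.pi / 2) with hc
  have hcpos : 0 < c := h.momentIntegral_pos
  have hpi := Real.pi_pos
  have hleft : variation g1 g2 r (-(Real.pi / 2)) < 0 := by
    have := h.chart.pos1 _ (h.mem (-(Real.pi / 2)))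
    simp only [variation, Real.sin_neg, Real.sin_pi_div_two, Real.cos_neg, Real.cos_pi_div_two]
      at this ⊢
    linarith
  have hright : 0 < variation g1 g2 r (Real.pi / 2) := by
    have := h.chart.pos1 _ (h.mem (Real.pi / 2))
    simp only [variation, Real.sin_pi_div_two, Real.cos_pi_div_two] at this ⊢
    linarith
  have hcont : Continuous (variation g1 g2 r) :=
    continuous_iff_continuousAt.2 fun x => (h.hasDerivAt_variation x).continuousAt
  -- At x₁ the quotient w/k' equals -c/2. On the rising half of the orbit, w ≤ -(c/2)k' < 0 before
  -- x₁ and w + c k' ≥ (c/2)k' > 0 after it.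
  obtain ⟨x₁, hx₁, hx₁0⟩ := intermediate_value_Ioo (a := -(Real.pi / 2)) (b := Real.pi / 2)
    (by linarith) (f := fun x => variation g1 g2 r x + r * Real.cos x * (c / 2))
    (by fun_prop) (show (0 : ℝ) ∈ Ioo _ _ by
      constructor
      · simpa using hleft
      · simpa using hright)
  simp only at hx₁0
  have hcos := Real.cos_pos_of_mem_Ioo hx₁
  have hr := h.pos
  have hrc : 0 < r * Real.cos x₁ := by positivity
  have hK : variation g1 g2 r x₁ / (r * Real.cos x₁) = -(c / 2) := by
    rw [div_eq_iff hrc.ne']; linarith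
  have hmono := h.strictMonoOn_variation_div_cos
  have hA : ∀ x ∈ Icc (-(Real.pi / 2)) x₁, variation g1 g2 r x < 0 := by
    intro x hx
    rcases hx.1.eq_or_lt with rfl | hx1
    · exact hleft
    · have hxI : x ∈ Ioo (-(Real.pi / 2)) (Real.pi / 2) := ⟨hx1, hx.2.trans_lt hx₁.2⟩
      have h1 := hmono.monotoneOn hxI hx₁ hx.2
      simp only [hK] at h1
      have h2 : 0 < r * Real.cos x := mul_pos hr (Real.cos_pos_of_mem_Ioo hxI)
      rw [div_le_iff₀ h2] at h1
      nlinarith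
  have hB : ∀ x ∈ Icc x₁ (Real.pi / 2), 0 < variation g1 g2 r x + r * Real.cos x * c := by
    intro x hx
    rcases hx.2.eq_or_lt with rfl | hx1
    · simpa using hright
    · have hxI : x ∈ Ioo (-(Real.pi / 2)) (Real.pi / 2) := ⟨hx₁.1.trans_le hx.1, hx1⟩
      have h1 := hmono.monotoneOn hx₁ hxI hx.1
      simp only [hK] at h1
      have h2 : 0 < r * Real.cos x := mul_pos hr (Real.cos_pos_of_mem_Ioo hxI)
      rw [le_div_iff₀ h2] at h1
      nlinarith
  refine ⟨x₁, hx₁, fun x hx => ?_, fun x hx => ?_⟩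
  -- w is even about the minimum and w + c k' is even about the maximum, so reflection yields the
  -- other halves.
  · rcases le_total (-(Real.pi / 2)) x with hx1 | hx1
    · exact hA x ⟨hx1, hx.2⟩
    · rw [← variation_neg]
      exact hA _ ⟨by linarith, by linarith [hx.1]⟩
  · rcases le_total x (Real.pi / 2) with hx1 | hx1
    · exact hB x ⟨hx.1, hx1⟩
    · have h1 := hB (Real.pi - x) ⟨by linarith [hx.2], by linarith⟩
      simp only [variation, Real.sin_pi_sub, Real.cos_pi_sub, h.momentIntegral_pi_sub, ← hc] at h1 ⊢
      linarith

end IsOrbit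

end Orbit

/-! ### Uniqueness, and the identification of k_α, its period and its area. -/

theorem exists_bounds_of_periodic {k : ℝ → ℝ} (hk : Continuous k) (hpos : ∀ t, 0 < k t) {T : ℝ}
    (hT : 0 < T) (hper : Function.Periodic k T) : ∃ m M, 0 < m ∧ ∀ t, k t ∈ Icc m M := by
  have hne : (Icc 0 T).Nonempty := ⟨0, le_rfl, hT.le⟩
  obtain ⟨t₁, -, h₁⟩ := isCompact_Icc.exists_isMinOn hne hk.continuousOn
  obtain ⟨t₂, -, h₂⟩ := isCompact_Icc.exists_isMaxOn hne hk.continuousOn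
  refine ⟨k t₁, k t₂, hpos _, fun t => ?_⟩
  obtain ⟨s, hs, hst⟩ := hper.exists_mem_Ico₀ hT t
  rw [hst]
  exact ⟨h₁ (Ico_subset_Icc_self hs), h₂ (Ico_subset_Icc_self hs)⟩

theorem oscillator_unique {q : ℝ} (hq : 1 < q) {k k1 l l1 : ℝ → ℝ} {m M : ℝ} (hm : 0 < m)
    (hk : ∀ t, HasDerivAt k (k1 t) t) (hk1 : ∀ t, HasDerivAt k1 (-((k t ^ q - 1) / q)) t)
    (hkm : ∀ t, k t ∈ Icc m M)
    (hl : ∀ t, HasDerivAt l (l1 t) t) (hl1 : ∀ t, HasDerivAt l1 (-((l t ^ q - 1) / q)) t)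
    (hlm : ∀ t, l t ∈ Icc m M) (h0 : k 0 = l 0) (h1 : k1 0 = l1 0) : k = l := by
  -- The first component of the vector field has Lipschitz constant 1, the second M^(q-1) on [m, M].
  set C : ℝ := max 1 (M ^ (q - 1)) with hC
  have hLip : ∀ x ∈ Icc m M, ∀ y ∈ Icc m M,
      |(x ^ q - 1) / q - (y ^ q - 1) / q| ≤ M ^ (q - 1) * |x - y| := by
    intro x hx y hy
    refine (convex_Icc m M).norm_image_sub_le_of_norm_hasDerivWithin_le
      (f := fun k : ℝ => (k ^ q - 1) / q)
      (fun z hz => (hasDerivAt_force hq (hm.trans_le hz.1)).hasDerivWithinAt) (fun z hz => ?_) hy hx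
    have hz0 := hm.trans_le hz.1
    rw [Real.norm_of_nonneg (Real.rpow_nonneg hz0.le _)]
    exact Real.rpow_le_rpow hz0.le hz.2 (by linarith)
  have hv : ∀ _ : ℝ, LipschitzOnWith C.toNNReal
      (fun p : ℝ × ℝ => (p.2, -((p.1 ^ q - 1) / q))) (Icc m M ×ˢ univ) := by
    intro _
    refine LipschitzOnWith.of_dist_le_mul fun p hp p' hp' => ?_
    rw [Real.coe_toNNReal _ (zero_le_one.trans (le_max_left _ _))]
    simp only [Prod.dist_eq, Real.dist_eq]
    have h2 := hLip p.1 hp.1 p'.1 hp'.1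
    have h3 : |-((p.1 ^ q - 1) / q) - -((p'.1 ^ q - 1) / q)| =
        |(p.1 ^ q - 1) / q - (p'.1 ^ q - 1) / q| := by rw [← abs_neg]; ring_nf
    rw [h3]
    have hC1 : 1 ≤ C := le_max_left _ _
    have hC2 : M ^ (q - 1) ≤ C := le_max_right _ _
    refine max_le ?_ (h2.trans ?_)
    · nlinarith [le_max_right |p.1 - p'.1| |p.2 - p'.2|, abs_nonneg (p.2 - p'.2)]
    · exact mul_le_mul hC2 (le_max_left _ _) (abs_nonneg _) (zero_le_one.trans hC1)
  have := ODE_solution_unique_univ (t₀ := 0) (f := fun t => (k t, k1 t)) (g := fun t => (l t, l1 t))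
    hv (fun t => ⟨(hk t).prodMk (hk1 t), hkm t, mem_univ _⟩)
    (fun t => ⟨(hl t).prodMk (hl1 t), hlm t, mem_univ _⟩) (by simp [h0, h1])
  funext t
  exact congrArg Prod.fst (congrFun this t)

theorem iteratedDeriv_two_eq {k k1 k2 : ℝ → ℝ} (hk : ∀ t, HasDerivAt k (k1 t) t)
    (hk1 : ∀ t, HasDerivAt k1 (k2 t) t) : iteratedDeriv 2 k = k2 := by
  have h1 : deriv k = k1 := funext fun t => (hk t).deriv
  have h2 : deriv k1 = k2 := funext fun t => (hk1 t).deriv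
  rw [iteratedDeriv_succ, iteratedDeriv_one, h1, h2]

theorem contDiff_two_of_hasDerivAt {k k1 k2 : ℝ → ℝ} (hk : ∀ t, HasDerivAt k (k1 t) t)
    (hk1 : ∀ t, HasDerivAt k1 (k2 t) t) (hc : Continuous k2) : ContDiff ℝ 2 k := by
  have h1 : deriv k = k1 := funext fun t => (hk t).deriv
  have h2 : deriv k1 = k2 := funext fun t => (hk1 t).deriv
  rw [show (2 : WithTop ℕ∞) = 1 + 1 by norm_num, contDiff_succ_iff_deriv, h1, contDiff_one_iff_deriv,
    h2]
  exact ⟨fun t => (hk t).differentiableAt, by simp, fun t => (hk1 t).differentiableAt, hc⟩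

theorem hasDerivAt_of_contDiff_two {k : ℝ → ℝ} (hk : ContDiff ℝ 2 k) (t : ℝ) :
    HasDerivAt k (deriv k t) t ∧ HasDerivAt (deriv k) (iteratedDeriv 2 k t) t := by
  have h1 : ContDiff ℝ 1 (deriv k) := by
    rw [show (2 : WithTop ℕ∞) = 1 + 1 by norm_num, contDiff_succ_iff_deriv] at hk
    exact hk.2.2
  refine ⟨(hk.differentiable (by norm_num) t).hasDerivAt, ?_⟩
  rw [iteratedDeriv_succ, iteratedDeriv_one]
  exact (h1.differentiable (by norm_num) t).hasDerivAt

theorem IsCanonicalSolution.hasDerivAt {q α : ℝ} {k : ℝ → ℝ} (h : IsCanonicalSolution q α k)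
    (t : ℝ) : HasDerivAt k (deriv k t) t ∧ HasDerivAt (deriv k) (-((k t ^ q - 1) / q)) t := by
  obtain ⟨h1, h2⟩ := hasDerivAt_of_contDiff_two h.1 t
  refine ⟨h1, ?_⟩
  have := h.2.2.2.1 t
  rwa [eq_neg_of_add_eq_zero_left this] at h2

theorem IsCanonicalSolution.unique {q α : ℝ} (hq : 1 < q) {k l : ℝ → ℝ}
    (hk : IsCanonicalSolution q α k) (hl : IsCanonicalSolution q α l) : k = l := by
  obtain ⟨T, hT, hkT⟩ := hk.2.2.1
  obtain ⟨S, hS, hlS⟩ := hl.2.2.1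
  obtain ⟨m, M, hm, hkm⟩ := exists_bounds_of_periodic hk.1.continuous hk.2.1 hT hkT
  obtain ⟨m', M', hm', hlm⟩ := exists_bounds_of_periodic hl.1.continuous hl.2.1 hS hlS
  refine oscillator_unique hq (m := min m m') (M := max M M') (lt_min hm hm')
    (fun t => (hk.hasDerivAt t).1) (fun t => (hk.hasDerivAt t).2)
    (fun t => Icc_subset_Icc (min_le_left _ _) (le_max_left _ _) (hkm t))
    (fun t => (hl.hasDerivAt t).1) (fun t => (hl.hasDerivAt t).2)
    (fun t => Icc_subset_Icc (min_le_right _ _) (le_max_right _ _) (hlm t)) ?_ ?_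
  · rw [hk.2.2.2.2.1, hl.2.2.2.2.1]
  · rw [hk.2.2.2.2.2, hl.2.2.2.2.2]

theorem IsCanonicalSolution.eq_canonicalSolution {q α : ℝ} (hq : 1 < q) {k : ℝ → ℝ}
    (hk : IsCanonicalSolution q α k) : canonicalSolution q α = k :=
  (Classical.epsilon_spec (p := IsCanonicalSolution q α) ⟨k, hk⟩).unique hq hk

namespace IsOrbit

variable {q : ℝ} {J : Set ℝ} {g g1 g2 : ℝ → ℝ} {r P : ℝ} {θ : ℝ → ℝ}

theorem continuous_phase (h : IsOrbit q J g g1 g2 r P θ) : Continuous θ :=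
  continuous_iff_continuousAt.2 fun t => (h.phase.deriv t).continuousAt

theorem periodic (h : IsOrbit q J g g1 g2 r P θ) :
    Function.Periodic (fun t => g (r * Real.sin (θ t))) P := fun t => by
  simp only [h.phase.add_period, Real.sin_add_two_pi]

theorem isCanonicalSolution (h : IsOrbit q J g g1 g2 r P θ) (hq : 1 < q) :
    IsCanonicalSolution q (g (-r)) fun t => g (r * Real.sin (θ t)) := by
  have hc : Continuous fun t => -((g (r * Real.sin (θ t)) ^ q - 1) / q) := by
    have : Continuous fun t => g (r * Real.sin (θ t)) :=
      (h.continuous_comp h.chart.continuousOn).comp h.continuous_phase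
    exact (((this.rpow_const fun t => Or.inr (by linarith)).sub continuous_const).div_const q).neg
  refine ⟨contDiff_two_of_hasDerivAt h.hasDerivAt_k h.hasDerivAt_k1 hc,
    fun t => h.chart.pos _ (h.mem _), ⟨P, h.phase.pos, h.periodic⟩, fun t => ?_, ?_, ?_⟩
  · rw [iteratedDeriv_two_eq h.hasDerivAt_k h.hasDerivAt_k1]
    simp
  · simp [h.phase.zero]
  · rw [(h.hasDerivAt_k 0).deriv, h.phase.zero]
    simp

theorem strictMonoOn (h : IsOrbit q J g g1 g2 r P θ) : StrictMonoOn g (Icc (-r) r) := by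
  refine strictMonoOn_of_deriv_pos (convex_Icc _ _)
    (h.chart.continuousOn.mono h.subset) fun x hx => ?_
  have hx' := h.subset (interior_subset hx)
  rw [(h.chart.deriv1 x hx').deriv]
  exact h.chart.pos1 x hx'

/-- Since g is injective on [-r, r], a period must bring sin θ back to -1; the phase, starting at
-π/2, first does so after a full turn. -/
theorem isLeastPeriod (h : IsOrbit q J g g1 g2 r P θ) :
    IsLeastPeriod (fun t => g (r * Real.sin (θ t))) P := by
  refine ⟨⟨h.phase.pos, h.periodic⟩, fun T ⟨hT, hper⟩ => ?_⟩
  by_contra hTP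
  rw [not_le] at hTP
  have h1 := hper 0
  simp only [zero_add] at h1
  have hr := h.pos
  have h2 := h.strictMonoOn.injOn (mul_sin_mem_Icc (abs_of_pos hr).le _)
    (mul_sin_mem_Icc (abs_of_pos hr).le _) h1
  have h3 := mul_left_cancel₀ hr.ne' h2
  rw [h.phase.zero, Real.sin_neg, Real.sin_pi_div_two] at h3
  have h4 := h.phase.mono hT
  have h5 := h.phase.mono hTP
  have h6 := h.phase.add_period 0
  rw [zero_add] at h6
  rw [h6, h.phase.zero] at h5
  rw [h.phase.zero] at h4
  have h7 : Real.cos (θ T + Real.pi / 2) = 1 := by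
    rw [Real.cos_add_pi_div_two, h3, neg_neg]
  have := (Real.cos_eq_one_iff_of_lt_of_lt (by linarith [Real.pi_pos]) (by linarith)).1 h7
  linarith

theorem canonicalSolution_eq (h : IsOrbit q J g g1 g2 r P θ) (hq : 1 < q) :
    canonicalSolution q (g (-r)) = fun t => g (r * Real.sin (θ t)) :=
  (h.isCanonicalSolution hq).eq_canonicalSolution hq

theorem period_eq (h : IsOrbit q J g g1 g2 r P θ) (hq : 1 < q) : period q (g (-r)) = P := by
  rw [period, h.canonicalSolution_eq hq]
  exact h.isLeastPeriod.csInf_eq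

theorem area_eq (h : IsOrbit q J g g1 g2 r P θ) (hq : 1 < q) : area q (g (-r)) =
    ∫ s in (-(Real.pi / 2))..(3 * Real.pi / 2), g (r * Real.sin s) * g1 (r * Real.sin s) := by
  rw [area, h.canonicalSolution_eq hq, h.period_eq hq]
  exact h.phase.integral_comp (h.continuous_comp h.chart.continuousOn1)
    (h.continuous_comp h.chart.continuousOn)

theorem area_pos (h : IsOrbit q J g g1 g2 r P θ) :
    0 < ∫ s in (-(Real.pi / 2))..(3 * Real.pi / 2), g (r * Real.sin s) * g1 (r * Real.sin s) := by
  refine intervalIntegral.intervalIntegral_pos_of_pos (Continuous.intervalIntegrable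
    ((h.continuous_comp h.chart.continuousOn).mul (h.continuous_comp h.chart.continuousOn1)) _ _)
    (fun s => mul_pos (h.chart.pos _ (h.mem s)) (h.chart.pos1 _ (h.mem s))) ?_
  linarith [Real.pi_pos]

end IsOrbit

/-! ### The condition on E' in terms of the amplitude. -/

/-- In the Morse chart, a negative derivative of the stability function means that
`(3 - q) A P_r + (q - 1) P A_r > 0`. -/
theorem exists_orbit_of_deriv_stabilityFunction_neg {q α : ℝ} (hq : 1 < q) (hα : α ∈ Ioo (0 : ℝ) 1)
    (hE : deriv (stabilityFunction q) α < 0) :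
    ∃ (J : Set ℝ) (g g1 g2 : ℝ → ℝ) (r P : ℝ) (θ : ℝ → ℝ), IsOrbit q J g g1 g2 r P θ ∧ g (-r) = α ∧
      0 < (3 - q) * (∫ s in (-(Real.pi / 2))..(3 * Real.pi / 2),
            g (r * Real.sin s) * g1 (r * Real.sin s)) *
          (∫ s in (-(Real.pi / 2))..(3 * Real.pi / 2), g2 (r * Real.sin s) * Real.sin s) +
        (q - 1) * P * ∫ s in (-(Real.pi / 2))..(3 * Real.pi / 2),
          (g1 (r * Real.sin s) ^ 2 + g (r * Real.sin s) * g2 (r * Real.sin s)) * Real.sin s := by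
  obtain ⟨J, g, g1, g2, ρ, hchart, hρ⟩ := exists_isChart hq
  obtain ⟨hr, hJ, hgα, ρ', hρneg, hρd⟩ := hρ α hα
  obtain ⟨θ, hθ⟩ := hchart.exists_isOrbit hr hJ
  refine ⟨J, g, g1, g2, ρ α, _, θ, hθ, hgα, ?_⟩
  set Pf : ℝ → ℝ := fun r => ∫ s in (-(Real.pi / 2))..(3 * Real.pi / 2), g1 (r * Real.sin s) with hPf
  set Af : ℝ → ℝ := fun r => ∫ s in (-(Real.pi / 2))..(3 * Real.pi / 2),
    g (r * Real.sin s) * g1 (r * Real.sin s) with hAf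
  have hP := hasDerivAt_integral_comp_mul_sin hchart.isOpen hchart.deriv2 hchart.cont hr hJ
    (-(Real.pi / 2)) (3 * Real.pi / 2)
  have hA := hasDerivAt_integral_comp_mul_sin hchart.isOpen (G := fun y => g y * g1 y)
    (G' := fun y => g1 y ^ 2 + g y * g2 y)
    (fun y hy => ((hchart.deriv1 y hy).mul (hchart.deriv2 y hy)).congr_deriv (by ring))
    ((hchart.continuousOn1.pow 2).add (hchart.continuousOn.mul hchart.cont)) hr hJ
    (-(Real.pi / 2)) (3 * Real.pi / 2)
  set Pr := ∫ s in (-(Real.pi / 2))..(3 * Real.pi / 2), g2 (ρ α * Real.sin s) * Real.sin s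
  set Ar := ∫ s in (-(Real.pi / 2))..(3 * Real.pi / 2), (g1 (ρ α * Real.sin s) ^ 2 +
    g (ρ α * Real.sin s) * g2 (ρ α * Real.sin s)) * Real.sin s
  have hPpos : 0 < Pf (ρ α) := hθ.phase.pos
  have hApos : 0 < Af (ρ α) := hθ.area_pos
  -- One chart serves all minima in (0,1), so E is an explicit function of the amplitude near α and
  -- can be differentiated.
  have heq : stabilityFunction q =ᶠ[𝓝 α] fun a => Pf (ρ a) ^ (3 - q) * Af (ρ a) ^ (q - 1) := by
    filter_upwards [isOpen_Ioo.mem_nhds hα] with a ha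
    obtain ⟨hra, hJa, hga, -⟩ := hρ a ha
    obtain ⟨θa, hθa⟩ := hchart.exists_isOrbit hra hJa
    have h1 := hθa.period_eq hq
    have h2 := hθa.area_eq hq
    rw [hga] at h1 h2
    rw [stabilityFunction, h1, h2]
  have hd := ((HasDerivAt.rpow_const (f := fun a => Pf (ρ a)) (p := 3 - q) (HasDerivAt.comp α hP hρd)
    (Or.inl hPpos.ne')).mul (HasDerivAt.rpow_const (f := fun a => Af (ρ a)) (p := q - 1)
      (HasDerivAt.comp α hA hρd) (Or.inl hApos.ne'))).congr_of_eventuallyEq heq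
  rw [hd.deriv, Real.rpow_sub_one hPpos.ne', Real.rpow_sub_one hApos.ne' (q - 1)] at hE
  change 0 < (3 - q) * Af (ρ α) * Pr + (q - 1) * Pf (ρ α) * Ar
  have h1 := Real.rpow_pos_of_pos hPpos (3 - q)
  have h2 := Real.rpow_pos_of_pos hApos (q - 1)
  generalize Pf (ρ α) ^ (3 - q) = x at *
  generalize Af (ρ α) ^ (q - 1) = y at *
  generalize Pf (ρ α) = p at *
  generalize Af (ρ α) = a at *
  -- E' is a positive factor times ρ' times the desired quantity, and ρ' < 0 reverses the sign.
  have h3 : Pr * ρ' * (3 - q) * (x / p) * y + x * (Ar * ρ' * (q - 1) * (y / a)) =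
      (x * y / (p * a)) * (ρ' * ((3 - q) * a * Pr + (q - 1) * p * Ar)) := by
    field_simp
  rw [h3] at hE
  have h4 : ρ' * ((3 - q) * a * Pr + (q - 1) * p * Ar) < 0 :=
    neg_of_mul_neg_right hE (by positivity)
  exact pos_of_mul_neg_right h4 hρneg.le

/-! ### Stability certificates and their construction along an orbit. -/

/-- Solutions of `y'' + V y = 0` and `y'' + V y = lam` which certify that the quadratic form
`∫ u'² - V u²` is nonnegative on zero-mean `X`-periodic functions, with kernel spanned by `κ`. -/
structure IsStabilityCertificate (X a b lam : ℝ) (V κ κ1 ψ ψ1 w w1 z z1 : ℝ → ℝ) : Prop where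
  lt : a < b
  lt' : b < a + X
  lam_pos : 0 < lam
  continuous : Continuous V
  periodic : Function.Periodic V X
  periodic_kernel : Function.Periodic κ X
  periodic_response : Function.Periodic ψ X
  kernel1 : ∀ x, HasDerivAt κ (κ1 x) x
  kernel2 : ∀ x, HasDerivAt κ1 (-(V x * κ x)) x
  response1 : ∀ x, HasDerivAt ψ (ψ1 x) x
  response2 : ∀ x, HasDerivAt ψ1 (lam - V x * ψ x) x
  left1 : ∀ x, HasDerivAt w (w1 x) x
  left2 : ∀ x, HasDerivAt w1 (-(V x * w x)) x
  right1 : ∀ x, HasDerivAt z (z1 x) x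
  right2 : ∀ x, HasDerivAt z1 (-(V x * z x)) x
  left_pos : ∀ x ∈ Icc a b, 0 < w x
  right_pos : ∀ x ∈ Icc b (a + X), 0 < z x
  kernel_ne : κ b ≠ 0
  kernel_odd : κ a = -κ b
  response_even : ψ a = ψ b
  mean_pos : 0 < ∫ x in (0 : ℝ)..X, ψ x

theorem periodic_of_hasDerivAt {f f1 : ℝ → ℝ} {X : ℝ} (hf : ∀ x, HasDerivAt f (f1 x) x)
    (hper : Function.Periodic f X) : Function.Periodic f1 X := by
  intro x
  have h1 := (hf (x + X)).comp_add_const x X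
  rw [show (fun x => f (x + X)) = f from funext hper] at h1
  exact h1.unique (hf x)

/-- Affine changes of variable preserve the certificate, with V and `lam` multiplied by c². This
carries the certificate of the canonical orbit to the steady state itself. -/
theorem IsStabilityCertificate.rescale {X a b lam : ℝ} {V κ κ1 ψ ψ1 w w1 z z1 : ℝ → ℝ}
    (h : IsStabilityCertificate X a b lam V κ κ1 ψ ψ1 w w1 z z1) {c : ℝ} (hc : 0 < c) (x₀ : ℝ) :
    IsStabilityCertificate (X / c) (x₀ + a / c) (x₀ + b / c) (c ^ 2 * lam)
      (fun x => c ^ 2 * V (c * (x - x₀))) (fun x => κ (c * (x - x₀)))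
      (fun x => c * κ1 (c * (x - x₀))) (fun x => ψ (c * (x - x₀)))
      (fun x => c * ψ1 (c * (x - x₀))) (fun x => w (c * (x - x₀))) (fun x => c * w1 (c * (x - x₀)))
      (fun x => z (c * (x - x₀))) (fun x => c * z1 (c * (x - x₀))) := by
  have hs : ∀ x, HasDerivAt (fun x => c * (x - x₀)) c x := fun x =>
    (((hasDerivAt_id x).sub_const x₀).const_mul c).congr_deriv (mul_one c)
  have hper : ∀ {f : ℝ → ℝ}, Function.Periodic f X →
      Function.Periodic (fun x => f (c * (x - x₀))) (X / c) := by
    intro f hf x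
    simp only
    rw [← hf (c * (x - x₀))]
    congr 1
    field_simp
    ring
  have hd1 : ∀ {f f1 : ℝ → ℝ}, (∀ x, HasDerivAt f (f1 x) x) → ∀ x,
      HasDerivAt (fun x => f (c * (x - x₀))) (c * f1 (c * (x - x₀))) x := fun hf x =>
    ((hf _).comp x (hs x)).congr_deriv (mul_comm _ _)
  have ha : ∀ y, c * (x₀ + y / c - x₀) = y := fun y => by field_simp; ring
  refine ⟨?_, ?_, ?_, ?_, ?_, hper h.periodic_kernel, hper h.periodic_response, hd1 h.kernel1,
    fun x => ?_, hd1 h.response1, fun x => ?_, hd1 h.left1, fun x => ?_, hd1 h.right1,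
    fun x => ?_, fun x hx => ?_, fun x hx => ?_, ?_, ?_, ?_, ?_⟩
  · have := div_lt_div_of_pos_right h.lt hc
    linarith
  · have := div_lt_div_of_pos_right h.lt' hc
    rw [add_div] at this
    linarith
  · have := h.lam_pos
    positivity
  · have := h.continuous
    fun_prop
  · intro x
    have := hper h.periodic x
    simp only at this ⊢
    rw [this]
  · exact ((hd1 h.kernel2 x).const_mul c).congr_deriv (by ring)
  · exact ((hd1 h.response2 x).const_mul c).congr_deriv (by ring)
  · exact ((hd1 h.left2 x).const_mul c).congr_deriv (by ring)
  · exact ((hd1 h.right2 x).const_mul c).congr_deriv (by ring)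
  · refine h.left_pos _ ⟨?_, ?_⟩
    · rw [← ha a]; exact mul_le_mul_of_nonneg_left (by linarith [hx.1]) hc.le
    · rw [← ha b]; exact mul_le_mul_of_nonneg_left (by linarith [hx.2]) hc.le
  · refine h.right_pos _ ⟨?_, ?_⟩
    · rw [← ha b]; exact mul_le_mul_of_nonneg_left (by linarith [hx.1]) hc.le
    · rw [← ha (a + X), add_div]; exact mul_le_mul_of_nonneg_left (by linarith [hx.2]) hc.le
  · simp only [ha]; exact h.kernel_ne
  · simp only [ha]; exact h.kernel_odd
  · simp only [ha]; exact h.response_even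
  · have h1 := intervalIntegral.integral_comp_mul_sub (a := 0) (b := X / c) ψ hc.ne' (c * x₀)
    have h2 : (fun x => ψ (c * (x - x₀))) = fun x => ψ (c * x - c * x₀) := by
      funext x; rw [mul_sub]
    have h3 := h.periodic_response.intervalIntegral_add_eq (c * 0 - c * x₀) 0
    rw [show c * 0 - c * x₀ + X = c * (X / c) - c * x₀ by field_simp; ring, zero_add] at h3
    rw [h2, h1, h3, smul_eq_mul]
    exact mul_pos (inv_pos.2 hc) h.mean_pos

namespace IsOrbit

variable {q : ℝ} {J : Set ℝ} {g g1 g2 : ℝ → ℝ} {r P : ℝ} {θ : ℝ → ℝ}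

/-- This is A_r for A = ∫₀^P k with a moving endpoint: A_r is the integral of w plus k(P) P_r, and
k(P) is the minimum g(-r). -/
theorem integral_w (h : IsOrbit q J g g1 g2 r P θ) :
    ∫ t in (0 : ℝ)..P, variation g1 g2 r (θ t) =
      (∫ s in (-(Real.pi / 2))..(3 * Real.pi / 2),
        (g1 (r * Real.sin s) ^ 2 + g (r * Real.sin s) * g2 (r * Real.sin s)) * Real.sin s) -
      g (-r) * momentIntegral g2 r (3 * Real.pi / 2) := by
  have hg := h.continuous_comp h.chart.continuousOn
  have hg1 := h.continuous_comp h.chart.continuousOn1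
  have hg2 := h.continuous_comp h.chart.cont
  have hI : Continuous (momentIntegral g2 r) :=
    continuous_iff_continuousAt.2 fun x => (h.hasDerivAt_momentIntegral x).continuousAt
  have hvar : Continuous (variation g1 g2 r) :=
    continuous_iff_continuousAt.2 fun x => (h.hasDerivAt_variation x).continuousAt
  rw [h.phase.integral_comp hg1 hvar]
  have hd : ∀ x, HasDerivAt (fun x => g (r * Real.sin x) * momentIntegral g2 r x)
      (g1 (r * Real.sin x) * (r * Real.cos x) * momentIntegral g2 r x +
        g (r * Real.sin x) * (g2 (r * Real.sin x) * Real.sin x)) x := fun x =>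
    ((h.chart.deriv1 _ (h.mem x)).comp x (hasDerivAt_mul_sin x)).mul (h.hasDerivAt_momentIntegral x)
  have hc : Continuous fun x => g1 (r * Real.sin x) * (r * Real.cos x) * momentIntegral g2 r x +
        g (r * Real.sin x) * (g2 (r * Real.sin x) * Real.sin x) :=
    ((hg1.mul (continuous_const.mul Real.continuous_cos)).mul hI).add
      (hg.mul (hg2.mul Real.continuous_sin))
  have h1 := intervalIntegral.integral_eq_sub_of_hasDerivAt (a := -(Real.pi / 2))
    (b := 3 * Real.pi / 2) (fun x _ => hd x) (hc.intervalIntegrable _ _)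
  have h2 : momentIntegral g2 r (-(Real.pi / 2)) = 0 := intervalIntegral.integral_same
  have h3 : Real.sin (3 * Real.pi / 2) = -1 := by
    rw [show 3 * Real.pi / 2 = Real.pi / 2 + Real.pi by ring, Real.sin_add_pi,
      Real.sin_pi_div_two]
  rw [h2, h3, mul_zero, sub_zero, mul_neg_one] at h1
  rw [← h1, ← intervalIntegral.integral_sub]
  · refine intervalIntegral.integral_congr fun x _ => ?_
    simp only [variation]
    ring
  · exact Continuous.intervalIntegrable (((hg1.pow 2).add (hg.mul hg2)).mul Real.continuous_sin) _ _
  · exact hc.intervalIntegrable _ _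

/-- The family λ k(λ^((q-1)/2) t) solves the oscillator equation with constant term λ^q/q. Its
derivative at λ = 1, namely k + ((q-1)/2) t k', therefore solves the linearised equation with right
side 1. It fails to be periodic by a multiple of k', as does w, so a combination with w gives the
periodic response ψ. -/
theorem exists_certificate (h : IsOrbit q J g g1 g2 r P θ) (hq : 1 < q)
    (hE : 0 < (3 - q) * (∫ s in (-(Real.pi / 2))..(3 * Real.pi / 2),
            g (r * Real.sin s) * g1 (r * Real.sin s)) *
          (∫ s in (-(Real.pi / 2))..(3 * Real.pi / 2), g2 (r * Real.sin s) * Real.sin s) +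
        (q - 1) * P * ∫ s in (-(Real.pi / 2))..(3 * Real.pi / 2),
          (g1 (r * Real.sin s) ^ 2 + g (r * Real.sin s) * g2 (r * Real.sin s)) * Real.sin s) :
    ∃ a b ψ ψ1 w w1 z z1, IsStabilityCertificate P a b 1
      (fun t => g (r * Real.sin (θ t)) ^ (q - 1)) (fun t => r * Real.cos (θ t))
      (fun t => -((g (r * Real.sin (θ t)) ^ q - 1) / q)) ψ ψ1 w w1 z z1 := by
  obtain ⟨x₁, hx₁, hleft, hright⟩ := h.exists_split
  set c := momentIntegral g2 r (Real.pi / 2) with hc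
  have hcpos : 0 < c := h.momentIntegral_pos
  have hr := h.pos
  have hPpos := h.phase.pos
  have hq0 : q ≠ 0 := by linarith
  have hm2 : momentIntegral g2 r (3 * Real.pi / 2) = 2 * c :=
    integral_half ((h.continuous_comp h.chart.cont).mul Real.continuous_sin) (fun s => by simp)
  set b := ∫ s in (-(Real.pi / 2))..x₁, g1 (r * Real.sin s) with hb
  have hθb : θ b = x₁ := h.phase.right_inv x₁
  have hθb' : θ (-b) = -Real.pi - x₁ := by rw [h.phase.neg, hθb]
  have hθb'' : θ (-b + P) = Real.pi - x₁ := by rw [h.phase.add_period, hθb']; ring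
  have hθc := h.continuous_phase
  have hkc : Continuous fun t => g (r * Real.sin (θ t)) :=
    (h.continuous_comp h.chart.continuousOn).comp hθc
  have hwc : Continuous fun t => variation g1 g2 r (θ t) :=
    continuous_iff_continuousAt.2 fun t => (h.hasDerivAt_w t).continuousAt
  -- Over one period t k' gains P k' and w loses 2c k' = P_r k'; this μ makes the two defects
  -- cancel.
  set μ := (q - 1) * P / (2 * (2 * c)) with hμ
  set k : ℝ → ℝ := fun t => g (r * Real.sin (θ t)) with hk
  set k1 : ℝ → ℝ := fun t => r * Real.cos (θ t) with hk1
  set v : ℝ → ℝ := fun t => variation g1 g2 r (θ t) with hv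
  set v1 : ℝ → ℝ := fun t => Real.cos (θ t) + (k t ^ q - 1) / q * momentIntegral g2 r (θ t) with hv1
  have hdk : ∀ t, HasDerivAt k (k1 t) t := h.hasDerivAt_k
  have hdk1 : ∀ t, HasDerivAt k1 (-((k t ^ q - 1) / q)) t := h.hasDerivAt_k1
  have hdv : ∀ t, HasDerivAt v (v1 t) t := h.hasDerivAt_w
  have hdv1 : ∀ t, HasDerivAt v1 (-(k t ^ (q - 1) * v t)) t := h.hasDerivAt_w1 hq
  have hkpos : ∀ t, 0 < k t := fun t => h.chart.pos _ (h.mem _)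
  have hdk2 : ∀ t, HasDerivAt (fun t => -((k t ^ q - 1) / q)) (-(k t ^ (q - 1) * k1 t)) t := fun t =>
    ((hasDerivAt_force hq (hkpos t)).comp t (hdk t)).neg
  have hk1c : Continuous k1 := by fun_prop
  have hkper : Function.Periodic k P := h.periodic
  have hk1per : Function.Periodic k1 P := periodic_of_hasDerivAt hdk hkper
  have hvper : ∀ t, v (t + P) = v t - 2 * c * k1 t := fun t => by
    simp only [hv, h.phase.add_period, h.variation_add_two_pi, hk1, ← hc]
  have hkneg : ∀ t, k (-t) = k t := fun t => by
    simp only [hk, h.phase.neg, sin_neg_pi_sub]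
  have hk1neg : ∀ t, k1 (-t) = -k1 t := fun t => by
    simp only [hk1, h.phase.neg, cos_neg_pi_sub]; ring
  have hvneg : ∀ t, v (-t) = v t := fun t => by
    simp only [hv, h.phase.neg, variation_neg]
  -- [-b, b] surrounds the minimum at time 0, where -w > 0. [b, P - b] surrounds the maximum at P/2,
  -- where w + c k', even about P/2, is positive.
  refine ⟨-b, b, fun t => k t + (q - 1) / 2 * (t * k1 t) + μ * v t,
    fun t => k1 t + (q - 1) / 2 * (k1 t + t * -((k t ^ q - 1) / q)) + μ * v1 t,
    fun t => -v t, fun t => -v1 t, fun t => v t + c * k1 t,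
    fun t => v1 t + c * -((k t ^ q - 1) / q), ?_, ?_, one_pos, ?_, ?_, hk1per, ?_, hdk1, hdk2,
    fun t => ?_, fun t => ?_, fun t => (hdv t).neg, fun t => ?_, fun t => ?_, fun t => ?_,
    fun t ht => ?_, fun t ht => ?_, ?_, ?_, ?_, ?_⟩
  · rw [← h.phase.mono.lt_iff_lt, hθb, hθb']
    linarith [hx₁.1]
  · rw [← h.phase.mono.lt_iff_lt, hθb, hθb'']
    linarith [hx₁.2]
  · exact hkc.rpow_const fun t => Or.inl (hkpos t).ne'
  · intro t
    have := hkper t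
    simp only [hk] at this ⊢
    rw [this]
  · intro t
    simp only [hkper t, hk1per t, hvper t, hμ]
    field_simp
    ring
  · refine (((hdk t).add (((hasDerivAt_id t).mul (hdk1 t)).const_mul ((q - 1) / 2))).add
      ((hdv t).const_mul μ)).congr_deriv ?_
    simp
  · refine (((hdk1 t).add (((hdk1 t).add ((hasDerivAt_id t).mul (hdk2 t))).const_mul
      ((q - 1) / 2))).add ((hdv1 t).const_mul μ)).congr_deriv ?_
    have : k t ^ q = k t ^ (q - 1) * k t := by
      rw [Real.rpow_sub_one (hkpos t).ne', div_mul_cancel₀ _ (hkpos t).ne']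
    simp only [id]
    rw [this]
    field_simp
    ring
  · exact ((hdv1 t).neg).congr_deriv (by ring)
  · exact (hdv t).add ((hdk1 t).const_mul c)
  · exact ((hdv1 t).add ((hdk2 t).const_mul c)).congr_deriv (by ring)
  · rw [neg_pos]
    exact hleft _ ⟨by rw [← hθb']; exact h.phase.mono.monotone ht.1,
      by rw [← hθb]; exact h.phase.mono.monotone ht.2⟩
  · have := hright (θ t) ⟨by rw [← hθb]; exact h.phase.mono.monotone ht.1,
      by rw [← hθb'']; exact h.phase.mono.monotone ht.2⟩
    simp only [hv, hk1]
    linarith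
  · simp only [hk1, hθb]
    exact (mul_pos hr (Real.cos_pos_of_mem_Ioo hx₁)).ne'
  · exact hk1neg b
  · simp only [hkneg, hk1neg, hvneg]
    ring
  · have hA : ∫ t in (0 : ℝ)..P, k t = ∫ s in (-(Real.pi / 2))..(3 * Real.pi / 2),
        g (r * Real.sin s) * g1 (r * Real.sin s) :=
      h.phase.integral_comp (h.continuous_comp h.chart.continuousOn1)
        (h.continuous_comp h.chart.continuousOn)
    have htkc : Continuous fun t => t * k1 t := continuous_id.mul hk1c
    have htk : ∫ t in (0 : ℝ)..P, (k t + t * k1 t) = P * g (-r) := by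
      have hd : ∀ t, HasDerivAt (fun t => t * k t) (k t + t * k1 t) t := fun t =>
        ((hasDerivAt_id t).mul (hdk t)).congr_deriv (by simp)
      rw [intervalIntegral.integral_eq_sub_of_hasDerivAt (fun t _ => hd t)
        (Continuous.intervalIntegrable (hkc.add htkc) _ _)]
      have h1 := hkper 0
      rw [zero_add] at h1
      have h2 : k 0 = g (-r) := by simp [hk, h.phase.zero]
      rw [h1, h2, zero_mul, sub_zero]
    have htk' : ∫ t in (0 : ℝ)..P, t * k1 t = P * g (-r) - ∫ t in (0 : ℝ)..P, k t := by
      rw [← htk, intervalIntegral.integral_add (hkc.intervalIntegrable _ _)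
        (htkc.intervalIntegrable _ _)]
      ring
    have hw := h.integral_w
    rw [hm2] at hw
    have hPr : ∫ s in (-(Real.pi / 2))..(3 * Real.pi / 2), g2 (r * Real.sin s) * Real.sin s =
      2 * c := hm2
    rw [hPr, ← hA] at hE
    rw [intervalIntegral.integral_add, intervalIntegral.integral_add,
      intervalIntegral.integral_const_mul, intervalIntegral.integral_const_mul, htk', hw]
    · generalize (∫ s in (-(Real.pi / 2))..(3 * Real.pi / 2),
          (g1 (r * Real.sin s) ^ 2 + g (r * Real.sin s) * g2 (r * Real.sin s)) * Real.sin s) = Ar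
          at *
      generalize (∫ t in (0 : ℝ)..P, k t) = A at *
      -- The boundary terms with g(-r) cancel by the choice of μ, leaving the combination controlled
      -- by E'.
      have : A + (q - 1) / 2 * (P * g (-r) - A) + μ * (Ar - g (-r) * (2 * c)) =
          ((3 - q) * A * (2 * c) + (q - 1) * P * Ar) / (2 * (2 * c)) := by
        rw [hμ]
        field_simp
        ring
      rw [this]
      positivity
    · exact hkc.intervalIntegrable _ _
    · exact Continuous.intervalIntegrable (continuous_const.mul htkc) _ _
    · exact Continuous.intervalIntegrable
        (hkc.add (continuous_const.mul htkc)) _ _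
    · exact Continuous.intervalIntegrable (continuous_const.mul hwc) _ _

end IsOrbit

/-! ### Absolutely continuous functions and Jacobi's identity. -/

/-- `u` is locally absolutely continuous with locally square integrable derivative `v`. -/
structure HasL2Deriv (u v : ℝ → ℝ) : Prop where
  ac : ∀ a b, AbsolutelyContinuousOnInterval u a b
  deriv : ∀ᵐ x, HasDerivAt u (v x) x
  int : ∀ a b, IntervalIntegrable v volume a b
  sq : ∀ a b, IntervalIntegrable (fun x => v x ^ 2) volume a b

theorem absolutelyContinuousOnInterval_of_hasDerivAt {u v : ℝ → ℝ} {a b : ℝ}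
    (hd : ∀ x ∈ uIcc a b, HasDerivAt u (v x) x) (hc : ContinuousOn v (uIcc a b)) :
    AbsolutelyContinuousOnInterval u a b := by
  obtain ⟨C, hC⟩ := isCompact_uIcc.exists_bound_of_continuousOn hc
  refine LipschitzOnWith.absolutelyContinuousOnInterval (K := C.toNNReal) ?_
  refine (convex_uIcc a b).lipschitzOnWith_of_nnnorm_hasDerivWithin_le
    (fun x hx => (hd x hx).hasDerivWithinAt) fun x hx => ?_
  rw [← NNReal.coe_le_coe, coe_nnnorm]
  exact (hC x hx).trans (Real.le_coe_toNNReal C)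

theorem HasL2Deriv.of_hasDerivAt {u v : ℝ → ℝ} (hd : ∀ x, HasDerivAt u (v x) x)
    (hc : Continuous v) : HasL2Deriv u v :=
  ⟨fun _ _ => absolutelyContinuousOnInterval_of_hasDerivAt (fun x _ => hd x) hc.continuousOn,
    Eventually.of_forall hd, fun _ _ => hc.intervalIntegrable _ _,
    fun _ _ => (hc.pow 2).intervalIntegrable _ _⟩

theorem HasL2Deriv.continuous {u v : ℝ → ℝ} (h : HasL2Deriv u v) : Continuous u := by
  refine continuous_iff_continuousAt.2 fun x => ?_
  have := (h.ac (x - 1) (x + 1)).continuousOn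
  rw [uIcc_of_le (by linarith)] at this
  exact this.continuousAt (Icc_mem_nhds (by linarith) (by linarith))

theorem HasL2Deriv.mul_int {u v : ℝ → ℝ} (h : HasL2Deriv u v) {f : ℝ → ℝ} (hf : Continuous f)
    (a b : ℝ) : IntervalIntegrable (fun x => v x * f x) volume a b :=
  (h.int a b).mul_continuousOn hf.continuousOn

theorem HasL2Deriv.add {u v f f1 : ℝ → ℝ} (h : HasL2Deriv u v) (hd : ∀ x, HasDerivAt f (f1 x) x)
    (hc : Continuous f1) : HasL2Deriv (fun x => u x + f x) (fun x => v x + f1 x) := by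
  refine ⟨fun a b => (h.ac a b).fun_add ((HasL2Deriv.of_hasDerivAt hd hc).ac a b), ?_,
    fun a b => (h.int a b).add (hc.intervalIntegrable _ _), fun a b => ?_⟩
  · filter_upwards [h.deriv] with x hx using hx.add (hd x)
  · have : (fun x => (v x + f1 x) ^ 2) = fun x => v x ^ 2 + v x * (2 * f1 x) + f1 x ^ 2 := by
      funext x; ring
    rw [this]
    exact ((h.sq a b).add (h.mul_int (by fun_prop) a b)).add ((hc.pow 2).intervalIntegrable _ _)

theorem HasL2Deriv.integral_by_parts {u v f f1 : ℝ → ℝ} (h : HasL2Deriv u v)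
    (hd : ∀ x, HasDerivAt f (f1 x) x) (hc : Continuous f1) (a b : ℝ) :
    ∫ x in a..b, (v x * f x + u x * f1 x) = u b * f b - u a * f a := by
  rw [← AbsolutelyContinuousOnInterval.integral_deriv_mul_eq_sub (h.ac a b)
    ((HasL2Deriv.of_hasDerivAt hd hc).ac a b)]
  refine intervalIntegral.integral_congr_ae ?_
  filter_upwards [h.deriv] with x hx _
  rw [hx.deriv, (hd x).deriv]

theorem HasL2Deriv.integral_deriv_mul_sq {u v R R' : ℝ → ℝ} (h : HasL2Deriv u v) {a b : ℝ}
    (hR : ∀ x ∈ uIcc a b, HasDerivAt R (R' x) x) (hc : ContinuousOn R' (uIcc a b)) :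
    ∫ x in a..b, (R' x * u x ^ 2 + R x * (2 * u x * v x)) = R b * u b ^ 2 - R a * u a ^ 2 := by
  have h1 := AbsolutelyContinuousOnInterval.integral_deriv_mul_eq_sub
    (absolutelyContinuousOnInterval_of_hasDerivAt hR hc) ((h.ac a b).fun_mul (h.ac a b))
  refine Eq.trans ?_ (h1.trans (by ring))
  refine intervalIntegral.integral_congr_ae ?_
  filter_upwards [h.deriv] with x hx hxI
  rw [(hR x (uIoc_subset_uIcc hxI)).deriv, (hx.fun_mul hx).deriv]
  ring

theorem HasL2Deriv.form_integrable {u v V : ℝ → ℝ} (h : HasL2Deriv u v) (hV : Continuous V)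
    (a b : ℝ) : IntervalIntegrable (fun x => v x ^ 2 - V x * u x ^ 2) volume a b := by
  have := h.continuous
  exact (h.sq a b).sub (Continuous.intervalIntegrable (by fun_prop) a b)

/-- Jacobi's identity for the second variation on an interval without conjugate points. -/
theorem HasL2Deriv.jacobi {u v V w w1 : ℝ → ℝ} (h : HasL2Deriv u v) {a b : ℝ} (hab : a ≤ b)
    (hV : Continuous V) (hw : ∀ x, HasDerivAt w (w1 x) x)
    (hw1 : ∀ x, HasDerivAt w1 (-(V x * w x)) x) (hpos : ∀ x ∈ Icc a b, 0 < w x)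
    (ha : u a = 0) (hb : u b = 0) :
    0 ≤ ∫ x in a..b, (v x ^ 2 - V x * u x ^ 2) ∧
      ((∫ x in a..b, (v x ^ 2 - V x * u x ^ 2)) = 0 → ∀ x ∈ Icc a b, u x = 0) := by
  have hI : uIcc a b = Icc a b := uIcc_of_le hab
  have hwc : Continuous w := continuous_iff_continuousAt.2 fun x => (hw x).continuousAt
  have hw1c : Continuous w1 := continuous_iff_continuousAt.2 fun x => (hw1 x).continuousAt
  have hne : ∀ x ∈ uIcc a b, w x ≠ 0 := fun x hx => (hpos x (hI ▸ hx)).ne'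
  -- R = w'/w solves the Riccati equation R' = -V - R². Hence v² - V u² = (v - R u)² + (R u²)', and
  -- the last term integrates to zero.
  have hR : ∀ x ∈ uIcc a b, HasDerivAt (fun x => w1 x / w x) (-V x - (w1 x / w x) ^ 2) x := by
    intro x hx
    refine ((hw1 x).div (hw x) (hne x hx)).congr_deriv ?_
    have := hne x hx
    field_simp
  have hRc : ContinuousOn (fun x => w1 x / w x) (uIcc a b) := fun x hx =>
    (hR x hx).continuousAt.continuousWithinAt
  have hR'c : ContinuousOn (fun x => -V x - (w1 x / w x) ^ 2) (uIcc a b) :=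
    hV.neg.continuousOn.sub (hRc.pow 2)
  have hu := h.continuous
  have hid := h.integral_deriv_mul_sq hR hR'c
  rw [ha, hb] at hid
  have hint1 : IntervalIntegrable (fun x => v x * (2 * u x * (w1 x / w x))) volume a b :=
    (h.int a b).mul_continuousOn (((continuous_const.mul hu).continuousOn).mul hRc)
  have hint2 : IntervalIntegrable (fun x => (-V x - (w1 x / w x) ^ 2) * u x ^ 2 +
      w1 x / w x * (2 * u x * v x)) volume a b := by
    refine (ContinuousOn.intervalIntegrable (hR'c.mul (hu.pow 2).continuousOn)).add ?_
    exact hint1.congr_ae (Eventually.of_forall fun x => by ring)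
  have hform := h.form_integrable hV a b
  have hsq_eq : ∀ x, (v x - w1 x / w x * u x) ^ 2 = (v x ^ 2 - V x * u x ^ 2) -
      ((-V x - (w1 x / w x) ^ 2) * u x ^ 2 + w1 x / w x * (2 * u x * v x)) := fun x => by ring
  have hsq_int : IntervalIntegrable (fun x => (v x - w1 x / w x * u x) ^ 2) volume a b := by
    simp only [hsq_eq]
    exact hform.sub hint2
  have hkey : ∫ x in a..b, (v x ^ 2 - V x * u x ^ 2) =
      ∫ x in a..b, (v x - w1 x / w x * u x) ^ 2 := by
    simp only [hsq_eq]
    rw [intervalIntegral.integral_sub hform hint2, hid]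
    ring
  rw [hkey]
  refine ⟨intervalIntegral.integral_nonneg hab fun x _ => sq_nonneg _, fun h0 => ?_⟩
  rw [intervalIntegral.integral_eq_zero_iff_of_le_of_nonneg_ae hab
    (Eventually.of_forall fun x => sq_nonneg _) hsq_int] at h0
  have h0' := (ae_restrict_iff' measurableSet_Ioc).1 h0
  have hinv : ∀ x ∈ uIcc a b, HasDerivAt (fun x => (w x)⁻¹) (-w1 x / w x ^ 2) x := fun x hx =>
    (hw x).inv (hne x hx)
  have hinvc : ContinuousOn (fun x => -w1 x / w x ^ 2) (uIcc a b) :=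
    hw1c.neg.continuousOn.div (hwc.pow 2).continuousOn fun x hx => pow_ne_zero 2 (hne x hx)
  -- Equality means u' = (w'/w) u almost everywhere, so (u/w)' = 0; absolute continuity makes u/w
  -- constant, and it vanishes at a.
  have hac : AbsolutelyContinuousOnInterval (fun x => u x * (w x)⁻¹) a b :=
    (h.ac a b).fun_mul (absolutelyContinuousOnInterval_of_hasDerivAt hinv hinvc)
  have hae : ∀ᵐ x, x ∈ uIcc a b → HasDerivAt (fun x => u x * (w x)⁻¹) 0 x := by
    have hane : ∀ᵐ x : ℝ, x ≠ a := by simp [ae_iff, measure_singleton]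
    filter_upwards [h.deriv, h0', hane] with x hx1 hx2 hx3 hx4
    rw [hI] at hx4
    have hx5 := hx2 ⟨lt_of_le_of_ne hx4.1 (Ne.symm hx3), hx4.2⟩
    simp only [Pi.zero_apply, sq_eq_zero_iff, sub_eq_zero] at hx5
    refine (hx1.mul (hinv x (hI ▸ hx4))).congr_deriv ?_
    have := hne x (hI ▸ hx4)
    rw [hx5]
    field_simp
    ring
  obtain ⟨C, hC⟩ := hac.const_of_ae_hasDerivAt_zero hae
  intro x hx
  have h1 := hC a left_mem_uIcc
  have h2 := hC x (hI ▸ hx)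
  simp only [ha, zero_mul] at h1 h2
  rw [← h1] at h2
  exact (mul_eq_zero.1 h2).resolve_right (inv_ne_zero (hpos x hx).ne')

/-! ### Nonnegativity of the second variation. -/

namespace IsStabilityCertificate

variable {X a b lam : ℝ} {V κ κ1 ψ ψ1 w w1 z z1 : ℝ → ℝ}

theorem period_pos (h : IsStabilityCertificate X a b lam V κ κ1 ψ ψ1 w w1 z z1) : 0 < X := by
  linarith [h.lt, h.lt']

/-- [a, b] and [b, a + X] tile one period and each carries a positive solution of the linearised
equation, so Jacobi's identity applies to each. -/
theorem form_of_vanish (h : IsStabilityCertificate X a b lam V κ κ1 ψ ψ1 w w1 z z1)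
    {u v : ℝ → ℝ} (hu : HasL2Deriv u v) (hper : Function.Periodic u X)
    (hperv : Function.Periodic v X) (ha : u a = 0) (hb : u b = 0) :
    0 ≤ ∫ x in (0 : ℝ)..X, (v x ^ 2 - V x * u x ^ 2) ∧
      ((∫ x in (0 : ℝ)..X, (v x ^ 2 - V x * u x ^ 2)) = 0 → ∀ x, u x = 0) := by
  have hp : Function.Periodic (fun x => v x ^ 2 - V x * u x ^ 2) X := fun x => by
    simp only [hper x, hperv x, h.periodic x]
  have hshift := hp.intervalIntegral_add_eq 0 a
  rw [zero_add] at hshift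
  have haX : u (a + X) = 0 := by rw [hper, ha]
  obtain ⟨h1, h1'⟩ := hu.jacobi h.lt.le h.continuous h.left1 h.left2 h.left_pos ha hb
  obtain ⟨h2, h2'⟩ := hu.jacobi h.lt'.le h.continuous h.right1 h.right2 h.right_pos hb haX
  have hadd := intervalIntegral.integral_add_adjacent_intervals
    (hu.form_integrable h.continuous a b) (hu.form_integrable h.continuous b (a + X))
  rw [hshift, ← hadd]
  refine ⟨add_nonneg h1 h2, fun h0 x => ?_⟩
  obtain ⟨y, hy, hxy⟩ := hper.exists_mem_Ico h.period_pos x a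
  rw [hxy]
  rcases le_total y b with hyb | hyb
  · exact h1' (by linarith) y ⟨hy.1, hyb⟩
  · exact h2' (by linarith) y ⟨hyb, hy.2.le⟩

/-- Pairing with a solution of `f'' + V f = μ`. -/
theorem pairing (h : IsStabilityCertificate X a b lam V κ κ1 ψ ψ1 w w1 z z1)
    {u v f f1 : ℝ → ℝ} {μ : ℝ} (hu : HasL2Deriv u v) (hper : Function.Periodic u X)
    (hf : ∀ x, HasDerivAt f (f1 x) x) (hf1 : ∀ x, HasDerivAt f1 (μ - V x * f x) x)
    (hfper : Function.Periodic f X) :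
    ∫ x in (0 : ℝ)..X, (v x * f1 x - V x * u x * f x) = -(μ * ∫ x in (0 : ℝ)..X, u x) := by
  have hfc : Continuous f := continuous_iff_continuousAt.2 fun x => (hf x).continuousAt
  have hf1c : Continuous f1 := continuous_iff_continuousAt.2 fun x => (hf1 x).continuousAt
  have hV := h.continuous
  have huc := hu.continuous
  have h1 := hu.integral_by_parts hf1 (by fun_prop) 0 X
  have h2 := periodic_of_hasDerivAt hf hfper 0
  have h3 := hper 0
  rw [zero_add] at h2 h3
  rw [h2, h3, sub_self] at h1
  rw [← zero_sub, ← intervalIntegral.integral_const_mul]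
  refine Eq.trans ?_ (congrArg (fun y => y - ∫ x in (0 : ℝ)..X, μ * u x) h1)
  rw [← intervalIntegral.integral_sub]
  · exact intervalIntegral.integral_congr fun x _ => by ring
  · exact (hu.mul_int hf1c _ _).add (Continuous.intervalIntegrable (by fun_prop) _ _)
  · exact Continuous.intervalIntegrable (by fun_prop) _ _

/-- Expansion of the quadratic form along a solution of `f'' + V f = μ`. -/
theorem form_add (h : IsStabilityCertificate X a b lam V κ κ1 ψ ψ1 w w1 z z1)
    {u v f f1 : ℝ → ℝ} {μ : ℝ} (hu : HasL2Deriv u v) (hper : Function.Periodic u X)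
    (hf : ∀ x, HasDerivAt f (f1 x) x) (hf1 : ∀ x, HasDerivAt f1 (μ - V x * f x) x)
    (hfper : Function.Periodic f X) :
    ∫ x in (0 : ℝ)..X, ((v x + f1 x) ^ 2 - V x * (u x + f x) ^ 2) =
      (∫ x in (0 : ℝ)..X, (v x ^ 2 - V x * u x ^ 2)) - 2 * μ * (∫ x in (0 : ℝ)..X, u x) -
        μ * ∫ x in (0 : ℝ)..X, f x := by
  have hfc : Continuous f := continuous_iff_continuousAt.2 fun x => (hf x).continuousAt
  have hf1c : Continuous f1 := continuous_iff_continuousAt.2 fun x => (hf1 x).continuousAt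
  have hV := h.continuous
  have huc := hu.continuous
  have h1 := h.pairing hu hper hf hf1 hfper
  have h2 := h.pairing (HasL2Deriv.of_hasDerivAt hf hf1c) hfper hf hf1 hfper
  have hi1 : IntervalIntegrable (fun x => 2 * (v x * f1 x - V x * u x * f x)) volume 0 X :=
    ((hu.mul_int hf1c _ _).sub (Continuous.intervalIntegrable (by fun_prop) _ _)).const_mul 2
  have hi2 : IntervalIntegrable (fun x => f1 x * f1 x - V x * f x * f x) volume 0 X :=
    Continuous.intervalIntegrable (by fun_prop) _ _
  have hform := hu.form_integrable h.continuous 0 X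
  have h3 : ∀ x, (v x + f1 x) ^ 2 - V x * (u x + f x) ^ 2 = (v x ^ 2 - V x * u x ^ 2) +
      2 * (v x * f1 x - V x * u x * f x) + (f1 x * f1 x - V x * f x * f x) := fun x => by ring
  simp only [h3]
  rw [intervalIntegral.integral_add (hform.add hi1) hi2, intervalIntegral.integral_add hform hi1,
    intervalIntegral.integral_const_mul, h1, h2]
  ring

/-- The bilinear form is symmetric: pairing κ with ψ yields -lam ∫κ in one order and 0 in the other.
-/
theorem integral_kernel (h : IsStabilityCertificate X a b lam V κ κ1 ψ ψ1 w w1 z z1) :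
    ∫ x in (0 : ℝ)..X, κ x = 0 := by
  have hκ1c : Continuous κ1 := continuous_iff_continuousAt.2 fun x => (h.kernel2 x).continuousAt
  have hψ1c : Continuous ψ1 := continuous_iff_continuousAt.2 fun x => (h.response2 x).continuousAt
  have h1 := h.pairing (HasL2Deriv.of_hasDerivAt h.kernel1 hκ1c) h.periodic_kernel h.response1
    h.response2 h.periodic_response
  have h2 := h.pairing (HasL2Deriv.of_hasDerivAt h.response1 hψ1c) h.periodic_response h.kernel1
    (μ := 0) (fun x => (h.kernel2 x).congr_deriv (by ring)) h.periodic_kernel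
  have h3 : ∫ x in (0 : ℝ)..X, (κ1 x * ψ1 x - V x * κ x * ψ x) =
      ∫ x in (0 : ℝ)..X, (ψ1 x * κ1 x - V x * ψ x * κ x) :=
    intervalIntegral.integral_congr fun x _ => by ring
  rw [h1, h2] at h3
  have := h.lam_pos
  simpa [this.ne'] using h3

/-- Otherwise ψ would vanish at both division points and have nonnegative form, whereas its form
equals -lam ∫ψ < 0. -/
theorem response_ne (h : IsStabilityCertificate X a b lam V κ κ1 ψ ψ1 w w1 z z1) : ψ b ≠ 0 := by
  intro h0
  have hψ1c : Continuous ψ1 := continuous_iff_continuousAt.2 fun x => (h.response2 x).continuousAt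
  have hψ := HasL2Deriv.of_hasDerivAt h.response1 hψ1c
  have h1 := (h.form_of_vanish hψ h.periodic_response
    (periodic_of_hasDerivAt h.response1 h.periodic_response) (h.response_even.trans h0) h0).1
  have h2 := h.pairing hψ h.periodic_response h.response1 h.response2 h.periodic_response
  have h3 : ∫ x in (0 : ℝ)..X, (ψ1 x ^ 2 - V x * ψ x ^ 2) =
      ∫ x in (0 : ℝ)..X, (ψ1 x * ψ1 x - V x * ψ x * ψ x) :=
    intervalIntegral.integral_congr fun x _ => by ring
  rw [h3, h2] at h1
  have := mul_pos h.lam_pos h.mean_pos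
  linarith

/-- The second variation is nonnegative on zero-mean functions, with kernel spanned by `κ`. -/
theorem form_nonneg (h : IsStabilityCertificate X a b lam V κ κ1 ψ ψ1 w w1 z z1)
    {u v : ℝ → ℝ} (hu : HasL2Deriv u v) (hper : Function.Periodic u X)
    (hperv : Function.Periodic v X) (hmean : ∫ x in (0 : ℝ)..X, u x = 0) :
    0 ≤ ∫ x in (0 : ℝ)..X, (v x ^ 2 - V x * u x ^ 2) ∧
      ((∫ x in (0 : ℝ)..X, (v x ^ 2 - V x * u x ^ 2)) = 0 → ∃ c, ∀ x, u x = c * κ x) := by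
  -- The coefficients make u + cκ + dψ vanish at a and b: κ takes opposite values there and cancels
  -- the difference, ψ takes equal values and cancels the sum.
  set c := -(u b - u a) / (2 * κ b) with hc
  set d := -(u a + u b) / (2 * ψ b) with hd
  have hκb := h.kernel_ne
  have hψb := h.response_ne
  have hκc : Continuous κ := continuous_iff_continuousAt.2 fun x => (h.kernel1 x).continuousAt
  have hψc : Continuous ψ := continuous_iff_continuousAt.2 fun x => (h.response1 x).continuousAt
  have hκ1c : Continuous κ1 := continuous_iff_continuousAt.2 fun x => (h.kernel2 x).continuousAt
  have hψ1c : Continuous ψ1 := continuous_iff_continuousAt.2 fun x => (h.response2 x).continuousAt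
  have hf : ∀ x, HasDerivAt (fun x => c * κ x + d * ψ x) (c * κ1 x + d * ψ1 x) x := fun x =>
    ((h.kernel1 x).const_mul c).add ((h.response1 x).const_mul d)
  have hf1 : ∀ x, HasDerivAt (fun x => c * κ1 x + d * ψ1 x)
      (d * lam - V x * (c * κ x + d * ψ x)) x := fun x =>
    (((h.kernel2 x).const_mul c).add ((h.response2 x).const_mul d)).congr_deriv (by ring)
  have hfper : Function.Periodic (fun x => c * κ x + d * ψ x) X := fun x => by
    simp only [h.periodic_kernel x, h.periodic_response x]
  have hf1per := periodic_of_hasDerivAt hf hfper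
  have hexp := h.form_add hu hper hf hf1 hfper
  have hint : ∫ x in (0 : ℝ)..X, (c * κ x + d * ψ x) = d * ∫ x in (0 : ℝ)..X, ψ x := by
    rw [intervalIntegral.integral_add (Continuous.intervalIntegrable (by fun_prop) _ _)
      (Continuous.intervalIntegrable (by fun_prop) _ _), intervalIntegral.integral_const_mul,
      intervalIntegral.integral_const_mul, h.integral_kernel, mul_zero, zero_add]
  rw [hmean, hint] at hexp
  obtain ⟨h1, h2⟩ := h.form_of_vanish (hu.add hf (by fun_prop))
    (fun x => congrArg₂ (· + ·) (hper x) (hfper x)) (fun x => congrArg₂ (· + ·) (hperv x) (hf1per x))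
    (by simp only [h.kernel_odd, h.response_even, hc, hd]; field_simp; ring)
    (by simp only [hc, hd]; field_simp; ring)
  rw [hexp] at h1 h2
  have h3 := mul_pos h.lam_pos h.mean_pos
  have h4 := mul_nonneg (sq_nonneg d) h3.le
  refine ⟨by linarith, fun h0 => ?_⟩
  rw [h0] at h1 h2
  have hd0 : d = 0 := by
    by_contra hne
    have : 0 < d ^ 2 := by positivity
    have := mul_pos this h3
    linarith
  refine ⟨-c, fun x => ?_⟩
  have := h2 (by rw [hd0]; ring) x
  rw [hd0] at this
  linarith

end IsStabilityCertificate

/-! ### Weak derivatives and absolutely continuous representatives. -/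

/-- A smooth compactly supported function with zero integral has a compactly supported smooth
antiderivative. -/
theorem exists_compact_antideriv {η : ℝ → ℝ} (hη : ContDiff ℝ ∞ η) (hs : HasCompactSupport η)
    (h0 : ∫ x, η x = 0) :
    ∃ Φ : ℝ → ℝ, ContDiff ℝ ∞ Φ ∧ HasCompactSupport Φ ∧ deriv Φ = η := by
  obtain ⟨N, hN⟩ := hs.isBounded.subset_closedBall 0
  rw [Real.closedBall_eq_Icc, zero_sub, zero_add] at hN
  set R := |N| + 1 with hR
  have hRpos : 0 < R := by positivity
  have hout : ∀ x, x ∉ Ioo (-R) R → η x = 0 := fun x hx => by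
    by_contra hne
    have h1 := hN (subset_tsupport η hne)
    have h2 := le_abs_self N
    exact hx ⟨by linarith [h1.1], by linarith [h1.2]⟩
  have hc := hη.continuous
  have hd : ∀ x, HasDerivAt (fun x => ∫ s in (-R)..x, η s) (η x) x := fun x =>
    (hc.integral_hasStrictDerivAt _ x).hasDerivAt
  have hderiv : deriv (fun x => ∫ s in (-R)..x, η s) = η := funext fun x => (hd x).deriv
  refine ⟨fun x => ∫ s in (-R)..x, η s, ?_, ?_, hderiv⟩
  · rw [contDiff_infty_iff_deriv, hderiv]
    exact ⟨fun x => (hd x).differentiableAt, hη⟩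
  · refine HasCompactSupport.intro (isCompact_Icc (a := -R) (b := R)) fun x hx => ?_
    rw [mem_Icc, not_and_or, not_le, not_le] at hx
    rcases hx with hx | hx
    · rw [intervalIntegral.integral_symm, intervalIntegral.integral_of_le hx.le, neg_eq_zero]
      exact setIntegral_eq_zero_of_forall_eq_zero fun y hy =>
        hout y fun hy' => absurd hy'.1 (not_lt.2 hy.2)
    · rw [intervalIntegral.integral_of_le (by linarith), ← h0]
      exact setIntegral_eq_integral_of_forall_compl_eq_zero fun y hy =>
        hout y fun hy' => hy ⟨hy'.1, hy'.2.le.trans hx.le⟩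

/-- The du Bois-Reymond lemma on the line. -/
theorem ae_eq_const_of_integral_mul_deriv_eq_zero {G : ℝ → ℝ} (hG : LocallyIntegrable G)
    (h : ∀ φ : ℝ → ℝ, ContDiff ℝ ∞ φ → HasCompactSupport φ → ∫ x, G x * deriv φ x = 0) :
    ∃ c, ∀ᵐ x, G x = c := by
  let χ : ContDiffBump (0 : ℝ) := ⟨1, 2, by norm_num, by norm_num⟩
  set ρ := χ.normed volume with hρ
  have hρd : ContDiff ℝ ∞ ρ := χ.contDiff_normed
  have hρs : HasCompactSupport ρ := χ.hasCompactSupport_normed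
  have hρ1 : ∫ x, ρ x = 1 := χ.integral_normed
  set c := ∫ x, G x * ρ x with hc
  refine ⟨c, ?_⟩
  have hint : ∀ {φ : ℝ → ℝ}, ContDiff ℝ ∞ φ → HasCompactSupport φ →
      Integrable (fun x => G x * φ x) := fun hφ hs => by
    simpa [mul_comm] using hG.integrable_smul_left_of_hasCompactSupport hφ.continuous hs
  have hφint : ∀ {φ : ℝ → ℝ}, ContDiff ℝ ∞ φ → HasCompactSupport φ → Integrable φ :=
    fun hφ hs => hφ.continuous.integrable_of_hasCompactSupport hs
  have := ae_eq_zero_of_integral_contDiff_smul_eq_zero (f := fun x => G x - c)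
    (hG.sub continuous_const.locallyIntegrable) fun φ hφ hs => by
      set m := ∫ x, φ x with hm
      -- Subtracting m times the unit-mass bump gives φ zero integral, so it becomes the derivative
      -- of a test function; the constant is c = ∫ Gρ.
      have hηd : ContDiff ℝ ∞ fun x => φ x - m * ρ x := hφ.sub (contDiff_const.mul hρd)
      have hηs : HasCompactSupport fun x => φ x - m * ρ x := hs.sub hρs.mul_left
      have hη0 : ∫ x, (φ x - m * ρ x) = 0 := by
        rw [integral_sub (hφint hφ hs) ((hφint hρd hρs).const_mul m), integral_const_mul, hρ1]
        simp [hm]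
      obtain ⟨Φ, hΦ, hΦs, hΦd⟩ := exists_compact_antideriv hηd hηs hη0
      have h1 := h Φ hΦ hΦs
      rw [hΦd] at h1
      have h2 : ∀ x, G x * (φ x - m * ρ x) = G x * φ x - m * (G x * ρ x) := fun x => by ring
      simp only [h2] at h1
      rw [integral_sub (hint hφ hs) ((hint hρd hρs).const_mul m), integral_const_mul, ← hc] at h1
      have h3 : ∀ x, φ x • (G x - c) = G x * φ x - c * φ x := fun x => by
        rw [smul_eq_mul]; ring
      simp only [h3]
      rw [integral_sub (hint hφ hs) ((hφint hφ hs).const_mul c), integral_const_mul, ← hm]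
      linarith
  filter_upwards [this] with x hx
  linarith

/-- The primitive F of v differs from u by a function with zero weak derivative, hence by a constant
almost everywhere. Continuity of F + c upgrades its almost-everywhere periodicity to periodicity. -/
theorem IsH1Circle.exists_hasL2Deriv {X : ℝ} {u v : ℝ → ℝ} (hX : 0 < X) (h : IsH1Circle X u v) :
    ∃ U, HasL2Deriv U v ∧ u =ᵐ[volume] U ∧ Function.Periodic U X := by
  have hfin : IsFiniteMeasure (volume.restrict (Ioc 0 X)) := ⟨by simp⟩
  have hv0 : IntervalIntegrable v volume 0 X := by
    rw [intervalIntegrable_iff_integrableOn_Ioc_of_le hX.le]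
    exact h.memLp_deriv.integrable (by norm_num)
  have hu0 : IntervalIntegrable u volume 0 X := by
    rw [intervalIntegrable_iff_integrableOn_Ioc_of_le hX.le]
    exact h.memLp.integrable (by norm_num)
  have hsq0 : IntervalIntegrable (fun x => v x ^ 2) volume 0 X := by
    rw [intervalIntegrable_iff_integrableOn_Ioc_of_le hX.le]
    exact h.memLp_deriv.integrable_sq
  have hint : ∀ a b, IntervalIntegrable v volume a b :=
    h.periodic_deriv.intervalIntegrable₀ hX.ne' hv0
  have huint : ∀ a b, IntervalIntegrable u volume a b :=
    h.periodic.intervalIntegrable₀ hX.ne' hu0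
  have hsq : ∀ a b, IntervalIntegrable (fun x => v x ^ 2) volume a b :=
    Function.Periodic.intervalIntegrable₀ (fun x => by simp only [h.periodic_deriv x]) hX.ne' hsq0
  have hloc : ∀ {f : ℝ → ℝ}, (∀ a b, IntervalIntegrable f volume a b) → LocallyIntegrable f := by
    intro f hf x
    refine ⟨Ioc (x - 1) (x + 1), Ioc_mem_nhds (by linarith) (by linarith), ?_⟩
    exact (intervalIntegrable_iff_integrableOn_Ioc_of_le (by linarith)).1 (hf _ _)
  set F : ℝ → ℝ := fun x => ∫ s in (0 : ℝ)..x, v s with hF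
  have hFac : ∀ a b, AbsolutelyContinuousOnInterval F a b := fun a b =>
    ((hint (min (min a b) 0) (max (max a b) 0)).absolutelyContinuousOnInterval_intervalIntegral
      (c := 0) (by rw [mem_uIcc]; exact Or.inl ⟨min_le_right _ _, le_max_right _ _⟩)).mono
      (by
        rw [uIcc_of_le (a := min (min a b) 0)
          ((min_le_right _ _).trans (le_max_right (max a b) 0))]
        exact Icc_subset_Icc (min_le_left _ _) (le_max_left _ _))
  have hFd : ∀ᵐ x, HasDerivAt F (v x) x := by
    filter_upwards [LocallyIntegrable.ae_hasDerivAt_integral (hloc hint)] with x hx using hx 0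
  have hFL : HasL2Deriv F v := ⟨hFac, hFd, hint, hsq⟩
  have hFc := hFL.continuous
  have hweak : ∀ φ : ℝ → ℝ, ContDiff ℝ ∞ φ → HasCompactSupport φ →
      ∫ x, (u x - F x) * deriv φ x = 0 := by
    intro φ hφ hs
    have hφd : ContDiff ℝ ∞ (deriv φ) := (contDiff_infty_iff_deriv.1 hφ).2
    obtain ⟨N, hN⟩ := hs.isBounded.subset_closedBall 0
    rw [Real.closedBall_eq_Icc, zero_sub, zero_add] at hN
    have hN' : tsupport φ ⊆ Icc (-(|N|)) |N| :=
      hN.trans (Icc_subset_Icc (neg_le_neg (le_abs_self N)) (le_abs_self N))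
    set R := |N| + 1 with hR
    have hRpos : 0 < R := by positivity
    have hoff : ∀ x, x ∉ Ioc (-R) R → φ x = 0 ∧ deriv φ x = 0 := by
      intro x hx
      have hx' : x ∉ tsupport φ := fun h' => by
        have := hN' h'
        exact hx ⟨by linarith [this.1], by linarith [this.2]⟩
      exact ⟨image_eq_zero_of_notMem_tsupport hx',
        by
          by_contra hne
          exact hx' (support_deriv_subset hne)⟩
    have hoffR : φ R = 0 := image_eq_zero_of_notMem_tsupport fun h' => by
      have := (hN' h').2; linarith
    have hibp := hFL.integral_by_parts (f := φ) (f1 := deriv φ)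
      (fun x => (hφ.differentiable (by simp) x).hasDerivAt) hφd.continuous (-R) R
    rw [hoffR, (hoff (-R) (by simp)).1, mul_zero, mul_zero, sub_zero,
      intervalIntegral.integral_of_le (by linarith)] at hibp
    rw [setIntegral_eq_integral_of_forall_compl_eq_zero
      (fun x hx => by rw [(hoff x hx).1, (hoff x hx).2]; ring)] at hibp
    have hi1 : Integrable fun x => v x * φ x := by
      simpa [mul_comm] using
        (hloc hint).integrable_smul_left_of_hasCompactSupport hφ.continuous hs
    have hi2 : Integrable fun x => F x * deriv φ x := by
      simpa [mul_comm] using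
        hFc.locallyIntegrable.integrable_smul_left_of_hasCompactSupport hφd.continuous hs.deriv
    have hi3 : Integrable fun x => u x * deriv φ x := by
      simpa [mul_comm] using
        (hloc huint).integrable_smul_left_of_hasCompactSupport hφd.continuous hs.deriv
    rw [integral_add hi1 hi2] at hibp
    simp only [sub_mul]
    rw [integral_sub hi3 hi2, h.weak_deriv φ hφ hs]
    linarith
  obtain ⟨c, hc⟩ := ae_eq_const_of_integral_mul_deriv_eq_zero
    ((hloc huint).sub hFc.locallyIntegrable) hweak
  have hUL : HasL2Deriv (fun x => F x + c) v := by
    have := hFL.add (f := fun _ => c) (f1 := fun _ => 0) (fun x => hasDerivAt_const x c)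
      continuous_const
    simpa using this
  have hae : u =ᵐ[volume] fun x => F x + c := by
    filter_upwards [hc] with x hx
    simp only [Pi.sub_apply] at hx
    linarith
  refine ⟨_, hUL, hae, fun x => ?_⟩
  have hshift : (fun x => u (x + X)) =ᵐ[volume] fun x => F (x + X) + c :=
    (measurePreserving_add_right volume X).quasiMeasurePreserving.ae_eq_comp hae
  have h1 : (fun x => F (x + X) + c) =ᵐ[volume] fun x => F x + c := by
    filter_upwards [hshift, hae] with x hx1 hx2
    rw [← hx1, ← hx2, h.periodic x]
  have hc2 : Continuous fun x => F (x + X) + c := by fun_prop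
  exact congrFun ((hc2.ae_eq_iff_eq volume hUL.continuous).1 h1) x

/-! ### Expansion of the energy around a profile. -/

/-- `H' = H₁` and `H₁' = B y^(q-1)` on the half-line. -/
def IsPrimitivePair (q B : ℝ) (H H₁ : ℝ → ℝ) : Prop :=
  ∀ y, 0 < y → HasDerivAt H (H₁ y) y ∧ HasDerivAt H₁ (B * y ^ (q - 1)) y

/-- `h` is a positive `X`-periodic solution of `h'' + (B h^q - D)/q = 0`, with `h' = h1`. -/
structure IsProfile (q B D X : ℝ) (h h1 : ℝ → ℝ) : Prop where
  deriv1 : ∀ x, HasDerivAt h (h1 x) x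
  deriv2 : ∀ x, HasDerivAt h1 (-((B * h x ^ q - D) / q)) x
  pos : ∀ x, 0 < h x
  periodic : Function.Periodic h X
  period_pos : 0 < X

section PrimitivePair

variable {q B : ℝ} {H H₁ : ℝ → ℝ}

theorem IsPrimitivePair.continuousOn (hH : IsPrimitivePair q B H H₁) : ContinuousOn H (Ioi 0) :=
  fun y hy => (hH y hy).1.continuousAt.continuousWithinAt

theorem IsPrimitivePair.continuousOn1 (hH : IsPrimitivePair q B H H₁) : ContinuousOn H₁ (Ioi 0) :=
  fun y hy => (hH y hy).2.continuousAt.continuousWithinAt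

theorem IsPrimitivePair.exists_eq (hH : IsPrimitivePair q B H H₁) (hq : 1 < q) :
    ∃ C, ∀ y, 0 < y → H₁ y = B * y ^ q / q + C := by
  have hd : ∀ y ∈ Ioi (0 : ℝ), HasDerivAt (fun y => H₁ y - B * y ^ q / q) 0 y := by
    intro y hy
    have h1 := (hH y hy).2.sub (((Real.hasDerivAt_rpow_const (x := y) (p := q)
      (Or.inl (ne_of_gt hy))).const_mul B).div_const q)
    refine h1.congr_deriv ?_
    have : q ≠ 0 := by linarith
    field_simp
    ring
  refine ⟨H₁ 1 - B * 1 ^ q / q, fun y hy => ?_⟩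
  have := isOpen_Ioi.is_const_of_deriv_eq_zero isPreconnected_Ioi
    (fun y hy => (hd y hy).differentiableAt.differentiableWithinAt)
    (fun y hy => (hd y hy).deriv) hy (one_pos : (0 : ℝ) < 1)
  linarith

/-- Second-order Taylor estimate for the potential, uniformly for arguments bounded below. -/
theorem IsPrimitivePair.taylor (hH : IsPrimitivePair q B H H₁) (hq1 : 1 < q) (hq2 : q < 2)
    (hB : 0 < B) {m : ℝ} (hm : 0 < m) : ∃ L, 0 ≤ L ∧ ∀ y δ, m ≤ y → |δ| ≤ m / 2 →
      |H (y + δ) - H y - H₁ y * δ - B * y ^ (q - 1) * δ ^ 2 / 2| ≤ L * |δ| ^ 3 := by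
  -- This bounds H''' on [m/2, ∞), where y^(q-2) is decreasing because q < 2.
  set L := B * ((q - 1) * (m / 2) ^ (q - 1 - 1)) with hL
  have hL0 : 0 ≤ L := by
    have : 0 < q - 1 := by linarith
    positivity
  refine ⟨L, hL0, fun y δ hy hδ => ?_⟩
  have hposs : ∀ s ∈ Icc (-|δ|) |δ|, m / 2 ≤ y + s := fun s hs => by linarith [hs.1]
  have hconv : Convex ℝ (Icc (-|δ|) |δ|) := convex_Icc _ _
  have h0 : (0 : ℝ) ∈ Icc (-|δ|) |δ| := ⟨by linarith [abs_nonneg δ], abs_nonneg δ⟩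
  have habs : ∀ s ∈ Icc (-|δ|) |δ|, |s| ≤ |δ| := fun s hs => abs_le.2 hs
  have h2 : ∀ s ∈ Icc (-|δ|) |δ|, |B * (y + s) ^ (q - 1) - B * y ^ (q - 1)| ≤ L * |δ| := by
    intro s hs
    have := hconv.norm_image_sub_le_of_norm_hasDerivWithin_le (C := L)
      (f := fun s => B * (y + s) ^ (q - 1)) (f' := fun s => B * ((q - 1) * (y + s) ^ (q - 1 - 1)))
      (fun z hz => by
        have hpos : 0 < y + z := (half_pos hm).trans_le (hposs z hz)
        have h1 := (Real.hasDerivAt_rpow_const (x := y + z) (p := q - 1)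
          (Or.inl hpos.ne')).comp_const_add y z
        exact (h1.const_mul B).hasDerivWithinAt)
      (fun z hz => by
        have hpos : 0 < y + z := (half_pos hm).trans_le (hposs z hz)
        have hq : 0 < q - 1 := by linarith
        rw [Real.norm_of_nonneg (by positivity)]
        have := Real.rpow_le_rpow_of_nonpos (half_pos hm) (hposs z hz)
          (show q - 1 - 1 ≤ 0 by linarith)
        exact mul_le_mul_of_nonneg_left (mul_le_mul_of_nonneg_left this hq.le) hB.le) h0 hs
    simp only [add_zero, sub_zero, Real.norm_eq_abs] at this
    exact this.trans (mul_le_mul_of_nonneg_left (habs s hs) hL0)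
  have h1 : ∀ s ∈ Icc (-|δ|) |δ|, |H₁ (y + s) - H₁ y - B * y ^ (q - 1) * s| ≤
      L * |δ| * |δ| := by
    intro s hs
    have := hconv.norm_image_sub_le_of_norm_hasDerivWithin_le (C := L * |δ|)
      (f := fun s => H₁ (y + s) - H₁ y - B * y ^ (q - 1) * s)
      (f' := fun s => B * (y + s) ^ (q - 1) - B * y ^ (q - 1))
      (fun z hz => by
        have hpos : 0 < y + z := (half_pos hm).trans_le (hposs z hz)
        have h1 := (hH _ hpos).2.comp_const_add y z
        exact (((h1.sub_const (H₁ y)).sub ((hasDerivAt_id z).const_mul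
          (B * y ^ (q - 1)))).congr_deriv (by ring)).hasDerivWithinAt) h2 h0 hs
    simp only [add_zero, sub_zero, sub_self, mul_zero, Real.norm_eq_abs] at this
    exact this.trans (mul_le_mul_of_nonneg_left (habs s hs) (by positivity))
  have hδI : δ ∈ Icc (-|δ|) |δ| := ⟨neg_abs_le δ, le_abs_self δ⟩
  have := hconv.norm_image_sub_le_of_norm_hasDerivWithin_le (C := L * |δ| * |δ|)
      (f := fun s => H (y + s) - H y - H₁ y * s - B * y ^ (q - 1) * s ^ 2 / 2)
      (f' := fun s => H₁ (y + s) - H₁ y - B * y ^ (q - 1) * s)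
      (fun z hz => by
        have hpos : 0 < y + z := (half_pos hm).trans_le (hposs z hz)
        have h1 := (hH _ hpos).1.comp_const_add y z
        refine ((((h1.sub_const (H y)).sub ((hasDerivAt_id z).const_mul (H₁ y))).sub
          ((((hasDerivAt_id z).pow 2).const_mul (B * y ^ (q - 1))).div_const 2)).congr_deriv
            ?_).hasDerivWithinAt
        simp only [id]
        push_cast
        ring) h1 h0 hδI
  simp only [add_zero, sub_zero, sub_self, mul_zero, Real.norm_eq_abs] at this
  norm_num at this
  calc _ ≤ L * |δ| * |δ| * |δ| := this
    _ = L * |δ| ^ 3 := by ring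

/-- Strict concavity of `y^(q-1)` makes the symmetric second difference of `H` subquadratic. -/
theorem IsPrimitivePair.second_difference_lt (hH : IsPrimitivePair q B H H₁) (hq1 : 1 < q)
    (hq2 : q < 2) (hB : 0 < B) {y s : ℝ} (hs : s ≠ 0) (hsy : |s| < y) :
    H (y + s) + H (y - s) - 2 * H y < B * y ^ (q - 1) * s ^ 2 := by
  wlog hpos : 0 < s generalizing s
  · have := this (s := -s) (neg_ne_zero.2 hs) (by rwa [abs_neg])
      (neg_pos.2 (lt_of_le_of_ne (not_lt.1 hpos) hs))
    rw [sub_neg_eq_add, ← sub_eq_add_neg, neg_sq] at this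
    linarith
  rw [abs_of_pos hpos] at hsy
  have hy : 0 < y := hpos.trans hsy
  have hp : ∀ t ∈ Icc 0 s, 0 < y + t ∧ 0 < y - t := fun t ht =>
    ⟨by linarith [ht.1], by linarith [ht.2]⟩
  have hd1 : ∀ t ∈ Icc 0 s, HasDerivAt
      (fun t => B * y ^ (q - 1) * t ^ 2 - (H (y + t) + H (y - t)))
      (2 * (B * y ^ (q - 1)) * t - (H₁ (y + t) - H₁ (y - t))) t := by
    intro t ht
    have h1 := (hH _ (hp t ht).1).1.comp_const_add y t
    have h2 := (hH _ (hp t ht).2).1.comp_const_sub y t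
    refine ((((hasDerivAt_id t).pow 2).const_mul (B * y ^ (q - 1))).sub (h1.add h2)).congr_deriv ?_
    simp only [id]
    push_cast
    ring
  have hd2 : ∀ t ∈ Icc 0 s, HasDerivAt
      (fun t => 2 * (B * y ^ (q - 1)) * t - (H₁ (y + t) - H₁ (y - t)))
      (2 * (B * y ^ (q - 1)) - (B * (y + t) ^ (q - 1) + B * (y - t) ^ (q - 1))) t := by
    intro t ht
    have h1 := (hH _ (hp t ht).1).2.comp_const_add y t
    have h2 := (hH _ (hp t ht).2).2.comp_const_sub y t
    refine (((hasDerivAt_id t).const_mul (2 * (B * y ^ (q - 1)))).sub (h1.sub h2)).congr_deriv ?_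
    ring
  have hmono1 : StrictMonoOn
      (fun t => 2 * (B * y ^ (q - 1)) * t - (H₁ (y + t) - H₁ (y - t))) (Icc 0 s) := by
    refine strictMonoOn_of_deriv_pos (convex_Icc _ _)
      (fun t ht => (hd2 t ht).continuousAt.continuousWithinAt) fun t ht => ?_
    rw [interior_Icc] at ht
    have ht' := Ioo_subset_Icc_self ht
    rw [(hd2 t ht').deriv]
    -- Since 0 < q - 1 < 1, strict concavity at the midpoint y of y ± t makes the second derivative
    -- of the difference positive.
    have hconc := (Real.strictConcaveOn_rpow (p := q - 1) (by linarith) (by linarith)).2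
      (show y + t ∈ Ici (0 : ℝ) from (hp t ht').1.le) (show y - t ∈ Ici (0 : ℝ) from (hp t ht').2.le)
      (by linarith [ht.1]) (show (0 : ℝ) < 1 / 2 by norm_num) (show (0 : ℝ) < 1 / 2 by norm_num)
      (by norm_num)
    simp only [smul_eq_mul] at hconc
    rw [show 1 / 2 * (y + t) + 1 / 2 * (y - t) = y by ring] at hconc
    nlinarith
  have hmono2 : StrictMonoOn
      (fun t => B * y ^ (q - 1) * t ^ 2 - (H (y + t) + H (y - t))) (Icc 0 s) := by
    refine strictMonoOn_of_deriv_pos (convex_Icc _ _)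
      (fun t ht => (hd1 t ht).continuousAt.continuousWithinAt) fun t ht => ?_
    rw [interior_Icc] at ht
    have ht' := Ioo_subset_Icc_self ht
    rw [(hd1 t ht').deriv]
    have := hmono1 ⟨le_rfl, hpos.le⟩ ht' ht.1
    simpa using this
  have := hmono2 ⟨le_rfl, hpos.le⟩ ⟨hpos.le, le_rfl⟩ hpos
  simp only [add_zero, sub_zero] at this
  norm_num at this
  linarith

end PrimitivePair

namespace IsProfile

variable {q B D X : ℝ} {h h1 H H₁ : ℝ → ℝ}

theorem continuous (hp : IsProfile q B D X h h1) : Continuous h :=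
  continuous_iff_continuousAt.2 fun x => (hp.deriv1 x).continuousAt

theorem continuous1 (hp : IsProfile q B D X h h1) : Continuous h1 :=
  continuous_iff_continuousAt.2 fun x => (hp.deriv2 x).continuousAt

theorem continuous_rpow (hp : IsProfile q B D X h h1) (p : ℝ) : Continuous fun x => h x ^ p :=
  hp.continuous.rpow_const fun x => Or.inl (hp.pos x).ne'

theorem periodic1 (hp : IsProfile q B D X h h1) : Function.Periodic h1 X :=
  periodic_of_hasDerivAt hp.deriv1 hp.periodic

theorem hasDerivAt_force (hp : IsProfile q B D X h h1) (hq : 1 < q) (x : ℝ) :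
    HasDerivAt (fun x => -((B * h x ^ q - D) / q)) (-(B * h x ^ (q - 1) * h1 x)) x := by
  have h2 := (((((hp.deriv1 x).rpow_const (p := q) (Or.inl (hp.pos x).ne')).const_mul B).sub_const
    D).div_const q).neg
  refine h2.congr_deriv ?_
  have : q ≠ 0 := by linarith
  field_simp

/-- The first variation vanishes on zero-mean perturbations. -/
theorem first_variation (hp : IsProfile q B D X h h1) (hq : 1 < q)
    (hH : IsPrimitivePair q B H H₁) {u v : ℝ → ℝ} (hu : HasL2Deriv u v)
    (hper : Function.Periodic u X) (hmean : ∫ x in (0 : ℝ)..X, u x = 0) :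
    ∫ x in (0 : ℝ)..X, (v x * h1 x - H₁ (h x) * u x) = 0 := by
  obtain ⟨C, hC⟩ := hH.exists_eq hq
  have hF : Continuous fun x => -((B * h x ^ q - D) / q) :=
    continuous_iff_continuousAt.2 fun x => (hp.hasDerivAt_force hq x).continuousAt
  have hibp := hu.integral_by_parts hp.deriv2 hF 0 X
  have e1 := hper 0
  have e2 := hp.periodic1 0
  rw [zero_add] at e1 e2
  rw [e1, e2, sub_self] at hibp
  have huc := hu.continuous
  have hi1 : IntervalIntegrable (fun x => v x * h1 x + u x * -((B * h x ^ q - D) / q)) volume 0 X :=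
    (hu.mul_int hp.continuous1 _ _).add ((huc.mul hF).intervalIntegrable _ _)
  have hi2 : IntervalIntegrable (fun x => (D / q + C) * u x) volume 0 X :=
    (huc.const_mul _).intervalIntegrable _ _
  -- The constant D/q + C acts as a Lagrange multiplier: its contribution is a multiple of the mean
  -- of u.
  have : ∀ x, v x * h1 x - H₁ (h x) * u x =
      (v x * h1 x + u x * -((B * h x ^ q - D) / q)) - (D / q + C) * u x := by
    intro x
    rw [hC _ (hp.pos x)]
    ring
  simp only [this]
  rw [intervalIntegral.integral_sub hi1 hi2, hibp, intervalIntegral.integral_const_mul, hmean]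
  ring

theorem energy_integrable (hp : IsProfile q B D X h h1) (hH : IsPrimitivePair q B H H₁)
    {u v : ℝ → ℝ} (hu : HasL2Deriv u v) {ε : ℝ} (hpos : ∀ x, 0 < h x + ε * u x) :
    IntervalIntegrable (fun x => 1 / 2 * (h1 x + ε * v x) ^ 2 - H (h x + ε * u x)) volume 0 X := by
  have h1c := hp.continuous1
  have hu' := hu.continuous
  have hhc := hp.continuous
  have e : (fun x => 1 / 2 * (h1 x + ε * v x) ^ 2 - H (h x + ε * u x)) = fun x =>
      (ε ^ 2 / 2 * v x ^ 2 + v x * (ε * h1 x)) + (1 / 2 * h1 x ^ 2 - H (h x + ε * u x)) := by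
    funext x; ring
  rw [e]
  refine (((hu.sq 0 X).const_mul _).add (hu.mul_int (by fun_prop) _ _)).add
    (Continuous.intervalIntegrable ?_ _ _)
  have : Continuous fun x => H (h x + ε * u x) :=
    hH.continuousOn.comp_continuous (by fun_prop) fun x => hpos x
  exact (continuous_const.mul (h1c.pow 2)).sub this

/-- A positive second variation forces an energy increase for small perturbations. -/
theorem energy_lt_of_form_pos (hp : IsProfile q B D X h h1) (hq1 : 1 < q) (hq2 : q < 2)
    (hB : 0 < B) (hH : IsPrimitivePair q B H H₁) {u v : ℝ → ℝ} (hu : HasL2Deriv u v)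
    (hper : Function.Periodic u X) (hmean : ∫ x in (0 : ℝ)..X, u x = 0)
    (hQ : 0 < ∫ x in (0 : ℝ)..X, (v x ^ 2 - B * h x ^ (q - 1) * u x ^ 2)) :
    ∀ᶠ ε : ℝ in 𝓝[>] 0, energy X H h h1 <
      energy X H (fun x => h x + ε * u x) (fun x => h1 x + ε * v x) := by
  obtain ⟨m, M, hm, hmM⟩ := exists_bounds_of_periodic hp.continuous hp.pos hp.period_pos hp.periodic
  obtain ⟨L, hL, hT⟩ := hH.taylor hq1 hq2 hB hm
  have huc := hu.continuous
  -- Adding 1 makes the function positive, as the bounding lemma requires, and makes K positive.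
  obtain ⟨m', K, -, hK⟩ := exists_bounds_of_periodic (k := fun x => |u x| + 1) (by fun_prop)
    (fun x => by positivity) hp.period_pos (fun x => by simp only [hper x])
  have hK' : ∀ x, |u x| ≤ K := fun x => by linarith [(hK x).2]
  have hKpos : 0 < K := by linarith [(hK 0).2, abs_nonneg (u 0)]
  set Q := ∫ x in (0 : ℝ)..X, (v x ^ 2 - B * h x ^ (q - 1) * u x ^ 2) with hQdef
  have hX := hp.period_pos
  -- The first bound keeps εu within the Taylor range m/2; the second keeps the cubic error ε³LK³X
  -- below ε²Q/2. The added 1 keeps the denominator positive even when L = 0.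
  have hev1 : ∀ᶠ ε : ℝ in 𝓝[>] 0, ε < m / (2 * K) :=
    eventually_nhdsWithin_of_eventually_nhds (gt_mem_nhds (by positivity))
  have hev2 : ∀ᶠ ε : ℝ in 𝓝[>] 0, ε < Q / (2 * (L * K ^ 3 * X + 1)) :=
    eventually_nhdsWithin_of_eventually_nhds (gt_mem_nhds (by positivity))
  filter_upwards [hev1, hev2, self_mem_nhdsWithin] with ε hε1 hε2 hε0
  have hε0 : 0 < ε := hε0
  rw [lt_div_iff₀ (by positivity)] at hε1 hε2
  have hδ : ∀ x, |ε * u x| ≤ ε * K := fun x => by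
    rw [abs_mul, abs_of_pos hε0]
    exact mul_le_mul_of_nonneg_left (hK' x) hε0.le
  have hδ' : ∀ x, |ε * u x| ≤ m / 2 := fun x => (hδ x).trans (by linarith)
  have hpos : ∀ x, 0 < h x + ε * u x := fun x => by
    linarith [(abs_le.1 (hδ' x)).1, (hmM x).1]
  have hi1 := hp.energy_integrable hH hu hpos
  have hhc := hp.continuous
  have h1c := hp.continuous1
  have hH0 : Continuous fun x => H (h x) :=
    hH.continuousOn.comp_continuous hp.continuous fun x => hp.pos x
  have hH1 : Continuous fun x => H₁ (h x) :=
    hH.continuousOn1.comp_continuous hp.continuous fun x => hp.pos x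
  have hi0 : IntervalIntegrable (fun x => 1 / 2 * h1 x ^ 2 - H (h x)) volume 0 X :=
    ((continuous_const.mul (h1c.pow 2)).sub hH0).intervalIntegrable _ _
  have hi2 : IntervalIntegrable (fun x => ε * (v x * h1 x - H₁ (h x) * u x)) volume 0 X :=
    ((hu.mul_int h1c _ _).sub ((hH1.mul huc).intervalIntegrable _ _)).const_mul ε
  have hi3 : IntervalIntegrable
      (fun x => ε ^ 2 / 2 * (v x ^ 2 - B * h x ^ (q - 1) * u x ^ 2)) volume 0 X :=
    (hu.form_integrable (continuous_const.mul (hp.continuous_rpow (q - 1))) _ _).const_mul _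
  have hle : ∫ x in (0 : ℝ)..X, ((1 / 2 * h1 x ^ 2 - H (h x)) +
        ε * (v x * h1 x - H₁ (h x) * u x) +
        ε ^ 2 / 2 * (v x ^ 2 - B * h x ^ (q - 1) * u x ^ 2) - L * (ε * K) ^ 3) ≤
      ∫ x in (0 : ℝ)..X, (1 / 2 * (h1 x + ε * v x) ^ 2 - H (h x + ε * u x)) := by
    refine intervalIntegral.integral_mono_on hX.le
      (((hi0.add hi2).add hi3).sub intervalIntegrable_const) hi1 fun x _ => ?_
    have h2 := (abs_le.1 (hT (h x) (ε * u x) (hmM x).1 (hδ' x))).2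
    have h3 : L * |ε * u x| ^ 3 ≤ L * (ε * K) ^ 3 := by
      have := hδ x
      gcongr
    linarith
  rw [intervalIntegral.integral_sub ((hi0.add hi2).add hi3) intervalIntegrable_const,
    intervalIntegral.integral_add (hi0.add hi2) hi3, intervalIntegral.integral_add hi0 hi2,
    intervalIntegral.integral_const_mul, intervalIntegral.integral_const_mul,
    hp.first_variation hq1 hH hu hper hmean, intervalIntegral.integral_const, smul_eq_mul,
    ← hQdef] at hle
  refine lt_of_lt_of_le ?_ hle
  have h4 : 0 < ε ^ 2 * (Q / 2 - ε * (L * K ^ 3 * X)) :=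
    mul_pos (by positivity) (by nlinarith)
  have h5 : energy X H h h1 = ∫ x in (0 : ℝ)..X, (1 / 2 * h1 x ^ 2 - H (h x)) := rfl
  rw [h5]
  have h6 : ε ^ 2 / 2 * Q - (X - 0) * (L * (ε * K) ^ 3) =
    ε ^ 2 * (Q / 2 - ε * (L * K ^ 3 * X)) := by ring
  linarith

/-- The second variation vanishes along translations. -/
theorem form_translation (hp : IsProfile q B D X h h1) (hq : 1 < q) :
    ∫ x in (0 : ℝ)..X, ((-((B * h x ^ q - D) / q)) ^ 2 - B * h x ^ (q - 1) * h1 x ^ 2) = 0 := by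
  have hF : Continuous fun x => -((B * h x ^ q - D) / q) :=
    continuous_iff_continuousAt.2 fun x => (hp.hasDerivAt_force hq x).continuousAt
  have h1c := hp.continuous1
  have hr := hp.continuous_rpow (q - 1)
  have hibp := (HasL2Deriv.of_hasDerivAt hp.deriv2 hF).integral_by_parts (hp.hasDerivAt_force hq)
    (by fun_prop) 0 X
  have e1 := periodic_of_hasDerivAt hp.deriv2 hp.periodic1 0
  have e2 := hp.periodic1 0
  rw [zero_add] at e1 e2
  rw [e1, e2, sub_self] at hibp
  refine Eq.trans ?_ hibp
  exact intervalIntegral.integral_congr fun x _ => by ring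

/-- Along translations the energy increases strictly, although the second variation vanishes. -/
theorem energy_lt_translation (hp : IsProfile q B D X h h1) (hq1 : 1 < q) (hq2 : q < 2)
    (hB : 0 < B) (hH : IsPrimitivePair q B H H₁) {x₀ : ℝ} (heven : ∀ x, h (2 * x₀ - x) = h x)
    {δ : ℝ} (hδ : δ ≠ 0) (hsmall : ∀ x, |δ * h1 x| < h x) {y : ℝ} (hy : y ∈ Icc 0 X)
    (hy1 : h1 y ≠ 0) :
    energy X H h h1 < energy X H (fun x => h x + δ * h1 x)
      (fun x => h1 x + δ * -((B * h x ^ q - D) / q)) := by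
  set F : ℝ → ℝ := fun x => -((B * h x ^ q - D) / q) with hFdef
  have hF : Continuous F :=
    continuous_iff_continuousAt.2 fun x => (hp.hasDerivAt_force hq1 x).continuousAt
  have hF0 := hp.form_translation hq1
  change ∫ x in (0 : ℝ)..X, (F x ^ 2 - B * h x ^ (q - 1) * h1 x ^ 2) = 0 at hF0
  have hodd : ∀ x, h1 (2 * x₀ - x) = -h1 x := by
    intro x
    have h2 := (hp.deriv1 (2 * x₀ - x)).comp_const_sub (2 * x₀) x
    rw [show (fun x => h (2 * x₀ - x)) = h from funext heven] at h2
    have := h2.unique (hp.deriv1 x)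
    linarith
  have hFeven : ∀ x, F (2 * x₀ - x) = F x := fun x => by simp only [hFdef, heven]
  have hFper : Function.Periodic F X := fun x => by simp only [hFdef, hp.periodic x]
  have hhc := hp.continuous
  have h1c := hp.continuous1
  have hr := hp.continuous_rpow (q - 1)
  have hpos : ∀ x, 0 < h x + δ * h1 x := fun x => by linarith [(abs_lt.1 (hsmall x)).1]
  have hpos' : ∀ x, 0 < h x - δ * h1 x := fun x => by linarith [(abs_lt.1 (hsmall x)).2]
  have hH0 : Continuous fun x => H (h x) :=
    hH.continuousOn.comp_continuous hhc fun x => hp.pos x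
  have hHp : Continuous fun x => H (h x + δ * h1 x) :=
    hH.continuousOn.comp_continuous (by fun_prop) fun x => hpos x
  have hHm : Continuous fun x => H (h x - δ * h1 x) :=
    hH.continuousOn.comp_continuous (by fun_prop) fun x => hpos' x
  set Ep : ℝ → ℝ := fun x => 1 / 2 * (h1 x + δ * F x) ^ 2 - H (h x + δ * h1 x) with hEp
  set Em : ℝ → ℝ := fun x => 1 / 2 * (h1 x - δ * F x) ^ 2 - H (h x - δ * h1 x) with hEm
  set E0 : ℝ → ℝ := fun x => 1 / 2 * h1 x ^ 2 - H (h x) with hE0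
  have hEpc : Continuous Ep :=
    (continuous_const.mul ((h1c.add (continuous_const.mul hF)).pow 2)).sub hHp
  have hEmc : Continuous Em :=
    (continuous_const.mul ((h1c.sub (continuous_const.mul hF)).pow 2)).sub hHm
  have hE0c : Continuous E0 := (continuous_const.mul (h1c.pow 2)).sub hH0
  -- Reflection about x₀ fixes h and changes the sign of h', so it exchanges the perturbations by δ
  -- and -δ.
  have hsymm : ∫ x in (0 : ℝ)..X, Em x = ∫ x in (0 : ℝ)..X, Ep x := by
    have hper : Function.Periodic Ep X := fun x => by
      simp only [hEp, hp.periodic x, hp.periodic1 x, hFper x]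
    have e1 := intervalIntegral.integral_comp_sub_left (a := 0) (b := X) Ep (2 * x₀)
    have e2 := hper.intervalIntegral_add_eq (2 * x₀ - X) 0
    rw [show 2 * x₀ - X + X = 2 * x₀ - 0 by ring, zero_add] at e2
    rw [← e2, ← e1]
    refine intervalIntegral.integral_congr fun x _ => ?_
    simp only [hEp, hEm, heven, hodd, hFeven]
    congr 1
    · ring
    · congr 1; ring
  have hkey : 0 < ∫ x in (0 : ℝ)..X, (B * h x ^ (q - 1) * (δ * h1 x) ^ 2 -
      (H (h x + δ * h1 x) + H (h x - δ * h1 x) - 2 * H (h x))) := by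
    refine intervalIntegral.integral_pos hp.period_pos (Continuous.continuousOn
      (((continuous_const.mul hr).mul ((continuous_const.mul h1c).pow 2)).sub
        ((hHp.add hHm).sub (continuous_const.mul hH0)))) (fun x _ => ?_) ⟨y, hy, ?_⟩
    · rcases eq_or_ne (h1 x) 0 with h0 | h0
      · simp only [h0, mul_zero, add_zero, sub_zero]
        apply le_of_eq
        ring
      · have := hH.second_difference_lt hq1 hq2 hB (mul_ne_zero hδ h0) (hsmall x)
        linarith
    · have := hH.second_difference_lt hq1 hq2 hB (mul_ne_zero hδ hy1) (hsmall y)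
      linarith
  -- The second difference of the energy is δ² times the second variation, which is zero along h',
  -- plus the defect of H shown positive above.
  have hsum : ∫ x in (0 : ℝ)..X, (B * h x ^ (q - 1) * (δ * h1 x) ^ 2 -
      (H (h x + δ * h1 x) + H (h x - δ * h1 x) - 2 * H (h x))) =
      (∫ x in (0 : ℝ)..X, Ep x) + (∫ x in (0 : ℝ)..X, Em x) - 2 * (∫ x in (0 : ℝ)..X, E0 x) -
        δ ^ 2 * ∫ x in (0 : ℝ)..X, (F x ^ 2 - B * h x ^ (q - 1) * h1 x ^ 2) := by
    have e : ∀ x, B * h x ^ (q - 1) * (δ * h1 x) ^ 2 -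
        (H (h x + δ * h1 x) + H (h x - δ * h1 x) - 2 * H (h x)) =
        Ep x + Em x - 2 * E0 x - δ ^ 2 * (F x ^ 2 - B * h x ^ (q - 1) * h1 x ^ 2) := fun x => by
      simp only [hEp, hEm, hE0]; ring
    have i1 := hEpc.intervalIntegrable (μ := volume) 0 X
    have i2 := hEmc.intervalIntegrable (μ := volume) 0 X
    have i3 := (hE0c.intervalIntegrable (μ := volume) 0 X).const_mul 2
    have i4 : IntervalIntegrable
        (fun x => δ ^ 2 * (F x ^ 2 - B * h x ^ (q - 1) * h1 x ^ 2)) volume 0 X :=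
      Continuous.intervalIntegrable (by fun_prop) _ _
    simp only [e]
    rw [intervalIntegral.integral_sub ((i1.add i2).sub i3) i4,
      intervalIntegral.integral_sub (i1.add i2) i3, intervalIntegral.integral_add i1 i2,
      intervalIntegral.integral_const_mul, intervalIntegral.integral_const_mul]
  rw [hsum, hsymm, hF0] at hkey
  change (∫ x in (0 : ℝ)..X, E0 x) < ∫ x in (0 : ℝ)..X, Ep x
  linarith

end IsProfile

/-! ### From steady states to the canonical oscillator. -/

theorem not_periodic_of_deriv_neg {f f' : ℝ → ℝ} {X : ℝ} (hX : 0 < X)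
    (hf : ∀ x, HasDerivAt f (f' x) x) (hneg : ∀ x, f' x < 0) : ¬ Function.Periodic f X := by
  intro hper
  have hanti : StrictAnti f := strictAnti_of_deriv_neg fun x => by rw [(hf x).deriv]; exact hneg x
  have h1 := hanti hX
  have h2 := hper 0
  rw [zero_add] at h2
  exact h1.ne h2

/-- Positive periodic steady states satisfy a second-order equation. -/
theorem IsPositiveSteadyState.exists_isProfile {n m q B X : ℝ} {h : ℝ → ℝ} (hq : q = m - n + 1)
    (hq1 : 1 < q) (hB : 0 < B) (hX : 0 < X) (hper : Function.Periodic h X)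
    (hss : IsPositiveSteadyState (fun y => y ^ n) (fun y => B * y ^ m) h) :
    ∃ D, 0 < D ∧ IsProfile q B D X h (deriv h) := by
  obtain ⟨hC4, hpos, heq⟩ := hss
  have hq0 : q ≠ 0 := by linarith
  have hd0 : ∀ x, HasDerivAt h (deriv h x) x := fun x =>
    (hC4.differentiable (by norm_num) x).hasDerivAt
  have hd1 : ∀ x, HasDerivAt (deriv h) (iteratedDeriv 2 h x) x := fun x =>
    (hasDerivAt_of_contDiff_two (hC4.of_le (by norm_num)) x).2
  have hd2 : ∀ x, HasDerivAt (iteratedDeriv 2 h) (iteratedDeriv 3 h x) x := fun x => by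
    rw [iteratedDeriv_succ (n := 2)]
    exact (hC4.differentiable_iteratedDeriv 2 (by norm_num) x).hasDerivAt
  have hd3 : ∀ x, DifferentiableAt ℝ (iteratedDeriv 3 h) x := fun x =>
    hC4.differentiable_iteratedDeriv 3 (by norm_num) x
  have hpow : ∀ (p : ℝ) x, HasDerivAt (fun y => h y ^ p) (deriv h x * p * h x ^ (p - 1)) x :=
    fun p x => (hd0 x).rpow_const (Or.inl (hpos x).ne')
  have hcpow : ∀ p : ℝ, Continuous fun y => h y ^ p := fun p =>
    hC4.continuous.rpow_const fun x => Or.inl (hpos x).ne'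
  have hJ1 : ∀ x, DifferentiableAt ℝ (fun y => h y ^ n * iteratedDeriv 3 h y) x := fun x =>
    (hpow n x).differentiableAt.mul (hd3 x)
  have hJ2 : ∀ x, DifferentiableAt ℝ (fun y => B * h y ^ m * deriv h y) x := fun x =>
    ((hpow m x).differentiableAt.const_mul B).mul (hd1 x).differentiableAt
  have hconst : ∀ x, h x ^ n * iteratedDeriv 3 h x + B * h x ^ m * deriv h x =
      h 0 ^ n * iteratedDeriv 3 h 0 + B * h 0 ^ m * deriv h 0 := fun x =>
    is_const_of_deriv_eq_zero
      (f := fun x => h x ^ n * iteratedDeriv 3 h x + B * h x ^ m * deriv h x)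
      (fun x => (hJ1 x).add (hJ2 x))
      (fun x => ((hJ1 x).hasDerivAt.add (hJ2 x).hasDerivAt).deriv.trans (heq x)) x 0
  set C := h 0 ^ n * iteratedDeriv 3 h 0 + B * h 0 ^ m * deriv h 0
  -- Dividing the constant flux by h^n makes the left side the derivative of h'' + B h^q/q.
  have hflux : ∀ x, iteratedDeriv 3 h x + B * h x ^ (q - 1) * deriv h x = C * h x ^ (-n) := by
    intro x
    have h1 : h x ^ (q - 1) = h x ^ m * h x ^ (-n) := by
      rw [← Real.rpow_add (hpos x)]; congr 1; rw [hq]; ring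
    have h2 : h x ^ n * h x ^ (-n) = 1 := by rw [← Real.rpow_add (hpos x)]; simp
    rw [h1, ← hconst x]
    linear_combination -(iteratedDeriv 3 h x) * h2
  have hS : ∀ x, HasDerivAt (fun x => iteratedDeriv 2 h x + B * h x ^ q / q) (C * h x ^ (-n)) x := by
    intro x
    refine ((hd2 x).add (((hpow q x).const_mul B).div_const q)).congr_deriv ?_
    rw [← hflux]
    field_simp
  have hper1 := periodic_of_hasDerivAt hd0 hper
  have hper2 := periodic_of_hasDerivAt hd1 hper1
  -- Integrating over a period gives C ∫ h^(-n) = 0 with a positive integral.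
  have hC : C = 0 := by
    have h1 := intervalIntegral.integral_eq_sub_of_hasDerivAt (a := 0) (b := X)
      (fun x _ => hS x) (((hcpow (-n)).const_mul C).intervalIntegrable _ _)
    have e1 := hper 0
    have e2 := hper2 0
    rw [zero_add] at e1 e2
    rw [e1, e2, sub_self, intervalIntegral.integral_const_mul] at h1
    refine (mul_eq_zero.1 h1).resolve_right (ne_of_gt ?_)
    exact intervalIntegral.intervalIntegral_pos_of_pos ((hcpow (-n)).intervalIntegrable _ _)
      (fun x => Real.rpow_pos_of_pos (hpos x) _) hX
  set c := iteratedDeriv 2 h 0 + B * h 0 ^ q / q with hc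
  have hcx : ∀ x, iteratedDeriv 2 h x + B * h x ^ q / q = c := fun x =>
    is_const_of_deriv_eq_zero (f := fun x => iteratedDeriv 2 h x + B * h x ^ q / q)
      (fun x => (hS x).differentiableAt) (fun x => by rw [(hS x).deriv, hC, zero_mul]) x 0
  -- If c ≤ 0 then h'' < 0 everywhere, which a periodic h' forbids.
  have hcpos : 0 < c := by
    by_contra hneg
    refine not_periodic_of_deriv_neg hX hd1 (fun x => ?_) hper1
    have h1 : 0 < B * h x ^ q / q := by
      have := Real.rpow_pos_of_pos (hpos x) q
      have : 0 < q := by linarith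
      positivity
    linarith [hcx x]
  refine ⟨q * c, by have : 0 < q := by linarith
                    positivity, hd0, fun x => (hd1 x).congr_deriv ?_, hpos, hper, hX⟩
  rw [← hcx x]
  field_simp
  ring

/-- The scaling relations behind `RescalesTo`. -/
theorem scaling_relations {q B D : ℝ} (hq1 : 1 < q) (hB : 0 < B) (hD : 0 < D) :
    ∃ a s, 0 < a ∧ 0 < s ∧ a ^ q = B / D ∧ a * s ^ 2 * D = 1 ∧ a = (B / D) ^ (1 / q) ∧
      ∀ x : ℝ, (D / B) ^ (1 / (2 * q)) * (x / D ^ ((1 : ℝ) / 2)) = s * x := by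
  have hq0 : q ≠ 0 := by linarith
  have hBD : 0 < B / D := by positivity
  have hDB : 0 < D / B := by positivity
  have h1 := Real.rpow_pos_of_pos hBD (1 / q)
  have h2 := Real.rpow_pos_of_pos hDB (1 / (2 * q))
  have h3 := Real.rpow_pos_of_pos hD ((1 : ℝ) / 2)
  refine ⟨(B / D) ^ (1 / q), (D / B) ^ (1 / (2 * q)) / D ^ ((1 : ℝ) / 2), h1, by positivity, ?_, ?_,
    rfl, fun x => by ring⟩
  · rw [← Real.rpow_mul hBD.le, one_div, inv_mul_cancel₀ hq0, Real.rpow_one]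
  · have e1 : ((D / B) ^ (1 / (2 * q))) ^ 2 = (D / B) ^ (1 / q) := by
      rw [← Real.rpow_natCast, ← Real.rpow_mul hDB.le]
      congr 1
      push_cast
      field_simp
    have e2 : (D ^ ((1 : ℝ) / 2)) ^ 2 = D := by
      rw [← Real.rpow_natCast, ← Real.rpow_mul hD.le]
      norm_num
    have e3 : (B / D) ^ (1 / q) * (D / B) ^ (1 / q) = 1 := by
      rw [← Real.mul_rpow hBD.le hDB.le, div_mul_div_cancel₀ hD.ne', div_self hB.ne',
        Real.one_rpow]
    rw [div_pow, e1, e2]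
    field_simp
    linarith

theorem IsProfile.hasDerivAt_rescale {q B D X : ℝ} {h h1 : ℝ → ℝ} (hp : IsProfile q B D X h h1)
    (hD : 0 < D) {a s : ℝ} (ha : 0 < a) (haq : a ^ q = B / D) (has : a * s ^ 2 * D = 1)
    (x₀ t : ℝ) :
    HasDerivAt (fun t => a * h (x₀ + s * t)) (a * s * h1 (x₀ + s * t)) t ∧
      HasDerivAt (fun t => a * s * h1 (x₀ + s * t))
        (-(((a * h (x₀ + s * t)) ^ q - 1) / q)) t := by
  have hs : HasDerivAt (fun t => x₀ + s * t) s t :=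
    (((hasDerivAt_id t).const_mul s).const_add x₀).congr_deriv (mul_one s)
  refine ⟨(((hp.deriv1 _).comp t hs).const_mul a).congr_deriv (by ring),
    (((hp.deriv2 _).comp t hs).const_mul (a * s)).congr_deriv ?_⟩
  rw [Real.mul_rpow ha.le (hp.pos _).le, haq]
  have : a * s * (-((B * h (x₀ + s * t) ^ q - D) / q) * s) =
      -((a * s ^ 2 * D) * (B / D * h (x₀ + s * t) ^ q - 1) / q) := by
    field_simp
  rw [this, has, one_mul]

/-- A non-constant profile rescales to some `k_α`. -/
theorem IsProfile.exists_rescalesTo {q B D X : ℝ} {h : ℝ → ℝ} (hq1 : 1 < q) (hB : 0 < B)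
    (hD : 0 < D) (hp : IsProfile q B D X h (deriv h)) (hnc : ¬ ∃ c : ℝ, ∀ x, h x = c) {x₀ : ℝ}
    (hmin : ∀ x, h x₀ ≤ h x) :
    ∃ α ∈ Ioo (0 : ℝ) 1, RescalesTo q B α (fun x => h (x₀ + x)) := by
  obtain ⟨a, s, ha, hs, haq, has, haeq, hsx⟩ := scaling_relations hq1 hB hD
  have hq0 : 0 < q := by linarith
  set k : ℝ → ℝ := fun t => a * h (x₀ + s * t) with hk
  have hdk := hp.hasDerivAt_rescale hD ha haq has x₀
  have hkpos : ∀ t, 0 < k t := fun t => mul_pos ha (hp.pos _)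
  have hkc : Continuous k := continuous_iff_continuousAt.2 fun t => (hdk t).1.continuousAt
  have hkper : Function.Periodic k (X / s) := fun t => by
    simp only [hk]
    rw [show x₀ + s * (t + X / s) = x₀ + s * t + X by field_simp; ring, hp.periodic]
  have hXs : 0 < X / s := div_pos hp.period_pos hs
  have hk0 : deriv h x₀ = 0 :=
    IsLocalMin.deriv_eq_zero (Eventually.of_forall hmin)
  have hkmin : ∀ t, k 0 ≤ k t := fun t => by
    simp only [hk, mul_zero, add_zero]
    exact mul_le_mul_of_nonneg_left (hmin _) ha.le
  have hFc : Continuous fun t => -((k t ^ q - 1) / q) :=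
    (((hkc.rpow_const fun t => Or.inl (hkpos t).ne').sub continuous_const).div_const q).neg
  have hcan : IsCanonicalSolution q (k 0) k := by
    refine ⟨contDiff_two_of_hasDerivAt (fun t => (hdk t).1) (fun t => (hdk t).2) hFc, hkpos,
      ⟨_, hXs, hkper⟩, fun t => ?_, rfl, ?_⟩
    · rw [iteratedDeriv_two_eq (fun t => (hdk t).1) (fun t => (hdk t).2)]
      simp only [hk]
      ring
    · rw [(hdk 0).1.deriv]
      simp [hk0]
  -- A minimum equal to 1 would force k to be the equilibrium 1 by uniqueness; a minimum above 1
  -- would give k'' < 0 everywhere.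
  have hlt : k 0 < 1 := by
    by_contra hge
    rw [not_lt] at hge
    rcases hge.eq_or_lt with h1 | h1
    · have hone : IsCanonicalSolution q (k 0) fun _ => 1 := by
        refine ⟨contDiff_const, fun _ => one_pos, ⟨1, one_pos, fun _ => rfl⟩, fun t => ?_, h1, ?_⟩
        · rw [iteratedDeriv_two_eq (fun t => hasDerivAt_const t (1 : ℝ))
            (fun t => hasDerivAt_const t (0 : ℝ))]
          simp
        · simp
      have heq := hcan.unique hq1 hone
      refine hnc ⟨1 / a, fun x => ?_⟩
      have := congrFun heq ((x - x₀) / s)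
      simp only [hk] at this
      rw [show x₀ + s * ((x - x₀) / s) = x by field_simp; ring] at this
      rw [eq_div_iff ha.ne']
      linarith
    · refine not_periodic_of_deriv_neg hXs (fun t => (hdk t).2) (fun t => ?_)
        (periodic_of_hasDerivAt (fun t => (hdk t).1) hkper)
      have := Real.one_lt_rpow (h1.trans_le (hkmin t)) hq0
      exact neg_neg_of_pos (div_pos (by simp only [hk] at this; linarith) hq0)
  refine ⟨k 0, ⟨hkpos 0, hlt⟩, D, hD, fun x => ?_, fun x => ?_⟩
  · have hd : ∀ x, HasDerivAt (fun x => h (x₀ + x)) (deriv h (x₀ + x)) x := fun x =>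
      (hp.deriv1 _).comp_const_add x₀ x
    have hd' : ∀ x, HasDerivAt (fun x => deriv h (x₀ + x)) (-((B * h (x₀ + x) ^ q - D) / q)) x :=
      fun x => (hp.deriv2 _).comp_const_add x₀ x
    rw [iteratedDeriv_two_eq hd hd']
    ring
  · rw [hcan.eq_canonicalSolution hq1]
    simp only [hk, hsx, ← haeq]

/-! ### Energy stability of the steady state. -/

theorem energy_congr {X : ℝ} {H l l' dl dl' : ℝ → ℝ} (h1 : l =ᵐ[volume] l')
    (h2 : dl =ᵐ[volume] dl') : energy X H l dl = energy X H l' dl' := by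
  refine intervalIntegral.integral_congr_ae ?_
  filter_upwards [h1, h2] with x hx1 hx2 _
  rw [hx1, hx2]

/-- Energy stability from a stability certificate whose kernel is `h'`. -/
theorem IsProfile.energyStable {q B D X a b lam : ℝ} {h H H₁ κ κ1 ψ ψ1 w w1 z z1 : ℝ → ℝ}
    (hq1 : 1 < q) (hq2 : q < 2) (hB : 0 < B) (hp : IsProfile q B D X h (deriv h))
    (hH : IsPrimitivePair q B H H₁) {x₀ : ℝ} (heven : ∀ x, h (2 * x₀ - x) = h x)
    (hcert : IsStabilityCertificate X a b lam (fun x => B * h x ^ (q - 1)) κ κ1 ψ ψ1 w w1 z z1)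
    {c : ℝ} (hκ : ∀ x, κ x = c * deriv h x) : EnergyStable X H h := by
  intro u v huv hne hmean
  obtain ⟨U, hU, huU, hUper⟩ := huv.exists_hasL2Deriv hp.period_pos
  have hmeanU : ∫ x in (0 : ℝ)..X, U x = 0 := by
    refine (intervalIntegral.integral_congr_ae ?_).trans hmean
    filter_upwards [huU] with x hx _ using hx.symm
  have hcongr : ∀ ε : ℝ, energy X H (fun x => h x + ε * u x) (fun x => deriv h x + ε * v x) =
      energy X H (fun x => h x + ε * U x) (fun x => deriv h x + ε * v x) := fun ε =>
    energy_congr (by filter_upwards [huU] with x hx; rw [hx]) EventuallyEq.rfl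
  simp only [hcongr]
  obtain ⟨h1, h2⟩ := hcert.form_nonneg hU hUper huv.periodic_deriv hmeanU
  -- A vanishing second variation leaves only multiples of h', where the strict increase comes from
  -- beyond second order.
  rcases h1.eq_or_lt with h0 | hpos
  · obtain ⟨d, hd⟩ := h2 h0.symm
    have hUh : ∀ x, U x = d * c * deriv h x := fun x => by rw [hd x, hκ x, mul_assoc]
    set F : ℝ → ℝ := fun x => -((B * h x ^ q - D) / q) with hF
    -- The weak derivative v is determined only almost everywhere, and this suffices for the energy.
    have hvF : v =ᵐ[volume] fun x => d * c * F x := by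
      filter_upwards [hU.deriv] with x hx
      have := (hp.deriv2 x).const_mul (d * c)
      rw [← show U = fun x => d * c * deriv h x from funext hUh] at this
      exact hx.unique this
    have hU0 : ∃ x, U x ≠ 0 := by
      by_contra hall
      push Not at hall
      exact hne (by filter_upwards [huU] with x hx; rw [hx, hall x]; rfl)
    obtain ⟨x, hx⟩ := hU0
    rw [hUh] at hx
    obtain ⟨hdc, hx1⟩ := mul_ne_zero_iff.1 hx
    obtain ⟨y, hy, hxy⟩ := hp.periodic1.exists_mem_Ico₀ hp.period_pos x
    rw [hxy] at hx1
    obtain ⟨m, M, hm, hmM⟩ := exists_bounds_of_periodic hp.continuous hp.pos hp.period_pos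
      hp.periodic
    have h1c := hp.continuous1
    obtain ⟨m', K, -, hK⟩ := exists_bounds_of_periodic (k := fun x => |d * c * deriv h x| + 1)
      (by fun_prop) (fun x => by positivity) hp.period_pos (fun x => by
        simp only [hp.periodic1 x])
    have hKpos : 0 < K := by linarith [(hK 0).2, abs_nonneg (d * c * deriv h 0)]
    have hev : ∀ᶠ ε : ℝ in 𝓝[>] 0, ε < m / K :=
      eventually_nhdsWithin_of_eventually_nhds (gt_mem_nhds (by positivity))
    filter_upwards [hev, self_mem_nhdsWithin] with ε hε hε0
    have hε0 : 0 < ε := hε0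
    rw [lt_div_iff₀ hKpos] at hε
    have hlt := hp.energy_lt_translation hq1 hq2 hB hH heven (δ := ε * (d * c))
      (mul_ne_zero hε0.ne' hdc) (fun x => by
        rw [mul_assoc, abs_mul, abs_of_pos hε0]
        have h3 : |d * c * deriv h x| ≤ K := by linarith [(hK x).2]
        exact ((mul_le_mul_of_nonneg_left h3 hε0.le).trans_lt hε).trans_le (hmM x).1)
      (Ico_subset_Icc_self hy) hx1
    refine hlt.trans_eq (energy_congr ?_ ?_)
    · exact Eventually.of_forall fun x => by simp only [hUh]; ring
    · filter_upwards [hvF] with x hx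
      rw [hx]
      simp only [hF]
      ring
  · exact hp.energy_lt_of_form_pos hq1 hq2 hB hH hU hUper hmeanU hpos

/-- `E'(α) < 0` implies energy stability of every profile rescaling to `k_α`. -/
theorem RescalesTo.energyStable {q B X α : ℝ} {h H H₁ : ℝ → ℝ} (hq1 : 1 < q) (hq2 : q < 2)
    (hB : 0 < B) (hC : ContDiff ℝ 2 h) (hpos : ∀ x, 0 < h x) (hX : IsLeastPeriod h X)
    (hH : IsPrimitivePair q B H H₁) {x₀ : ℝ} (hα : α ∈ Ioo (0 : ℝ) 1)
    (hr : RescalesTo q B α (fun x => h (x₀ + x)))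
    (hE : deriv (stabilityFunction q) α < 0) : EnergyStable X H h := by
  obtain ⟨D, hD, hode, hk⟩ := hr
  obtain ⟨a, s, ha, hs, haq, has, haeq, hsx⟩ := scaling_relations hq1 hB hD
  have hp : IsProfile q B D X h (deriv h) := by
    refine ⟨fun x => (hasDerivAt_of_contDiff_two hC x).1, fun x =>
      (hasDerivAt_of_contDiff_two hC x).2.congr_deriv ?_, hpos, hX.1.2, hX.1.1⟩
    have h1 := hode (x - x₀)
    rw [iteratedDeriv_comp_const_add] at h1
    simp only [add_sub_cancel] at h1
    linarith
  obtain ⟨J, g, g1, g2, r, P, θ, ho, hgα, hEpos⟩ :=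
    exists_orbit_of_deriv_stabilityFunction_neg hq1 hα hE
  obtain ⟨a', b', ψ, ψ1, w, w1, z, z1, hcert⟩ := ho.exists_certificate hq1 hEpos
  have hkeq : ∀ t, g (r * Real.sin (θ t)) = a * h (x₀ + s * t) := fun t => by
    have h1 := hk t
    rw [← hgα, ho.canonicalSolution_eq hq1] at h1
    simp only [hsx, ← haeq] at h1
    exact h1
  have hk1eq : ∀ t, r * Real.cos (θ t) = a * s * deriv h (x₀ + s * t) := fun t => by
    have h1 := ho.hasDerivAt_k t
    rw [show (fun t => g (r * Real.sin (θ t))) = fun t => a * h (x₀ + s * t) from funext hkeq] at h1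
    exact h1.unique (hp.hasDerivAt_rescale hD ha haq has x₀ t).1
  have hinv : ∀ x, x₀ + s * (s⁻¹ * (x - x₀)) = x := fun x => by field_simp; ring
  have hxeq : ∀ x, h x = a⁻¹ * g (r * Real.sin (θ (s⁻¹ * (x - x₀)))) := fun x => by
    rw [hkeq, hinv]; field_simp
  -- Periods of h and of k_α correspond under scaling by s, and both P and X are least, so X = sP.
  have hPX : P / s⁻¹ = X := by
    rw [div_inv_eq_mul]
    refine le_antisymm ?_ (hX.2 ⟨mul_pos ho.phase.pos hs, fun x => ?_⟩)
    · rw [← le_div_iff₀ hs]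
      refine ho.isLeastPeriod.2 ⟨div_pos hp.period_pos hs, fun t => ?_⟩
      simp only [hkeq]
      rw [show x₀ + s * (t + X / s) = x₀ + s * t + X by field_simp; ring, hp.periodic]
    · rw [hxeq, hxeq x, show s⁻¹ * (x + P * s - x₀) = s⁻¹ * (x - x₀) + P by field_simp; ring]
      congr 1
      exact ho.periodic _
  have hcert' := hcert.rescale (inv_pos.2 hs) x₀
  rw [hPX] at hcert'
  have hV : (fun x => s⁻¹ ^ 2 * g (r * Real.sin (θ (s⁻¹ * (x - x₀)))) ^ (q - 1)) =
      fun x => B * h x ^ (q - 1) := by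
    funext x
    rw [hkeq, hinv, Real.mul_rpow ha.le (hpos x).le, Real.rpow_sub_one ha.ne', haq]
    -- With a^q = B/D this matches the rescaled potential k^(q-1)/s² to B h^(q-1).
    have : s⁻¹ ^ 2 = a * D := by
      field_simp
      linarith
    rw [this]
    field_simp
  rw [hV] at hcert'
  refine hp.energyStable hq1 hq2 hB hH (x₀ := x₀) (fun x => ?_) hcert' (c := a * s) fun x => ?_
  · rw [hxeq, hxeq x, show s⁻¹ * (2 * x₀ - x - x₀) = -(s⁻¹ * (x - x₀)) by ring, ho.phase.neg,
      sin_neg_pi_sub]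
  · rw [hk1eq, hinv]

theorem IsSecondAntiderivative.exists_isPrimitivePair {n m q B : ℝ} {H : ℝ → ℝ}
    (hq : q = m - n + 1) (hH : IsSecondAntiderivative (fun y => (B * y ^ m) / y ^ n) H) :
    ∃ H₁, IsPrimitivePair q B H H₁ := by
  obtain ⟨H₁, h⟩ := hH
  refine ⟨H₁, fun y hy => ⟨(h y hy).1, (h y hy).2.congr_deriv ?_⟩⟩
  simp only [hq, add_sub_cancel_right, Real.rpow_sub hy, mul_div_assoc]

end ThinFilm

theorem mainTheorem6 (n m q B X : ℝ) (h H : ℝ → ℝ)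
    (hq : q = m - n + 1) (hq1 : 1 < q) (hq2 : q < 2) (hB : 0 < B)
    (hss : ThinFilm.IsPositiveSteadyState (fun y => y ^ n) (fun y => B * y ^ m) h)
    (hnc : ¬ ∃ c : ℝ, ∀ x, h x = c)
    (hX : ThinFilm.IsLeastPeriod h X)
    (hH : ThinFilm.IsSecondAntiderivative (fun y => (B * y ^ m) / y ^ n) H)
    (x₀ : ℝ) (hmin : ∀ x, h x₀ ≤ h x) :
    (∃ α ∈ Set.Ioo (0 : ℝ) 1, ThinFilm.RescalesTo q B α (fun x => h (x₀ + x))) ∧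
    ∀ α ∈ Set.Ioo (0 : ℝ) 1, ThinFilm.RescalesTo q B α (fun x => h (x₀ + x)) →
      deriv (ThinFilm.stabilityFunction q) α < 0 → ThinFilm.EnergyStable X H h := by
  obtain ⟨D, hD, hp⟩ := hss.exists_isProfile hq hq1 hB hX.1.1 hX.1.2
  obtain ⟨H₁, hHp⟩ := hH.exists_isPrimitivePair hq
  exact ⟨hp.exists_rescalesTo hq1 hB hD hnc hmin, fun α hα hr hE =>
    hr.energyStable hq1 hq2 hB (hss.1.of_le (by norm_num)) hss.2.1 hX hHp hα hE⟩
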